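/- **Setting.** Let $n\ge 2$ and fix a smooth, nonnegative, radially non-increasing $\chi:\mathbb R^n\to\mathbb R$ supported in $\{|\xi|\le \frac43\}$ with $\chi=1$ on $\{|\xi|<\frac34\}$. Put $\varphi(\xi)=\chi(\xi/2)-\chi(\xi)$, $\dot S_j=\chi(2^{-j}D)$ and $\dot\Delta_j=\varphi(2^{-j}D)$ for $j\in\mathbb Z$, where $D=-i\nabla$. For $\sigma\in\mathbb R$ let $\dot B^{\sigma}_{2,1}(\mathbb R^n)$ be the set of (complex-valued) tempered distributions $f$ with $$\lim_{j\to-\infty}\|\dot S_jf\|_{L^\infty}=0,\qquad \|f\|_{\dot B^\sigma_{2,1}}:=\sum_{j\in\mathbb Z}2^{j\sigma}\|\dot\Delta_jf\|_{L^2}<\infty .$$ Let $\Lambda=\sqrt{-\Delta}$. For tempered $f$, a tempered distribution $g$ *represents* $\Lambda^sf$ if $m(D)g=(m\,|\cdot|^s)(D)f$ for all $m\in C_c^\infty(\mathbb R^n\setminus\{0\})$; so $g$ is determined up to a polynomial, which $\|\cdot\|_{\dot B^\sigma_{2,1}}$ does not see. For tuples $u,w$ of $n$ tempered distributions, $u\cdot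 w:=\lim_{N\to\infty}\sum_{k}\dot S_Nu_k\,\dot S_Nw_k$, if this limit exists in $\mathcal S'(\mathbb R^n)$. For $u=(u_1,\dots,u_n)$, $\|\nabla u\|_{\dot B^\sigma_{2,1}}:=\sum_{i,k}\|\partial_ku_i\|_{\dot B^\sigma_{2,1}}$. **Lemma 2.5.** Let $n\ge2$ and $-1\le s<n+1$. There is a constant $C$, depending only on $n$, $s$ and $\chi$, such that for all $v\in\dot B^{n/2}_{2,1}(\mathbb R^n)$ and all $u\in\mathcal S'(\mathbb R^n)^n$ with $\partial_ku_i\in\dot B^{n/2}_{2,1}(\mathbb R^n)$ for all $i,k$ and $\operatorname{div}u=0$ the following holds. The product $u\cdot\nabla v$ exists in $\mathcal S'$; each $\Lambda^s\partial_kv$ has a representative in $\dot B^{n/2-s-1}_{2,1}(\mathbb R^n)$, and with $\nabla\Lambda^sv$ formed from these representatives the product $u\cdot\nabla\Lambda^sv$ exists in $\mathcal S'$; $\Lambda^s(u\cdot\nabla v)$ has a representative in $\mathcal S'$; and $$\big\|\Lambda^s(u\cdot\nabla v)-u\cdot\nabla\Lambda^sv\big\|_{\dot B^{n/2-s}_{2,1}}\le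 C\,\|\nabla u\|_{\dot B^{n/2}_{2,1}}\,\|v\|_{\dot B^{n/2}_{2,1}} .$$ If moreover $s\ge0$, the representative of $\Lambda^s(u\cdot\nabla v)$ can be chosen so that, in addition, $\Lambda^s(u\cdot\nabla v)-u\cdot\nabla\Lambda^sv$ belongs to $\dot B^{n/2-s}_{2,1}(\mathbb R^n)$. -/

import Mathlib

open MeasureTheory Filter Topology
open scoped ENNReal NNReal SchwartzMap ContDiff FourierTransform LineDeriv

noncomputable section

/-- The Euclidean space `ℝⁿ`. -/
abbrev Rn (n : ℕ) : Type := EuclideanSpace ℝ (Fin n)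

/-- A Littlewood-Paley cut-off: a smooth, nonnegative, radially non-increasing function `χ` which is
supported in the ball of radius `4/3` and equal to `1` on the ball of radius `3/4`.
(`antitone` also forces `χ` to be radial.) -/
structure LPCutoff (n : ℕ) where
  toFun : Rn n → ℝ
  smooth : ContDiff ℝ ∞ toFun
  nonneg : ∀ x, 0 ≤ toFun x
  antitone : ∀ x y, ‖x‖ ≤ ‖y‖ → toFun y ≤ toFun x
  support_subset : Function.support toFun ⊆ Metric.closedBall 0 (4 / 3)
  eq_one : ∀ x ∈ Metric.ball (0 : Rn n) (3 / 4), toFun x = 1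

namespace LPCutoff

variable {n : ℕ}

/-- The annular function `φ(ξ) = χ(ξ / 2) - χ(ξ)`. -/
def phi (χ : LPCutoff n) (ξ : Rn n) : ℝ := χ.toFun ((1 / 2 : ℝ) • ξ) - χ.toFun ξ

/-- The symbol of `χ(2⁻ʲ D)`. Mathlib's Fourier transform has the kernel `exp (-2πi ⟨x, ξ⟩)`, so that
`D = -i∇` has the symbol `2πξ`. -/
def lowSymbol (χ : LPCutoff n) (j : ℤ) (ξ : Rn n) : ℂ :=
  (χ.toFun (((2 : ℝ) ^ (-j) * (2 * Real.pi)) • ξ) : ℂ)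

/-- The symbol of `φ(2⁻ʲ D)`. -/
def dyadicSymbol (χ : LPCutoff n) (j : ℤ) (ξ : Rn n) : ℂ :=
  (χ.phi (((2 : ℝ) ^ (-j) * (2 * Real.pi)) • ξ) : ℂ)

/-- The low-frequency cut-off `Ṡ_j = χ(2⁻ʲ D)` on tempered distributions. -/
def lowFreq (χ : LPCutoff n) (j : ℤ) (f : 𝓢'(Rn n, ℂ)) : 𝓢'(Rn n, ℂ) :=
  TemperedDistribution.fourierMultiplierCLM ℂ (χ.lowSymbol j) f

/-- The dyadic block `Δ̇_j = φ(2⁻ʲ D)` on tempered distributions. -/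
def dyadicBlock (χ : LPCutoff n) (j : ℤ) (f : 𝓢'(Rn n, ℂ)) : 𝓢'(Rn n, ℂ) :=
  TemperedDistribution.fourierMultiplierCLM ℂ (χ.dyadicSymbol j) f

end LPCutoff

/-- The `L^p` norm of a tempered distribution: the norm of the (unique) element of `L^p` which
represents it, and `∞` if there is none. -/
def distLpNorm {n : ℕ} (p : ℝ≥0∞) [Fact (1 ≤ p)] (f : 𝓢'(Rn n, ℂ)) : ℝ≥0∞ :=
  ⨅ (g : Lp ℂ p (volume : Measure (Rn n))) (_ : Lp.toTemperedDistribution g = f), ‖g‖ₑ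

/-- The homogeneous Besov norm `∑_{j ∈ ℤ} 2^{jσ} ‖Δ̇_j f‖_{L²}` of `Ḃ^σ_{2,1}`. -/
def besovNorm {n : ℕ} (χ : LPCutoff n) (σ : ℝ) (f : 𝓢'(Rn n, ℂ)) : ℝ≥0∞ :=
  ∑' j : ℤ, (2 : ℝ≥0∞) ^ ((j : ℝ) * σ) * distLpNorm 2 (χ.dyadicBlock j f)

/-- Membership in the homogeneous Besov space `Ḃ^σ_{2,1}(ℝⁿ)`. -/
def MemBesov {n : ℕ} (χ : LPCutoff n) (σ : ℝ) (f : 𝓢'(Rn n, ℂ)) : Prop :=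
  Tendsto (fun j : ℤ => distLpNorm ⊤ (χ.lowFreq j f)) atBot (𝓝 0) ∧ besovNorm χ σ f < ⊤

/-- The distributional partial derivative `∂_k`. -/
def partialD {n : ℕ} (k : Fin n) (f : 𝓢'(Rn n, ℂ)) : 𝓢'(Rn n, ℂ) :=
  ∂_{(EuclideanSpace.single k 1 : Rn n)} f

/-- The norm of the matrix `∇u = (∂_k u_i)` in `Ḃ^σ_{2,1}`, as the sum over its entries. -/
def gradBesovNorm {n : ℕ} (χ : LPCutoff n) (σ : ℝ) (u : Fin n → 𝓢'(Rn n, ℂ)) : ℝ≥0∞ :=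
  ∑ i : Fin n, ∑ k : Fin n, besovNorm χ σ (partialD k (u i))

/-- `g` represents `Λ^s f`, where `Λ = √(-Δ)` is the Fourier multiplier with symbol `|2πξ|`:
away from the frequency `0`, the Fourier transform of `g` is `|2πξ|^s` times that of `f`, that is,
`m(D) g = (m |2π·|^s)(D) f` for every symbol `m ∈ C_c^∞(ℝⁿ ∖ {0})`.
As usual in homogeneous spaces this determines `g` up to polynomials only, which no dyadic block
sees; at most one representative lies in a given homogeneous Besov space. -/
def IsLambda {n : ℕ} (s : ℝ) (f g : 𝓢'(Rn n, ℂ)) : Prop :=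
  ∀ m : Rn n → ℂ, ContDiff ℝ ∞ m → HasCompactSupport m → (0 : Rn n) ∉ tsupport m →
    TemperedDistribution.fourierMultiplierCLM ℂ m g =
      TemperedDistribution.fourierMultiplierCLM ℂ
        (fun ξ => m ξ * (((2 * Real.pi * ‖ξ‖) ^ s : ℝ) : ℂ)) f

/-- `p = ∑_k u_k w_k`, the product `u · w` of two tuples of tempered distributions, in the usual
sense of Littlewood-Paley theory: `∑_k (Ṡ_N u_k) (Ṡ_N w_k) → p` in `𝓢'` as `N → ∞`.
Here `U N k` is the smooth function of temperate growth which represents `Ṡ_N u_k`, so that each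
product is that of a distribution with a smooth function. -/
def IsDotProduct {n : ℕ} (χ : LPCutoff n) (u w : Fin n → 𝓢'(Rn n, ℂ)) (p : 𝓢'(Rn n, ℂ)) : Prop :=
  ∃ U : ℤ → Fin n → Rn n → ℂ,
    (∀ N k, ∃ hU : (U N k).HasTemperateGrowth,
      Function.HasTemperateGrowth.toTemperedDistribution volume hU = χ.lowFreq N (u k)) ∧
    Tendsto (fun N : ℤ => ∑ k : Fin n,
      TemperedDistribution.smulLeftCLM ℂ (U N k) (χ.lowFreq N (w k))) atTop (𝓝 p)

end

/-!
The proof takes place on the Fourier side and uses absolute values only, so that no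
paraproduct decomposition of distributions is needed.

*Densities.* A distribution `v` in `Ḃ^{n/2}_{2,1}` has an integrable Fourier transform `V`, and its
norm is equivalent to the sum `annulusSum (n/2)` of the weighted `L²` norms of `V` over dyadic
annuli (`exists_density_of_memBesov`, `besovNorm_le_annulusSum`). If all `∂_k u_i` lie in this
space, then `û_i` is the sum of `c_i δ₀` and of the regularisation `h ↦ ∫ (h - h(0)) g_i` of a
function with `∫ |η| |g_i(η)| dη < ∞` (`exists_symbols_of_memBesov_gradient`); and `div u = 0` means
`∑ η_k g_k(η) = 0` almost everywhere.

*The products.* The Fourier transform of `u · ∇Λ^s v` is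
`h ↦ ∑ c_k ∫ W_k h + ∬ (h(ζ + η) - h(ζ)) ∑ W_k(ζ) g_k(η)`, with `W_k(ζ) = 2πi ζ_k |2πζ|^s V(ζ)`. The
double integral converges absolutely thanks to `ζ · g(η) = (ζ + η) · g(η)`
(`lintegral_productIntegrand_ne_top`). The truncated products have the same form, with cut-offs in
`ζ` and `η`, so that they converge by dominated convergence (`exists_isDotProduct`). The case `s = 0`
is `u · ∇v`.

*The commutator.* Subtracting the two formulas, `Λ^s (u · ∇v) - u · ∇Λ^s v` has, away from the
origin, the density `∫ (|2πξ|^s - |2π(ξ - η)|^s) 2πi V(ξ - η) (ξ - η) · g(η) dη`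
(`isLambda_add_commutator`). With `A = |η| |g(η)|` and `B = |V|`, it is bounded by the bilinear
operator with kernel `| |ξ|^s - |ξ - η|^s | min(|ξ|, |ξ - η|) / |η|` applied to `A` and `B`. This
kernel is `≲ |ξ|^s` if one of `η`, `ξ - η` is small compared to `ξ`, and
`≲ |ξ|^s (|ξ| / |η|)^θ` with `θ = min(1, 1 - s)` otherwise. Young's inequality handles the first
case; in the second, Cauchy-Schwarz and Bernstein's inequality leave a factor `2^{(j - l)(n + θ)}`
between the frequencies `|ξ| ∼ 2^j ≲ |η| ∼ 2^l`, which is summable because `s < n + 1`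
(`annulusSum_commOp_le`).

*Representatives.* For `s ≥ 0` the commutator density is locally integrable, and defines an element
of the Besov space. For `-1 ≤ s < 0` it only satisfies `∫ |ξ|^{-s} |F(ξ)| dξ < ∞`, and is regularised
by subtracting the value of the test function at `0`; this is harmless, since neither `IsLambda` nor
the dyadic blocks see the frequency `0`.
-/

/-! ### Schwartz functions as test functions -/

/-- A continuous norm on Schwartz functions which controls the function and its gradient with the
weight `(1 + |x|)^M`. -/
noncomputable def decayNorm {n : ℕ} (M : ℕ) (h : 𝓢(Rn n, ℂ)) : ℝ :=
  2 ^ M * (Finset.Iic (M, 1)).sup (schwartzSeminormFamily ℂ (Rn n) ℂ) h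

theorem decayNorm_nonneg {n : ℕ} (M : ℕ) (h : 𝓢(Rn n, ℂ)) : 0 ≤ decayNorm M h := by
  unfold decayNorm; positivity

theorem norm_iteratedFDeriv_le_decayNorm {n : ℕ} {M k i : ℕ} (hk : k ≤ M) (hi : i ≤ 1)
    (h : 𝓢(Rn n, ℂ)) (x : Rn n) :
    (1 + ‖x‖) ^ k * ‖iteratedFDeriv ℝ i h x‖ ≤ decayNorm M h :=
  SchwartzMap.one_add_le_sup_seminorm_apply (𝕜 := ℂ) (m := (M, 1)) hk hi h x

theorem norm_apply_le_decayNorm {n : ℕ} (M : ℕ) (h : 𝓢(Rn n, ℂ)) (x : Rn n) :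
    ‖h x‖ ≤ decayNorm M h * ((1 + ‖x‖) ^ M)⁻¹ := by
  have := norm_iteratedFDeriv_le_decayNorm (le_refl M) zero_le_one h x
  rw [norm_iteratedFDeriv_zero] at this
  rw [← div_eq_mul_inv, le_div_iff₀ (by positivity)]
  linarith

theorem norm_apply_le_decayNorm' {n : ℕ} (M : ℕ) (h : 𝓢(Rn n, ℂ)) (x : Rn n) :
    ‖h x‖ ≤ decayNorm M h := by
  have := norm_iteratedFDeriv_le_decayNorm (Nat.zero_le M) zero_le_one h x
  simpa [norm_iteratedFDeriv_zero] using this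

theorem norm_fderiv_le_decayNorm {n : ℕ} {M k : ℕ} (hk : k ≤ M) (h : 𝓢(Rn n, ℂ)) (x : Rn n) :
    (1 + ‖x‖) ^ k * ‖fderiv ℝ h x‖ ≤ decayNorm M h := by
  have := norm_iteratedFDeriv_le_decayNorm hk le_rfl h x
  rwa [norm_iteratedFDeriv_one] at this

theorem norm_sub_le_decayNorm {n : ℕ} (M : ℕ) (h : 𝓢(Rn n, ℂ)) (x y : Rn n) :
    ‖h x - h y‖ ≤ decayNorm M h * ‖x - y‖ := by
  refine Convex.norm_image_sub_le_of_norm_fderiv_le (𝕜 := ℝ) (s := Set.univ)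
    (fun z _ => h.differentiableAt) (fun z _ => ?_) convex_univ (Set.mem_univ _) (Set.mem_univ _)
  simpa using norm_fderiv_le_decayNorm (Nat.zero_le M) h z

theorem norm_add_sub_le_decayNorm {n : ℕ} (M : ℕ) (h : 𝓢(Rn n, ℂ)) (x y : Rn n) (hy : ‖y‖ ≤ 1) :
    ‖h (x + y) - h x‖ ≤ decayNorm M h * (2 ^ M * ((1 + ‖x‖) ^ M)⁻¹ * ‖y‖) := by
  have key : ∀ z ∈ Metric.closedBall x 1,
      ‖fderiv ℝ h z‖ ≤ decayNorm M h * (2 ^ M * ((1 + ‖x‖) ^ M)⁻¹) := by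
    intro z hz
    have h1 := norm_fderiv_le_decayNorm (le_refl M) h z
    have hz' : ‖x‖ ≤ ‖z‖ + 1 := by
      have := norm_sub_norm_le x z
      rw [mem_closedBall_iff_norm, norm_sub_rev] at hz
      linarith
    have h2 : (1 + ‖x‖) ^ M ≤ 2 ^ M * (1 + ‖z‖) ^ M := by
      rw [← mul_pow]
      gcongr
      linarith [norm_nonneg z]
    rw [← div_eq_mul_inv, ← mul_div_assoc, le_div_iff₀ (by positivity)]
    calc ‖fderiv ℝ h z‖ * (1 + ‖x‖) ^ M ≤ ‖fderiv ℝ h z‖ * (2 ^ M * (1 + ‖z‖) ^ M) := by gcongr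
      _ = ((1 + ‖z‖) ^ M * ‖fderiv ℝ h z‖) * 2 ^ M := by ring
      _ ≤ _ := by gcongr
  have := Convex.norm_image_sub_le_of_norm_fderiv_le (𝕜 := ℝ) (s := Metric.closedBall x 1)
    (fun z _ => h.differentiableAt) key (convex_closedBall _ _)
    (Metric.mem_closedBall_self zero_le_one) (y := x + y) (by simpa using hy)
  simpa [mul_assoc] using this

/-! ### Tempered distributions given by integrals -/

/-- Integration against a fixed function defines a tempered distribution as soon as the test
objects are dominated by a Schwartz norm times a weight which makes the integral converge. The test
object `τ h` may live on another measure space than `h`. -/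
theorem exists_distribution_of_integral {n : ℕ} {X : Type*} [MeasurableSpace X] (μ : Measure X)
    (G : X → ℂ) (hG : AEStronglyMeasurable G μ) (τ : 𝓢(Rn n, ℂ) → X → ℂ)
    (hadd : ∀ h h' x, τ (h + h') x = τ h x + τ h' x) (hsmul : ∀ (a : ℂ) h x, τ (a • h) x = a * τ h x)
    (hτ : ∀ h, AEStronglyMeasurable (τ h) μ) (M : ℕ) (wt : X → ℝ)
    (hbd : ∀ h x, ‖τ h x‖ ≤ decayNorm M h * wt x) (hint : Integrable (fun x => ‖G x‖ * wt x) μ) :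
    ∃ T : 𝓢'(Rn n, ℂ), ∀ h, Integrable (fun x => τ h x * G x) μ ∧ T h = ∫ x, τ h x * G x ∂μ := by
  have hI : ∀ h, Integrable (fun x => τ h x * G x) μ := by
    intro h
    refine (hint.const_mul (decayNorm M h)).mono' ((hτ h).mul hG) (Eventually.of_forall fun x => ?_)
    rw [norm_mul]
    calc ‖τ h x‖ * ‖G x‖ ≤ (decayNorm M h * wt x) * ‖G x‖ := by gcongr; exact hbd h x
      _ = _ := by ring
  refine ⟨ContinuousLinearMap.toPointwiseConvergenceCLM _ _ _ _ <|
    SchwartzMap.mkCLMtoNormedSpace (𝕜 := ℂ) (𝕜' := ℂ) (σ := RingHom.id ℂ)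
      (fun h => ∫ x, τ h x * G x ∂μ) ?_ ?_ ?_, fun h => ⟨hI h, rfl⟩⟩
  · intro h h'
    rw [← integral_add (hI h) (hI h')]
    exact integral_congr_ae (Eventually.of_forall fun x => by simp [hadd, add_mul])
  · intro a h
    rw [RingHom.id_apply, smul_eq_mul, ← integral_const_mul]
    exact integral_congr_ae (Eventually.of_forall fun x => by simp [hsmul, mul_assoc])
  · refine ⟨Finset.Iic (M, 1), 2 ^ M * |∫ x, ‖G x‖ * wt x ∂μ|, by positivity, fun h => ?_⟩
    calc ‖∫ x, τ h x * G x ∂μ‖ ≤ ∫ x, decayNorm M h * (‖G x‖ * wt x) ∂μ := by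
          refine norm_integral_le_of_norm_le (hint.const_mul _) (Eventually.of_forall fun x => ?_)
          rw [norm_mul]
          calc ‖τ h x‖ * ‖G x‖ ≤ (decayNorm M h * wt x) * ‖G x‖ := by gcongr; exact hbd h x
            _ = _ := by ring
      _ = decayNorm M h * ∫ x, ‖G x‖ * wt x ∂μ := integral_const_mul _ _
      _ ≤ decayNorm M h * |∫ x, ‖G x‖ * wt x ∂μ| := by
          gcongr
          · exact decayNorm_nonneg _ _
          · exact le_abs_self _
      _ = _ := by unfold decayNorm; ring

/-- `T` is the tempered distribution with density `F`. -/
def HasDensity {n : ℕ} (T : 𝓢'(Rn n, ℂ)) (F : Rn n → ℂ) : Prop :=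
  ∀ h : 𝓢(Rn n, ℂ), Integrable (fun ξ => h ξ * F ξ) ∧ T h = ∫ ξ, h ξ * F ξ

/-- `T` is given by the density `F` on test functions which vanish at the origin. This determines
`T` up to a multiple of the Dirac mass at `0`, and allows `F` to be non-integrable near `0`. -/
def HasDensityAwayZero {n : ℕ} (T : 𝓢'(Rn n, ℂ)) (F : Rn n → ℂ) : Prop :=
  ∀ h : 𝓢(Rn n, ℂ), h 0 = 0 → Integrable (fun ξ => h ξ * F ξ) ∧ T h = ∫ ξ, h ξ * F ξ

theorem HasDensity.awayZero {n : ℕ} {T : 𝓢'(Rn n, ℂ)} {F : Rn n → ℂ} (hT : HasDensity T F) :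
    HasDensityAwayZero T F := fun h _ => hT h

theorem exists_hasDensity {n : ℕ} (F : Rn n → ℂ) (hF : AEStronglyMeasurable F) (M : ℕ)
    (hint : Integrable (fun ξ => ‖F ξ‖ * ((1 + ‖ξ‖) ^ M)⁻¹)) :
    ∃ T : 𝓢'(Rn n, ℂ), HasDensity T F :=
  exists_distribution_of_integral volume F hF (fun h ξ => h ξ) (fun _ _ _ => rfl)
    (fun _ _ _ => rfl) (fun h => h.continuous.aestronglyMeasurable) M _
    (fun h ξ => norm_apply_le_decayNorm M h ξ) hint

/-- The regularisation `h ↦ ∫ F (h - h(0))` of a density which is singular at the origin. -/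
theorem exists_regularized {n : ℕ} (F : Rn n → ℂ) (hF : AEStronglyMeasurable F) {θ : ℝ}
    (hθ : 0 ≤ θ) (hθ' : θ ≤ 1) (hint : Integrable (fun ξ => ‖F ξ‖ * ‖ξ‖ ^ θ)) :
    ∃ T : 𝓢'(Rn n, ℂ), ∀ h : 𝓢(Rn n, ℂ), Integrable (fun ξ => (h ξ - h 0) * F ξ) ∧
      T h = ∫ ξ, (h ξ - h 0) * F ξ := by
  refine exists_distribution_of_integral volume F hF (fun h ξ => h ξ - h 0) ?_ ?_ ?_ 0
    (fun ξ => 2 * ‖ξ‖ ^ θ) ?_ ?_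
  · intro h h' x; simp only [_root_.add_apply]; ring
  · intro a h x; simp only [_root_.smul_apply, smul_eq_mul]; ring
  · exact fun h => (h.continuous.sub continuous_const).aestronglyMeasurable
  · intro h ξ
    rcases le_total ‖ξ‖ 1 with h1 | h1
    · calc ‖h ξ - h 0‖ ≤ decayNorm 0 h * ‖ξ - 0‖ := norm_sub_le_decayNorm 0 h ξ 0
        _ ≤ decayNorm 0 h * (2 * ‖ξ‖ ^ θ) := by
          gcongr
          · exact decayNorm_nonneg _ _
          · rw [sub_zero]
            have := Real.rpow_le_rpow_of_exponent_ge' (norm_nonneg ξ) h1 hθ hθ'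
            rw [Real.rpow_one] at this
            linarith [Real.rpow_nonneg (norm_nonneg ξ) θ]
    · have := Real.one_le_rpow h1 hθ
      calc ‖h ξ - h 0‖ ≤ ‖h ξ‖ + ‖h 0‖ := norm_sub_le _ _
        _ ≤ decayNorm 0 h + decayNorm 0 h :=
          add_le_add (norm_apply_le_decayNorm' 0 h ξ) (norm_apply_le_decayNorm' 0 h 0)
        _ ≤ decayNorm 0 h * (2 * ‖ξ‖ ^ θ) := by nlinarith [decayNorm_nonneg 0 h]
  · exact (hint.const_mul 2).congr (Eventually.of_forall fun ξ => by simp only; ring)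

/-! ### Fourier multipliers on the Fourier side -/

theorem fourier_fourierMultiplierCLM {n : ℕ} (m : Rn n → ℂ) (T : 𝓢'(Rn n, ℂ))
    (h : 𝓢(Rn n, ℂ)) :
    𝓕 (TemperedDistribution.fourierMultiplierCLM ℂ m T) h
      = 𝓕 T (SchwartzMap.smulLeftCLM ℂ m h) := by
  rw [TemperedDistribution.fourierMultiplierCLM_apply, FourierTransform.fourier_fourierInv_eq]
  rfl

theorem eq_of_fourier_apply_eq {n : ℕ} {T T' : 𝓢'(Rn n, ℂ)}
    (h : ∀ φ : 𝓢(Rn n, ℂ), 𝓕 T φ = 𝓕 T' φ) : T = T' := by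
  have : 𝓕 T = 𝓕 T' := by ext φ; exact h φ
  calc T = 𝓕⁻ (𝓕 T : 𝓢'(Rn n, ℂ)) := (FourierTransform.fourierInv_fourier_eq T).symm
    _ = 𝓕⁻ (𝓕 T' : 𝓢'(Rn n, ℂ)) := by rw [this]
    _ = T' := FourierTransform.fourierInv_fourier_eq T'

theorem HasDensity.multiplier {n : ℕ} {T : 𝓢'(Rn n, ℂ)} {F m : Rn n → ℂ} (hT : HasDensity (𝓕 T) F)
    (hm : m.HasTemperateGrowth) :
    HasDensity (𝓕 (TemperedDistribution.fourierMultiplierCLM ℂ m T)) (fun ξ => m ξ * F ξ) := by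
  intro h
  obtain ⟨h1, h2⟩ := hT (SchwartzMap.smulLeftCLM ℂ m h)
  have e : (fun ξ => SchwartzMap.smulLeftCLM ℂ m h ξ * F ξ) = fun ξ => h ξ * (m ξ * F ξ) := by
    ext ξ
    rw [SchwartzMap.smulLeftCLM_apply_apply hm, smul_eq_mul]
    ring
  rw [e] at h1 h2
  exact ⟨h1, by rw [fourier_fourierMultiplierCLM, h2]⟩

theorem HasDensityAwayZero.multiplier {n : ℕ} {T : 𝓢'(Rn n, ℂ)} {F m : Rn n → ℂ}
    (hT : HasDensityAwayZero (𝓕 T) F) (hm : m.HasTemperateGrowth) (hm0 : m 0 = 0) :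
    HasDensity (𝓕 (TemperedDistribution.fourierMultiplierCLM ℂ m T)) (fun ξ => m ξ * F ξ) := by
  intro h
  obtain ⟨h1, h2⟩ := hT (SchwartzMap.smulLeftCLM ℂ m h) (by
    rw [SchwartzMap.smulLeftCLM_apply_apply hm, hm0, zero_smul])
  have e : (fun ξ => SchwartzMap.smulLeftCLM ℂ m h ξ * F ξ) = fun ξ => h ξ * (m ξ * F ξ) := by
    ext ξ
    rw [SchwartzMap.smulLeftCLM_apply_apply hm, smul_eq_mul]
    ring
  rw [e] at h1 h2
  exact ⟨h1, by rw [fourier_fourierMultiplierCLM, h2]⟩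

theorem HasDensity.ae_eq {n : ℕ} {T : 𝓢'(Rn n, ℂ)} {F F' : Rn n → ℂ} (hF : LocallyIntegrable F)
    (hF' : LocallyIntegrable F') (h : HasDensity T F) (h' : HasDensity T F') : F =ᵐ[volume] F' := by
  refine ae_eq_of_integral_contDiff_smul_eq hF hF' fun g hg hgc => ?_
  have hg₁ : HasCompactSupport (Complex.ofRealCLM ∘ g) := hgc.comp_left rfl
  have hg₂ : ContDiff ℝ ∞ (Complex.ofRealCLM ∘ g) := by fun_prop
  have h1 := (h (hg₁.toSchwartzMap hg₂)).2
  have h2 := (h' (hg₁.toSchwartzMap hg₂)).2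
  simpa using h1.symm.trans h2

theorem HasDensity.congr_ae {n : ℕ} {T : 𝓢'(Rn n, ℂ)} {F F' : Rn n → ℂ} (h : HasDensity T F)
    (hFF' : F =ᵐ[volume] F') : HasDensity T F' := by
  intro φ
  have : (fun ξ => φ ξ * F ξ) =ᵐ[volume] fun ξ => φ ξ * F' ξ := by
    filter_upwards [hFF'] with ξ hξ
    rw [hξ]
  exact ⟨(h φ).1.congr this, by rw [(h φ).2, integral_congr_ae this]⟩

theorem fourier_partialD {n : ℕ} (k : Fin n) (T : 𝓢'(Rn n, ℂ)) (h : 𝓢(Rn n, ℂ)) :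
    𝓕 (partialD k T) h =
      𝓕 T (SchwartzMap.smulLeftCLM ℂ (fun ξ : Rn n => 2 * Real.pi * Complex.I * (ξ k : ℂ)) h) := by
  have e : partialD k T = TemperedDistribution.fourierMultiplierCLM ℂ
      (fun ξ : Rn n => 2 * Real.pi * Complex.I * (ξ k : ℂ)) T := by
    have hg : (fun ξ : Rn n => (ξ k : ℂ)).HasTemperateGrowth := by
      have : (fun ξ : Rn n => ((inner ℝ ξ (EuclideanSpace.single k 1 : Rn n) : ℝ) : ℂ))
        |>.HasTemperateGrowth := by fun_prop
      simpa [EuclideanSpace.inner_single_right] using this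
    have := TemperedDistribution.lineDeriv_eq_fourierMultiplierCLM
      (EuclideanSpace.single k 1 : Rn n) T
    rw [partialD, this]
    have h2 := TemperedDistribution.fourierMultiplierCLM_smul (F := ℂ) hg
      (2 * Real.pi * Complex.I)
    have h3 : (fun ξ : Rn n => 2 * Real.pi * Complex.I * (ξ k : ℂ))
      = (2 * Real.pi * Complex.I) • (fun ξ : Rn n => (ξ k : ℂ)) := by ext; simp
    rw [h3, h2]
    simp [EuclideanSpace.inner_single_right]
  rw [e, fourier_fourierMultiplierCLM]

/-! ### The Littlewood-Paley symbols -/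

namespace LPCutoff

variable {n : ℕ} (χ : LPCutoff n)

theorem le_one (x : Rn n) : χ.toFun x ≤ 1 := by
  have h0 : χ.toFun 0 = 1 := χ.eq_one 0 (by simp)
  rw [← h0]
  exact χ.antitone 0 x (by simp)

theorem eq_zero {x : Rn n} (hx : 4 / 3 < ‖x‖) : χ.toFun x = 0 := by
  by_contra h
  have := χ.support_subset (Function.mem_support.2 h)
  rw [mem_closedBall_zero_iff] at this
  linarith

theorem norm_scaled (j : ℤ) (ξ : Rn n) :
    ‖((2 : ℝ) ^ (-j) * (2 * Real.pi)) • ξ‖ = (2 : ℝ) ^ (-j) * (2 * Real.pi) * ‖ξ‖ := by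
  rw [norm_smul, Real.norm_of_nonneg (by positivity)]

theorem lowSymbol_zero (j : ℤ) : χ.lowSymbol j 0 = 1 := by
  simp [lowSymbol, χ.eq_one 0 (by simp)]

theorem lowSymbol_eq_one {j : ℤ} {ξ : Rn n} (h : 2 * Real.pi * ‖ξ‖ < 3 / 4 * 2 ^ j) :
    χ.lowSymbol j ξ = 1 := by
  rw [lowSymbol, χ.eq_one, Complex.ofReal_one]
  rw [mem_ball_zero_iff, norm_scaled, zpow_neg, mul_assoc, inv_mul_lt_iff₀ (by positivity)]
  linarith

theorem lowSymbol_eq_zero {j : ℤ} {ξ : Rn n} (h : 4 / 3 * 2 ^ j < 2 * Real.pi * ‖ξ‖) :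
    χ.lowSymbol j ξ = 0 := by
  rw [lowSymbol, χ.eq_zero, Complex.ofReal_zero]
  rw [norm_scaled, zpow_neg, mul_assoc, lt_inv_mul_iff₀ (by positivity)]
  linarith

theorem norm_lowSymbol_le (j : ℤ) (ξ : Rn n) : ‖χ.lowSymbol j ξ‖ ≤ 1 := by
  rw [lowSymbol, Complex.norm_real, Real.norm_of_nonneg (χ.nonneg _)]
  exact χ.le_one _

theorem dyadicSymbol_eq (j : ℤ) (ξ : Rn n) :
    χ.dyadicSymbol j ξ = χ.lowSymbol (j + 1) ξ - χ.lowSymbol j ξ := by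
  rw [dyadicSymbol, phi, lowSymbol, lowSymbol, Complex.ofReal_sub, smul_smul]
  have : 1 / 2 * ((2 : ℝ) ^ (-j) * (2 * Real.pi)) = 2 ^ (-(j + 1)) * (2 * Real.pi) := by
    rw [neg_add, zpow_add₀ (by norm_num)]
    simp only [zpow_neg_one]
    ring
  rw [this]

theorem contDiff_lowSymbol (j : ℤ) : ContDiff ℝ ∞ (χ.lowSymbol j) := by
  have := χ.smooth
  unfold lowSymbol
  exact Complex.ofRealCLM.contDiff.comp (this.comp (contDiff_const_smul _))

theorem hasCompactSupport_lowSymbol (j : ℤ) : HasCompactSupport (χ.lowSymbol j) := by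
  refine HasCompactSupport.intro
    (isCompact_closedBall (0 : Rn n) (4 / 3 * 2 ^ j / (2 * Real.pi))) fun ξ hξ => ?_
  apply χ.lowSymbol_eq_zero
  rw [mem_closedBall_zero_iff, not_le, div_lt_iff₀ (by positivity)] at hξ
  linarith

theorem hasTemperateGrowth_lowSymbol (j : ℤ) : (χ.lowSymbol j).HasTemperateGrowth :=
  (χ.hasCompactSupport_lowSymbol j).hasTemperateGrowth (χ.contDiff_lowSymbol j)

theorem dyadicSymbol_eq_sub (j : ℤ) :
    χ.dyadicSymbol j = χ.lowSymbol (j + 1) - χ.lowSymbol j := by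
  ext ξ; exact χ.dyadicSymbol_eq j ξ

theorem hasTemperateGrowth_dyadicSymbol (j : ℤ) : (χ.dyadicSymbol j).HasTemperateGrowth := by
  rw [dyadicSymbol_eq_sub]
  exact (χ.hasTemperateGrowth_lowSymbol _).sub (χ.hasTemperateGrowth_lowSymbol _)

theorem continuous_lowSymbol (j : ℤ) : Continuous (χ.lowSymbol j) :=
  (χ.contDiff_lowSymbol j).continuous

theorem continuous_dyadicSymbol (j : ℤ) : Continuous (χ.dyadicSymbol j) := by
  rw [dyadicSymbol_eq_sub]
  exact (χ.continuous_lowSymbol _).sub (χ.continuous_lowSymbol _)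

theorem dyadicSymbol_zero (j : ℤ) : χ.dyadicSymbol j 0 = 0 := by
  rw [dyadicSymbol_eq, lowSymbol_zero, lowSymbol_zero, sub_self]

theorem norm_dyadicSymbol_le (j : ℤ) (ξ : Rn n) : ‖χ.dyadicSymbol j ξ‖ ≤ 1 := by
  have h0 := χ.nonneg ((1 / 2 : ℝ) • (((2 : ℝ) ^ (-j) * (2 * Real.pi)) • ξ))
  have h1 := χ.nonneg (((2 : ℝ) ^ (-j) * (2 * Real.pi)) • ξ)
  have h2 := χ.le_one ((1 / 2 : ℝ) • (((2 : ℝ) ^ (-j) * (2 * Real.pi)) • ξ))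
  have h3 := χ.le_one (((2 : ℝ) ^ (-j) * (2 * Real.pi)) • ξ)
  rw [dyadicSymbol, Complex.norm_real, phi, Real.norm_eq_abs, abs_le]
  constructor <;> linarith

/-- With Mathlib's Fourier transform the symbol of `D` is `2πξ`, so the symbol of `Δ_j` lives on
`3/4 ≤ 2^{-j} 2π|ξ| ≤ 8/3`. The bounds `2^(j-4)` here and `2^(j-1)` on the other side absorb the
factor `2π`. -/
theorem dyadicSymbol_eq_zero_of_lt {j : ℤ} {ξ : Rn n} (h : ‖ξ‖ < 2 ^ (j - 4)) :
    χ.dyadicSymbol j ξ = 0 := by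
  have hp : Real.pi ≤ 4 := Real.pi_le_four
  have h1 : (2 : ℝ) ^ (j - 4) = 2 ^ j / 16 := by
    rw [zpow_sub₀ (by norm_num)]; norm_num
  have h2 : (2 : ℝ) ^ (j + 1) = 2 ^ j * 2 := by rw [zpow_add₀ (by norm_num)]; norm_num
  have hj : (0 : ℝ) < 2 ^ j := by positivity
  have h3 : 2 * Real.pi * ‖ξ‖ < 3 / 4 * 2 ^ j := by
    nlinarith [norm_nonneg ξ, Real.pi_pos]
  rw [dyadicSymbol_eq, χ.lowSymbol_eq_one h3, χ.lowSymbol_eq_one, sub_self]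
  rw [h2]; linarith

theorem dyadicSymbol_eq_zero_of_le {j : ℤ} {ξ : Rn n} (h : 2 ^ (j - 1) ≤ ‖ξ‖) :
    χ.dyadicSymbol j ξ = 0 := by
  have hp := Real.pi_gt_three
  have h1 : (2 : ℝ) ^ (j - 1) = 2 ^ j / 2 := by
    rw [zpow_sub₀ (by norm_num)]; norm_num
  have h2 : (2 : ℝ) ^ (j + 1) = 2 ^ j * 2 := by rw [zpow_add₀ (by norm_num)]; norm_num
  have hj : (0 : ℝ) < 2 ^ j := by positivity
  have h3 : 4 / 3 * 2 ^ (j + 1) < 2 * Real.pi * ‖ξ‖ := by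
    rw [h2]; nlinarith
  rw [dyadicSymbol_eq, χ.lowSymbol_eq_zero h3, χ.lowSymbol_eq_zero, sub_self]
  rw [h2] at h3; linarith

/-- Low frequency cut-offs of Schwartz functions converge in the Schwartz topology. -/
theorem tendsto_smulLeftCLM_lowSymbol (h : 𝓢(Rn n, ℂ)) :
    Tendsto (fun N : ℤ => SchwartzMap.smulLeftCLM ℂ (χ.lowSymbol N) h) atTop (𝓝 h) := by
  rw [(schwartz_withSeminorms ℂ (Rn n) ℂ).tendsto_nhds]
  rintro ⟨k, m⟩ ε hε
  -- `B` bounds the derivatives of `1 - χ(2^{-N} D)` up to order `m`, uniformly in `N ≥ 0`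
  obtain ⟨B, hB0, hB⟩ : ∃ B : ℝ, 0 ≤ B ∧ ∀ i ≤ m, ∀ N : ℤ, 0 ≤ N → ∀ x : Rn n,
      ‖iteratedFDeriv ℝ i (fun y => χ.lowSymbol N y - 1) x‖ ≤ B := by
    have hl := χ.hasTemperateGrowth_lowSymbol 0
    have hc : ∀ i : ℕ, ∃ C : ℝ, ∀ x, ‖iteratedFDeriv ℝ i (χ.lowSymbol 0) x‖ ≤ C := by
      intro i
      have hcont : Continuous fun x => ‖iteratedFDeriv ℝ i (χ.lowSymbol 0) x‖ :=
        ((χ.contDiff_lowSymbol 0).continuous_iteratedFDeriv (mod_cast le_top)).norm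
      obtain ⟨x₀, hx₀⟩ := hcont.exists_forall_ge_of_hasCompactSupport
        (((χ.hasCompactSupport_lowSymbol 0).iteratedFDeriv i).norm)
      exact ⟨_, hx₀⟩
    choose C hC using hc
    refine ⟨(∑ i ∈ Finset.range (m + 1), |C i|) + 1, by positivity, fun i hi N hN x => ?_⟩
    have e : χ.lowSymbol N = fun y => χ.lowSymbol 0 ((2 : ℝ) ^ (-N) • y) := by
      ext y
      simp only [lowSymbol, smul_smul]
      congr 3
      simp; ring
    have ha : (2 : ℝ) ^ (-N) ≤ 1 := zpow_le_one_of_nonpos₀ (by norm_num) (by omega)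
    have h1 : ‖iteratedFDeriv ℝ i (χ.lowSymbol N) x‖ ≤ |C i| := by
      rw [e, iteratedFDeriv_comp_const_smul _ ((χ.contDiff_lowSymbol 0).of_le (mod_cast le_top))]
      simp only [norm_smul, norm_pow]
      have : ‖(2 : ℝ) ^ (-N)‖ ^ i ≤ 1 := by
        apply pow_le_one₀ (norm_nonneg _)
        rw [Real.norm_of_nonneg (by positivity)]; exact ha
      calc _ ≤ 1 * |C i| := by
            gcongr
            exact (hC i _).trans (le_abs_self _)
        _ = _ := one_mul _
    have h2 : |C i| ≤ ∑ i ∈ Finset.range (m + 1), |C i| :=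
      Finset.single_le_sum (f := fun i => |C i|) (fun i _ => abs_nonneg _)
        (Finset.mem_range.2 (by omega))
    rcases i with _ | i
    · rw [norm_iteratedFDeriv_zero] at h1 ⊢
      calc _ ≤ ‖χ.lowSymbol N x‖ + ‖(1 : ℂ)‖ := norm_sub_le _ _
        _ ≤ _ := by rw [norm_one]; linarith
    · have : iteratedFDeriv ℝ (i + 1) (fun y => χ.lowSymbol N y - 1) x
          = iteratedFDeriv ℝ (i + 1) (χ.lowSymbol N) x := by
        have := iteratedFDeriv_sub_apply (𝕜 := ℝ) (i := i + 1) (x := x)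
          (((χ.contDiff_lowSymbol N).of_le (mod_cast le_top)).contDiffAt)
          (contDiffAt_const (c := (1 : ℂ)))
        rw [iteratedFDeriv_const_of_ne (by omega), Pi.zero_apply, sub_zero] at this
        exact this
      rw [this]; linarith
  -- the tail: one extra power of `|x|` is worth a factor `2^{-N}`
  set S : ℝ := ∑ i ∈ Finset.range (m + 1),
    (m.choose i : ℝ) * B * SchwartzMap.seminorm ℂ (k + 1) (m - i) h with hS
  have hS0 : 0 ≤ S := Finset.sum_nonneg fun i _ => by positivity
  obtain ⟨N₀, hN₀⟩ := pow_unbounded_of_one_lt (16 * S / ε) (one_lt_two (α := ℝ))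
  filter_upwards [eventually_ge_atTop (N₀ : ℤ)] with N hN
  have hNp : (2 : ℝ) ^ N₀ ≤ 2 ^ N := by
    rw [← zpow_natCast]; exact zpow_le_zpow_right₀ (by norm_num) hN
  have hlt : 16 * S / 2 ^ N < ε := by
    rw [div_lt_iff₀ hε] at hN₀
    rw [div_lt_iff₀ (by positivity)]
    nlinarith
  refine lt_of_le_of_lt ?_ hlt
  rw [SchwartzMap.schwartzSeminormFamily_apply]
  refine SchwartzMap.seminorm_le_bound ℂ k m _ (by positivity) fun x => ?_
  have e : ((SchwartzMap.smulLeftCLM ℂ (χ.lowSymbol N) h - h : 𝓢(Rn n, ℂ)) : Rn n → ℂ)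
      = fun y => (χ.lowSymbol N y - 1) • h y := by
    ext y
    rw [_root_.sub_apply,
      SchwartzMap.smulLeftCLM_apply_apply (χ.hasTemperateGrowth_lowSymbol N), sub_smul, one_smul]
  rw [e]
  have hp := Real.pi_le_four
  rcases lt_or_ge ‖x‖ (2 ^ N / 16) with hx | hx
  · have : (fun y => (χ.lowSymbol N y - 1) • h y) =ᶠ[𝓝 x] fun _ => 0 := by
      filter_upwards [(continuous_norm.continuousAt (x := x)).eventually_lt continuousAt_const hx]
        with y hy
      rw [χ.lowSymbol_eq_one, sub_self, zero_smul]
      nlinarith [norm_nonneg y, Real.pi_pos]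
    rw [(this.iteratedFDeriv (𝕜 := ℝ) m).self_of_nhds]
    simp only [iteratedFDeriv_fun_zero]
    simpa using by positivity
  · have hbase := norm_iteratedFDeriv_smul_le (𝕜 := ℝ) (N := ∞) (n := m)
      (f := fun y => χ.lowSymbol N y - 1) (g := h)
      ((χ.contDiff_lowSymbol N).sub contDiff_const) (h.smooth ⊤) x (mod_cast le_top)
    have hterm : ∀ i ∈ Finset.range (m + 1), ‖x‖ ^ k * ((m.choose i : ℝ) *
        ‖iteratedFDeriv ℝ i (fun y => χ.lowSymbol N y - 1) x‖ * ‖iteratedFDeriv ℝ (m - i) h x‖)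
        ≤ 16 / 2 ^ N * ((m.choose i : ℝ) * B * SchwartzMap.seminorm ℂ (k + 1) (m - i) h) := by
      intro i hi
      have h1 := hB i (by simpa [Nat.lt_succ_iff] using hi) N (by omega) x
      have h2 := SchwartzMap.le_seminorm ℂ (k + 1) (m - i) h x
      have h3 : ‖x‖ ^ k * ‖iteratedFDeriv ℝ (m - i) h x‖
          ≤ 16 / 2 ^ N * SchwartzMap.seminorm ℂ (k + 1) (m - i) h := by
        rw [div_mul_eq_mul_div, le_div_iff₀ (by positivity)]
        rw [pow_succ] at h2
        have := mul_le_mul_of_nonneg_left hx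
          (show 0 ≤ ‖x‖ ^ k * ‖iteratedFDeriv ℝ (m - i) h x‖ by positivity)
        nlinarith
      calc _ = ((m.choose i : ℝ) * ‖iteratedFDeriv ℝ i (fun y => χ.lowSymbol N y - 1) x‖) *
            (‖x‖ ^ k * ‖iteratedFDeriv ℝ (m - i) h x‖) := by ring
        _ ≤ ((m.choose i : ℝ) * B) *
            (16 / 2 ^ N * SchwartzMap.seminorm ℂ (k + 1) (m - i) h) := by gcongr
        _ = _ := by ring
    calc _ ≤ ‖x‖ ^ k * ∑ i ∈ Finset.range (m + 1), (m.choose i : ℝ) *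
        ‖iteratedFDeriv ℝ i (fun y => χ.lowSymbol N y - 1) x‖ * ‖iteratedFDeriv ℝ (m - i) h x‖ := by
          gcongr
      _ ≤ 16 / 2 ^ N * S := by
          rw [Finset.mul_sum, hS, Finset.mul_sum]
          exact Finset.sum_le_sum hterm
      _ = _ := by ring

theorem tendsto_apply_smulLeftCLM_lowSymbol (T : 𝓢'(Rn n, ℂ)) (h : 𝓢(Rn n, ℂ)) :
    Tendsto (fun N : ℤ => T (SchwartzMap.smulLeftCLM ℂ (χ.lowSymbol N) h)) atTop (𝓝 (T h)) :=
  (T.continuous.tendsto h).comp (χ.tendsto_smulLeftCLM_lowSymbol h)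

end LPCutoff

/-! ### Distributions with vanishing gradient -/

/-- Smoothness of `∫₀¹ ρ(t) F(tξ) dt`, which is the remainder in Hadamard's lemma. The induction
differentiates under the integral, and so passes from values in `V` to values in `Rn n →L[ℝ] V`. -/
theorem contDiff_integral_comp_smul {n : ℕ} (m : ℕ) :
    ∀ {V : Type} [NormedAddCommGroup V] [NormedSpace ℝ V] {F : Rn n → V} {ρ : ℝ → ℝ},
      ContDiff ℝ ∞ F → Continuous ρ →
      ContDiff ℝ m (fun ξ : Rn n => ∫ t in (0 : ℝ)..1, ρ t • F (t • ξ)) := by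
  induction m with
  | zero =>
    intro V _ _ F ρ hF hρ
    have hFc := hF.continuous
    rw [Nat.cast_zero, contDiff_zero]
    exact intervalIntegral.continuous_parametric_intervalIntegral_of_continuous'
      (f := fun (ξ : Rn n) t => ρ t • F (t • ξ)) (by fun_prop) 0 1
  | succ m ih =>
    intro V _ _ F ρ hF hρ
    have hFc := hF.continuous
    have hF' : ContDiff ℝ ∞ (fderiv ℝ F) := hF.fderiv_right (by simp)
    have hF'c := hF'.continuous
    have hFd : Differentiable ℝ F := hF.differentiable (by simp)
    have hd : ∀ ξ₀ : Rn n, HasFDerivAt (fun ξ : Rn n => ∫ t in (0 : ℝ)..1, ρ t • F (t • ξ))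
        (∫ t in (0 : ℝ)..1, (ρ t * t) • fderiv ℝ F (t • ξ₀)) ξ₀ := by
      intro ξ₀
      have hcont : Continuous fun p : ℝ × Rn n => (ρ p.1 * p.1) • fderiv ℝ F (p.1 • p.2) := by
        fun_prop
      obtain ⟨K, hK⟩ := ((isCompact_Icc (a := (0 : ℝ)) (b := 1)).prod
        (isCompact_closedBall ξ₀ 1)).exists_bound_of_continuousOn hcont.continuousOn
      refine intervalIntegral.hasFDerivAt_integral_of_dominated_of_fderiv_le (𝕜 := ℝ)
        (F := fun (ξ : Rn n) t => ρ t • F (t • ξ))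
        (F' := fun (ξ : Rn n) t => (ρ t * t) • fderiv ℝ F (t • ξ))
        (bound := fun _ => K) (s := Metric.closedBall ξ₀ 1)
        (Metric.closedBall_mem_nhds ξ₀ one_pos) ?_ ?_ ?_ ?_ ?_ ?_
      · exact Eventually.of_forall fun ξ =>
          (show Continuous fun t => ρ t • F (t • ξ) by fun_prop).aestronglyMeasurable
      · exact (show Continuous fun t => ρ t • F (t • ξ₀) by fun_prop).intervalIntegrable 0 1
      · exact (show Continuous fun t => (ρ t * t) • fderiv ℝ F (t • ξ₀) by
          fun_prop).aestronglyMeasurable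
      · refine Eventually.of_forall fun t ht x hx => hK (t, x) ⟨?_, hx⟩
        rw [Set.uIoc_of_le zero_le_one] at ht
        exact ⟨ht.1.le, ht.2⟩
      · exact intervalIntegrable_const
      · refine Eventually.of_forall fun t _ x _ => ?_
        have h1 : HasFDerivAt (fun x : Rn n => t • x) (t • ContinuousLinearMap.id ℝ (Rn n)) x :=
          (hasFDerivAt_id x).const_smul t
        have h2 := ((hFd (t • x)).hasFDerivAt.comp x h1).const_smul (ρ t)
        convert! h2 using 1
        ext v
        simp [mul_smul]
    rw [Nat.cast_succ, contDiff_succ_iff_fderiv]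
    refine ⟨fun ξ => (hd ξ).differentiableAt, by simp, ?_⟩
    have : fderiv ℝ (fun ξ : Rn n => ∫ t in (0 : ℝ)..1, ρ t • F (t • ξ))
        = fun ξ => ∫ t in (0 : ℝ)..1, (ρ t * t) • fderiv ℝ F (t • ξ) := by
      ext1 ξ; exact (hd ξ).fderiv
    rw [this]
    exact ih (ρ := fun t => ρ t * t) hF' (hρ.mul continuous_id)

theorem hasTemperateGrowth_coord {n : ℕ} (k : Fin n) :
    (fun ξ : Rn n => (ξ k : ℂ)).HasTemperateGrowth := by
  have : (fun ξ : Rn n => ((inner ℝ ξ (EuclideanSpace.single k 1 : Rn n) : ℝ) : ℂ))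
    |>.HasTemperateGrowth := by fun_prop
  simpa [EuclideanSpace.inner_single_right] using this

/-- A distribution annihilated by all coordinate functions is a multiple of the Dirac mass at `0`.
By Hadamard's lemma, a compactly supported test function vanishing at `0` is a combination
`∑ ξ_k h_k` with `h_k` compactly supported. -/
theorem eq_const_mul_delta {n : ℕ} (χ : LPCutoff n) (T : 𝓢'(Rn n, ℂ))
    (hT : ∀ (k : Fin n) (h : 𝓢(Rn n, ℂ)),
      T (SchwartzMap.smulLeftCLM ℂ (fun ξ : Rn n => (ξ k : ℂ)) h) = 0) :
    ∃ c : ℂ, ∀ h : 𝓢(Rn n, ℂ), T h = c * h 0 := by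
  set X : 𝓢(Rn n, ℂ) :=
    (χ.hasCompactSupport_lowSymbol 0).toSchwartzMap (χ.contDiff_lowSymbol 0) with hX
  have hX0 : X 0 = 1 := χ.lowSymbol_zero 0
  have key : ∀ h : 𝓢(Rn n, ℂ), h 0 = 0 → T h = 0 := by
    intro h h0
    refine tendsto_nhds_unique (χ.tendsto_apply_smulLeftCLM_lowSymbol T h) ?_
    refine tendsto_const_nhds.congr fun N => ?_
    set H := SchwartzMap.smulLeftCLM ℂ (χ.lowSymbol N) h with hH
    have hHx : ∀ x, H x = χ.lowSymbol N x * h x := fun x => by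
      rw [hH, SchwartzMap.smulLeftCLM_apply_apply (χ.hasTemperateGrowth_lowSymbol N), smul_eq_mul]
    have hH0 : H 0 = 0 := by rw [hHx, h0, mul_zero]
    set D : Rn n → (Rn n →L[ℝ] ℂ) := fun ξ => ∫ t in (0 : ℝ)..1, (1 : ℝ) • fderiv ℝ H (t • ξ)
      with hD
    have hDsmooth : ContDiff ℝ ∞ D := contDiff_infty.2 fun m =>
      contDiff_integral_comp_smul m ((H.smooth ⊤).fderiv_right (by simp)) continuous_const
    have hfd : Continuous (fderiv ℝ H) := (H.smooth 1).continuous_fderiv (by simp)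
    have hDH : ∀ ξ, D ξ ξ = H ξ := by
      intro ξ
      have hint : IntervalIntegrable (fun t : ℝ => (1 : ℝ) • fderiv ℝ H (t • ξ)) volume 0 1 :=
        (show Continuous fun t : ℝ => (1 : ℝ) • fderiv ℝ H (t • ξ) by
          fun_prop).intervalIntegrable _ _
      have h1 : D ξ ξ = ∫ t in (0 : ℝ)..1, fderiv ℝ H (t • ξ) ξ := by
        rw [hD]
        simp only
        rw [ContinuousLinearMap.intervalIntegral_apply hint]
        simp
      have h2 : ∀ t ∈ Set.uIcc (0 : ℝ) 1,
          HasDerivAt (fun t : ℝ => H (t • ξ)) (fderiv ℝ H (t • ξ) ξ) t := by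
        intro t _
        have := (H.differentiableAt (x := t • ξ)).hasFDerivAt.comp_hasDerivAt t
          ((hasDerivAt_id t).smul_const ξ)
        simpa [Function.comp_def] using this
      rw [h1, intervalIntegral.integral_eq_sub_of_hasDerivAt h2
        ((show Continuous fun t : ℝ => fderiv ℝ H (t • ξ) ξ by fun_prop).intervalIntegrable _ _)]
      simp [hH0]
    set f : Fin n → Rn n → ℂ :=
      fun k ξ => χ.lowSymbol (N + 2) ξ * D ξ (EuclideanSpace.single k 1) with hf
    have hfs : ∀ k, ContDiff ℝ ∞ (f k) := fun k =>
      (χ.contDiff_lowSymbol (N + 2)).mul (hDsmooth.clm_apply contDiff_const)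
    have hfc : ∀ k, HasCompactSupport (f k) := fun k =>
      (χ.hasCompactSupport_lowSymbol (N + 2)).mul_right
    have hsum : H = ∑ k, SchwartzMap.smulLeftCLM ℂ (fun ξ : Rn n => (ξ k : ℂ))
        ((hfc k).toSchwartzMap (hfs k)) := by
      ext ξ
      have e1 : (∑ k, SchwartzMap.smulLeftCLM ℂ (fun ξ : Rn n => (ξ k : ℂ))
          ((hfc k).toSchwartzMap (hfs k))) ξ = ∑ k, (ξ k : ℂ) * f k ξ := by
        rw [_root_.sum_apply]
        refine Finset.sum_congr rfl fun k _ => ?_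
        rw [SchwartzMap.smulLeftCLM_apply_apply (hasTemperateGrowth_coord k)]
        rfl
      have e2 : ∑ k, (ξ k : ℂ) * f k ξ = χ.lowSymbol (N + 2) ξ * D ξ ξ := by
        have h3 : ξ = ∑ k, ξ k • (EuclideanSpace.single k (1 : ℝ) : Rn n) := by
          have := (EuclideanSpace.basisFun (Fin n) ℝ).sum_repr ξ
          simpa using this.symm
        conv_rhs => rw [show D ξ ξ = D ξ (∑ k, ξ k • (EuclideanSpace.single k (1 : ℝ) : Rn n)) by
          rw [← h3], map_sum, Finset.mul_sum]
        refine Finset.sum_congr rfl fun k _ => ?_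
        rw [map_smul, hf, Complex.real_smul]
        ring
      rw [e1, e2, hDH]
      rcases le_or_gt (2 * Real.pi * ‖ξ‖) (4 / 3 * 2 ^ N) with hle | hgt
      · rw [χ.lowSymbol_eq_one, one_mul]
        have : (2 : ℝ) ^ (N + 2) = 2 ^ N * 4 := by rw [zpow_add₀ (by norm_num)]; norm_num
        have : (0 : ℝ) < 2 ^ N := by positivity
        linarith
      · rw [hHx, χ.lowSymbol_eq_zero hgt]; simp
    rw [hsum, map_sum]
    exact (Finset.sum_eq_zero fun k _ => hT k _).symm
  refine ⟨T X, fun h => ?_⟩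
  have := key (h - (h 0) • X) (by simp [hX0])
  rw [map_sub, map_smul, sub_eq_zero, smul_eq_mul] at this
  rw [this, mul_comm]

/-! ### Dyadic annuli and weighted norms on the Fourier side -/

/-- The dyadic annulus `2^j ≤ |ξ| < 2^{j+1}`. -/
def annulus (n : ℕ) (j : ℤ) : Set (Rn n) := {ξ | (2 : ℝ) ^ j ≤ ‖ξ‖ ∧ ‖ξ‖ < 2 ^ (j + 1)}

/-- The `L²` norm over the set `S`, for functions with values in `[0, ∞]`. -/
noncomputable def l2On {n : ℕ} (f : Rn n → ℝ≥0∞) (S : Set (Rn n)) : ℝ≥0∞ :=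
  (∫⁻ ξ in S, f ξ ^ (2 : ℝ)) ^ (1 / 2 : ℝ)

/-- The sum `∑_j 2^{jσ} ‖f‖_{L²(2^j ≤ |ξ| < 2^{j+1})}`: the norm of `Ḃ^σ_{2,1}` seen on the Fourier
side, with sharp annuli. -/
noncomputable def annulusSum {n : ℕ} (σ : ℝ) (f : Rn n → ℝ≥0∞) : ℝ≥0∞ :=
  ∑' j : ℤ, (2 : ℝ≥0∞) ^ ((j : ℝ) * σ) * l2On f (annulus n j)

theorem measurableSet_annulus (n : ℕ) (j : ℤ) : MeasurableSet (annulus n j) :=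
  (measurableSet_le measurable_const measurable_norm).inter
    (measurableSet_lt measurable_norm measurable_const)

theorem two_rpow_ne_zero (x : ℝ) : (2 : ℝ≥0∞) ^ x ≠ 0 := by
  simp [ENNReal.rpow_eq_zero_iff]

theorem two_rpow_ne_top (x : ℝ) : (2 : ℝ≥0∞) ^ x ≠ ⊤ := by
  simp [ENNReal.rpow_eq_top_iff]

theorem two_rpow_add (x y : ℝ) : (2 : ℝ≥0∞) ^ (x + y) = 2 ^ x * 2 ^ y :=
  ENNReal.rpow_add x y two_ne_zero ENNReal.ofNat_ne_top

theorem one_le_two_rpow {x : ℝ} (hx : 0 ≤ x) : (1 : ℝ≥0∞) ≤ 2 ^ x := by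
  calc (1 : ℝ≥0∞) = 2 ^ (0 : ℝ) := by simp
    _ ≤ 2 ^ x := ENNReal.rpow_le_rpow_of_exponent_le (by norm_num) hx

theorem two_rpow_eq_ofReal (x : ℝ) : (2 : ℝ≥0∞) ^ x = ENNReal.ofReal (2 ^ x) := by
  rw [← ENNReal.ofReal_rpow_of_pos two_pos, ENNReal.ofReal_ofNat]

theorem two_rpow_intCast (j : ℤ) : (2 : ℝ≥0∞) ^ (j : ℝ) = ENNReal.ofReal (2 ^ j) := by
  rw [two_rpow_eq_ofReal, Real.rpow_intCast]

theorem le_enorm_of_mem_annulus {n : ℕ} {j : ℤ} {ξ : Rn n} (h : ξ ∈ annulus n j) :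
    (2 : ℝ≥0∞) ^ (j : ℝ) ≤ ‖ξ‖ₑ := by
  rw [two_rpow_intCast, ← ofReal_norm]
  exact ENNReal.ofReal_le_ofReal h.1

theorem enorm_le_of_mem_annulus {n : ℕ} {j : ℤ} {ξ : Rn n} (h : ξ ∈ annulus n j) :
    ‖ξ‖ₑ ≤ (2 : ℝ≥0∞) ^ ((j : ℝ) + 1) := by
  have : ((j : ℝ) + 1) = ((j + 1 : ℤ) : ℝ) := by push_cast; ring
  rw [this, two_rpow_intCast, ← ofReal_norm]
  exact ENNReal.ofReal_le_ofReal h.2.le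

/-- On a dyadic annulus every power of `|ξ|` is constant up to a factor. -/
theorem enorm_rpow_le_of_mem_annulus {n : ℕ} {j : ℤ} {ξ : Rn n} (h : ξ ∈ annulus n j) (a : ℝ) :
    ‖ξ‖ₑ ^ a ≤ 2 ^ |a| * (2 : ℝ≥0∞) ^ ((j : ℝ) * a) := by
  rcases le_total 0 a with ha | ha
  · calc ‖ξ‖ₑ ^ a ≤ ((2 : ℝ≥0∞) ^ ((j : ℝ) + 1)) ^ a :=
          ENNReal.rpow_le_rpow (enorm_le_of_mem_annulus h) ha
      _ = _ := by
          rw [← ENNReal.rpow_mul, abs_of_nonneg ha, ← two_rpow_add]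
          congr 1; ring
  · calc ‖ξ‖ₑ ^ a ≤ ((2 : ℝ≥0∞) ^ (j : ℝ)) ^ a := by
          obtain ⟨b, rfl⟩ : ∃ b, a = -b := ⟨-a, by ring⟩
          rw [ENNReal.rpow_neg, ENNReal.rpow_neg]
          exact ENNReal.inv_le_inv.2 (ENNReal.rpow_le_rpow (le_enorm_of_mem_annulus h) (by linarith))
      _ = 1 * (2 : ℝ≥0∞) ^ ((j : ℝ) * a) := by rw [← ENNReal.rpow_mul, one_mul]
      _ ≤ _ := by
          gcongr
          exact one_le_two_rpow (abs_nonneg a)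

theorem enorm_ne_zero_of_mem_annulus {n : ℕ} {j : ℤ} {ξ : Rn n} (h : ξ ∈ annulus n j) :
    ‖ξ‖ₑ ≠ 0 := fun h0 => by
  have := le_enorm_of_mem_annulus h
  rw [h0, nonpos_iff_eq_zero] at this
  exact two_rpow_ne_zero _ this

theorem pairwise_disjoint_annulus (n : ℕ) : Pairwise (Function.onFun Disjoint (annulus n)) := by
  have key : ∀ i j : ℤ, i < j → Disjoint (annulus n i) (annulus n j) := by
    intro i j hij
    refine Set.disjoint_left.2 fun ξ hi hj => ?_
    have : (2 : ℝ) ^ (i + 1) ≤ 2 ^ j := zpow_le_zpow_right₀ (by norm_num) (by omega)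
    linarith [hi.2, hj.1]
  intro i j hij
  rcases lt_or_gt_of_ne hij with h | h
  · exact key i j h
  · exact (key j i h).symm

theorem exists_mem_annulus {n : ℕ} {ξ : Rn n} (h : ξ ≠ 0) : ∃ j, ξ ∈ annulus n j :=
  exists_mem_Ico_zpow (norm_pos_iff.2 h) one_lt_two

theorem iUnion_annulus (n : ℕ) : ⋃ j, annulus n j = {0}ᶜ := by
  ext ξ
  simp only [Set.mem_iUnion, Set.mem_compl_iff, Set.mem_singleton_iff]
  refine ⟨?_, exists_mem_annulus⟩
  rintro ⟨j, hj⟩ rfl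
  exact enorm_ne_zero_of_mem_annulus hj (by simp)

theorem nontrivial_Rn {n : ℕ} (hn : 0 < n) : Nontrivial (Rn n) :=
  Module.nontrivial_of_finrank_pos (R := ℝ) (by simpa using hn)

theorem ae_ne_zero {n : ℕ} (hn : 0 < n) : ∀ᵐ ξ : Rn n, ξ ≠ 0 := by
  have := nontrivial_Rn hn
  exact Measure.ae_ne volume 0

theorem lintegral_eq_tsum_annulus {n : ℕ} (hn : 0 < n) (f : Rn n → ℝ≥0∞) :
    ∫⁻ ξ, f ξ = ∑' j : ℤ, ∫⁻ ξ in annulus n j, f ξ := by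
  rw [← lintegral_iUnion (measurableSet_annulus n) (pairwise_disjoint_annulus n), iUnion_annulus]
  symm
  rw [setLIntegral_congr (t := Set.univ), setLIntegral_univ]
  rw [ae_eq_univ, compl_compl]
  have := nontrivial_Rn hn
  exact measure_singleton 0

theorem lintegral_mul_le_l2On {n : ℕ} (f g : Rn n → ℝ≥0∞) (S : Set (Rn n))
    (hf : AEMeasurable f) (hg : AEMeasurable g) :
    ∫⁻ ξ in S, f ξ * g ξ ≤ l2On f S * l2On g S :=
  ENNReal.lintegral_mul_le_Lp_mul_Lq _ Real.HolderConjugate.two_two hf.restrict hg.restrict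

theorem l2On_mono {n : ℕ} {f g : Rn n → ℝ≥0∞} {S T : Set (Rn n)} (hT : MeasurableSet T)
    (hfg : ∀ ξ ∈ T, f ξ ≤ g ξ) (hST : S ⊆ T) : l2On f S ≤ l2On g T := by
  refine ENNReal.rpow_le_rpow ?_ (by norm_num)
  refine (lintegral_mono_set hST).trans (setLIntegral_mono' hT fun ξ hξ => ?_)
  exact ENNReal.rpow_le_rpow (hfg ξ hξ) (by norm_num)

theorem l2On_congr_ae {n : ℕ} {f g : Rn n → ℝ≥0∞} (hfg : f =ᵐ[volume] g) (S : Set (Rn n)) :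
    l2On f S = l2On g S := by
  unfold l2On
  rw [lintegral_congr_ae]
  filter_upwards [ae_restrict_of_ae hfg] with ξ hξ
  rw [hξ]

theorem l2On_add_le {n : ℕ} {f g : Rn n → ℝ≥0∞} (hf : AEMeasurable f) (hg : AEMeasurable g)
    (S : Set (Rn n)) : l2On (f + g) S ≤ l2On f S + l2On g S :=
  ENNReal.lintegral_Lp_add_le hf.restrict hg.restrict (by norm_num)

theorem l2On_sum_le {n : ℕ} {ι : Type*} (I : Finset ι) {f : ι → Rn n → ℝ≥0∞}
    (hf : ∀ i, AEMeasurable (f i)) (S : Set (Rn n)) :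
    l2On (fun ξ => ∑ i ∈ I, f i ξ) S ≤ ∑ i ∈ I, l2On (f i) S := by
  classical
  induction I using Finset.induction_on with
  | empty => simp [l2On]
  | insert i I hi ih =>
    simp only [Finset.sum_insert hi]
    refine (l2On_add_le (hf i) (Finset.aemeasurable_fun_sum I fun i _ => hf i) S).trans ?_
    gcongr

theorem l2On_const_mul {n : ℕ} (c : ℝ≥0∞) {f : Rn n → ℝ≥0∞} (hf : AEMeasurable f)
    (S : Set (Rn n)) : l2On (fun ξ => c * f ξ) S = c * l2On f S := by
  unfold l2On
  simp_rw [ENNReal.mul_rpow_of_nonneg _ _ (show (0 : ℝ) ≤ 2 by norm_num)]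
  rw [lintegral_const_mul'' _ (hf.restrict.pow_const _),
    ENNReal.mul_rpow_of_nonneg _ _ (by norm_num), ← ENNReal.rpow_mul]
  norm_num

theorem l2On_le_sum {n : ℕ} {ι : Type*} (I : Finset ι) (f : Rn n → ℝ≥0∞) (A : ι → Set (Rn n))
    {S : Set (Rn n)} (hS : S ⊆ ⋃ i ∈ I, A i) : l2On f S ≤ ∑ i ∈ I, l2On f (A i) := by
  have h1 : ∫⁻ ξ in S, f ξ ^ (2 : ℝ) ≤ ∑ i ∈ I, ∫⁻ ξ in A i, f ξ ^ (2 : ℝ) := by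
    refine (lintegral_mono_set hS).trans ?_
    classical
    clear hS
    induction I using Finset.induction_on with
    | empty => simp
    | insert i I hi ih =>
      rw [Finset.set_biUnion_insert, Finset.sum_insert hi]
      exact (lintegral_union_le _ _ _).trans (by gcongr)
  refine (ENNReal.rpow_le_rpow h1 (by norm_num)).trans ?_
  classical
  clear h1 hS
  induction I using Finset.induction_on with
  | empty => simp
  | insert i I hi ih =>
    rw [Finset.sum_insert hi, Finset.sum_insert hi]
    refine (ENNReal.rpow_add_le_add_rpow _ _ (by norm_num) (by norm_num)).trans ?_
    gcongr
    exact le_rfl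

/-- The constant `|{|ξ| < 2}|^{1/2}` of the Bernstein inequalities on dyadic annuli. -/
noncomputable def bernsteinConst (n : ℕ) : ℝ≥0∞ :=
  (2 ^ (n : ℝ) * volume (Metric.ball (0 : Rn n) 1)) ^ (1 / 2 : ℝ)

theorem bernsteinConst_ne_top (n : ℕ) : bernsteinConst n ≠ ⊤ :=
  ENNReal.rpow_ne_top_of_nonneg (by norm_num)
    (ENNReal.mul_ne_top (two_rpow_ne_top _) measure_ball_lt_top.ne)

theorem volume_annulus_rpow_half_le (n : ℕ) (j : ℤ) :
    (volume (annulus n j)) ^ (1 / 2 : ℝ) ≤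
      bernsteinConst n * (2 : ℝ≥0∞) ^ ((j : ℝ) * (n / 2)) := by
  have h1 : volume (annulus n j) ≤
      (2 ^ (n : ℝ) * volume (Metric.ball (0 : Rn n) 1)) * (2 : ℝ≥0∞) ^ ((j : ℝ) * n) := by
    calc volume (annulus n j) ≤ volume (Metric.ball (0 : Rn n) (2 ^ (j + 1))) :=
          measure_mono fun ξ hξ => by simpa using hξ.2
      _ = ENNReal.ofReal ((2 ^ (j + 1)) ^ n) * volume (Metric.ball (0 : Rn n) 1) := by
          rw [Measure.addHaar_ball_of_pos _ _ (by positivity)]; simp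
      _ = _ := by
          have : ENNReal.ofReal (((2 : ℝ) ^ (j + 1)) ^ n)
              = 2 ^ (n : ℝ) * (2 : ℝ≥0∞) ^ ((j : ℝ) * n) := by
            rw [← two_rpow_add, two_rpow_eq_ofReal, ← Real.rpow_intCast, ← Real.rpow_natCast,
              ← Real.rpow_mul (by norm_num)]
            congr 2; push_cast; ring
          rw [this]; ring
  refine (ENNReal.rpow_le_rpow h1 (by norm_num)).trans (le_of_eq ?_)
  rw [bernsteinConst, ENNReal.mul_rpow_of_nonneg _ ((2 : ℝ≥0∞) ^ ((j : ℝ) * n)) (by norm_num), ← ENNReal.rpow_mul]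
  congr 2; ring

theorem setLIntegral_annulus_le {n : ℕ} {f : Rn n → ℝ≥0∞} (hf : AEMeasurable f) (j : ℤ) :
    ∫⁻ ξ in annulus n j, f ξ ≤
      bernsteinConst n * (2 : ℝ≥0∞) ^ ((j : ℝ) * (n / 2)) * l2On f (annulus n j) := by
  calc ∫⁻ ξ in annulus n j, f ξ = ∫⁻ ξ in annulus n j, 1 * f ξ := by simp
    _ ≤ l2On (fun _ => 1) (annulus n j) * l2On f (annulus n j) :=
        lintegral_mul_le_l2On _ _ _ aemeasurable_const hf
    _ ≤ _ := by
        gcongr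
        simpa [l2On] using volume_annulus_rpow_half_le n j

/-- Bernstein's inequality on the Fourier side, summed over annuli: dyadic sums of `L²` norms control
weighted `L¹` norms, at the cost of `n/2` powers of the frequency. -/
theorem lintegral_enorm_rpow_mul_le {n : ℕ} (hn : 0 < n) {f : Rn n → ℝ≥0∞} (hf : AEMeasurable f)
    (a : ℝ) : ∫⁻ ξ, ‖ξ‖ₑ ^ a * f ξ ≤ 2 ^ |a| * bernsteinConst n * annulusSum (n / 2 + a) f := by
  rw [lintegral_eq_tsum_annulus hn, annulusSum, ← ENNReal.tsum_mul_left]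
  refine ENNReal.tsum_le_tsum fun j => ?_
  calc ∫⁻ ξ in annulus n j, ‖ξ‖ₑ ^ a * f ξ
      ≤ ∫⁻ ξ in annulus n j, (2 ^ |a| * (2 : ℝ≥0∞) ^ ((j : ℝ) * a)) * f ξ :=
        setLIntegral_mono' (measurableSet_annulus n j) fun ξ hξ => by
          gcongr; exact enorm_rpow_le_of_mem_annulus hξ a
    _ = (2 ^ |a| * (2 : ℝ≥0∞) ^ ((j : ℝ) * a)) * ∫⁻ ξ in annulus n j, f ξ :=
        lintegral_const_mul'' _ hf.restrict
    _ ≤ (2 ^ |a| * (2 : ℝ≥0∞) ^ ((j : ℝ) * a)) *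
        (bernsteinConst n * (2 : ℝ≥0∞) ^ ((j : ℝ) * (n / 2)) * l2On f (annulus n j)) := by
        gcongr; exact setLIntegral_annulus_le hf j
    _ = _ := by
        rw [mul_add, two_rpow_add]; ring

theorem lintegral_le_annulusSum {n : ℕ} (hn : 0 < n) {f : Rn n → ℝ≥0∞} (hf : AEMeasurable f) :
    ∫⁻ ξ, f ξ ≤ bernsteinConst n * annulusSum (n / 2) f := by
  simpa using lintegral_enorm_rpow_mul_le hn hf 0

theorem tsum_sq_le_sq_tsum {ι : Type*} (a : ι → ℝ≥0∞) :
    ∑' j, a j ^ (2 : ℝ) ≤ (∑' j, a j) ^ (2 : ℝ) := by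
  calc ∑' j, a j ^ (2 : ℝ) ≤ ∑' j, a j * ∑' i, a i := by
        refine ENNReal.tsum_le_tsum fun j => ?_
        rw [ENNReal.rpow_two, sq]
        gcongr
        exact ENNReal.le_tsum j
    _ = _ := by rw [ENNReal.tsum_mul_right, ENNReal.rpow_two, sq]

theorem lintegral_sq_le_annulusSum {n : ℕ} (hn : 0 < n) {f : Rn n → ℝ≥0∞} (hf : AEMeasurable f)
    (σ : ℝ) : ∫⁻ ξ, (‖ξ‖ₑ ^ σ * f ξ) ^ (2 : ℝ) ≤ (2 ^ |σ| * annulusSum σ f) ^ (2 : ℝ) := by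
  rw [lintegral_eq_tsum_annulus hn, annulusSum, ← ENNReal.tsum_mul_left]
  refine le_trans (ENNReal.tsum_le_tsum fun j => ?_) (tsum_sq_le_sq_tsum _)
  rw [← mul_assoc, ← l2On_const_mul _ hf, l2On, ← ENNReal.rpow_mul]
  norm_num
  refine setLIntegral_mono' (measurableSet_annulus n j) fun ξ hξ => ?_
  gcongr
  exact enorm_rpow_le_of_mem_annulus hξ σ

theorem tsum_two_rpow_shift (σ : ℝ) (a : ℤ → ℝ≥0∞) (i : ℤ) :
    ∑' j : ℤ, (2 : ℝ≥0∞) ^ ((j : ℝ) * σ) * a (j + i)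
      = 2 ^ (-(i : ℝ) * σ) * ∑' j : ℤ, (2 : ℝ≥0∞) ^ ((j : ℝ) * σ) * a j := by
  rw [← (Equiv.addRight i).tsum_eq (fun j : ℤ => (2 : ℝ≥0∞) ^ ((j : ℝ) * σ) * a j),
    ← ENNReal.tsum_mul_left]
  refine tsum_congr fun j => ?_
  rw [Equiv.coe_addRight, ← mul_assoc, ← two_rpow_add]
  congr 2; push_cast; ring

/-- A sum over slightly enlarged annuli is controlled by the sum over the sharp ones. -/
theorem tsum_l2On_le {n : ℕ} (σ : ℝ) (f : Rn n → ℝ≥0∞) (I : Finset ℤ) (S : ℤ → Set (Rn n))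
    (hS : ∀ j, S j ⊆ ⋃ i ∈ I, annulus n (j + i)) :
    ∑' j : ℤ, (2 : ℝ≥0∞) ^ ((j : ℝ) * σ) * l2On f (S j)
      ≤ (∑ i ∈ I, (2 : ℝ≥0∞) ^ (-(i : ℝ) * σ)) * annulusSum σ f := by
  calc _ ≤ ∑' j : ℤ, ∑ i ∈ I, (2 : ℝ≥0∞) ^ ((j : ℝ) * σ) * l2On f (annulus n (j + i)) := by
        refine ENNReal.tsum_le_tsum fun j => ?_
        rw [← Finset.mul_sum]
        gcongr
        exact l2On_le_sum I f _ (hS j)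
    _ = ∑ i ∈ I, ∑' j : ℤ, (2 : ℝ≥0∞) ^ ((j : ℝ) * σ) * l2On f (annulus n (j + i)) :=
        Summable.tsum_finsetSum fun i _ => ENNReal.summable
    _ = _ := by
        rw [Finset.sum_mul]
        exact Finset.sum_congr rfl fun i _ => tsum_two_rpow_shift σ (fun j => l2On f (annulus n j)) i

theorem annulusSum_mono {n : ℕ} (σ : ℝ) {f g : Rn n → ℝ≥0∞} (hfg : ∀ ξ, f ξ ≤ g ξ) :
    annulusSum σ f ≤ annulusSum σ g :=
  ENNReal.tsum_le_tsum fun j => by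
    gcongr
    exact l2On_mono (measurableSet_annulus n j) (fun ξ _ => hfg ξ) subset_rfl

theorem annulusSum_sum_le {n : ℕ} {ι : Type*} (σ : ℝ) (I : Finset ι) {f : ι → Rn n → ℝ≥0∞}
    (hf : ∀ i, AEMeasurable (f i)) :
    annulusSum σ (fun ξ => ∑ i ∈ I, f i ξ) ≤ ∑ i ∈ I, annulusSum σ (f i) := by
  unfold annulusSum
  rw [← Summable.tsum_finsetSum fun i _ => ENNReal.summable]
  refine ENNReal.tsum_le_tsum fun j => ?_
  rw [← Finset.mul_sum]
  gcongr
  exact l2On_sum_le I hf _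

theorem annulusSum_const_mul {n : ℕ} (σ : ℝ) (c : ℝ≥0∞) {f : Rn n → ℝ≥0∞} (hf : AEMeasurable f) :
    annulusSum σ (fun ξ => c * f ξ) = c * annulusSum σ f := by
  unfold annulusSum
  rw [← ENNReal.tsum_mul_left]
  refine tsum_congr fun j => ?_
  rw [l2On_const_mul c hf]; ring

theorem annulusSum_enorm_rpow_mul_le {n : ℕ} (σ a : ℝ) {f : Rn n → ℝ≥0∞} (hf : AEMeasurable f) :
    annulusSum σ (fun ξ => ‖ξ‖ₑ ^ a * f ξ) ≤ 2 ^ |a| * annulusSum (σ + a) f := by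
  unfold annulusSum
  rw [← ENNReal.tsum_mul_left]
  refine ENNReal.tsum_le_tsum fun j => ?_
  calc (2 : ℝ≥0∞) ^ ((j : ℝ) * σ) * l2On (fun ξ => ‖ξ‖ₑ ^ a * f ξ) (annulus n j)
      ≤ (2 : ℝ≥0∞) ^ ((j : ℝ) * σ) *
        l2On (fun ξ => (2 ^ |a| * (2 : ℝ≥0∞) ^ ((j : ℝ) * a)) * f ξ) (annulus n j) := by
        gcongr
        refine l2On_mono (measurableSet_annulus n j) (fun ξ hξ => ?_) subset_rfl
        gcongr
        exact enorm_rpow_le_of_mem_annulus hξ a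
    _ = _ := by rw [l2On_const_mul _ hf, mul_add, two_rpow_add]; ring

/-- An interval of radii is covered by finitely many dyadic annuli. -/
theorem subset_iUnion_annulus {n : ℕ} (j a b : ℤ) :
    {ξ : Rn n | (2 : ℝ) ^ (j + a) ≤ ‖ξ‖ ∧ ‖ξ‖ < 2 ^ (j + b)}
      ⊆ ⋃ i ∈ Finset.Ico a b, annulus n (j + i) := by
  rintro ξ ⟨h1, h2⟩
  have h0 : ξ ≠ 0 := by
    rw [← norm_pos_iff]; exact lt_of_lt_of_le (by positivity) h1
  obtain ⟨k, hk⟩ := exists_mem_annulus h0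
  have ha : j + a < k + 1 := (zpow_lt_zpow_iff_right₀ one_lt_two).1 (h1.trans_lt hk.2)
  have hb : k < j + b := (zpow_lt_zpow_iff_right₀ one_lt_two).1 (hk.1.trans_lt h2)
  simp only [Set.mem_iUnion, Finset.mem_Ico, exists_prop]
  exact ⟨k - j, ⟨by omega, by omega⟩, by simpa using hk⟩

/-! ### `L^p` norms of distributions -/

theorem toTemperedDistribution_injective {n : ℕ} {p : ℝ≥0∞} [Fact (1 ≤ p)] :
    Function.Injective
      (Lp.toTemperedDistribution : Lp ℂ p (volume : Measure (Rn n)) → 𝓢'(Rn n, ℂ)) := by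
  have := Lp.ker_toTemperedDistributionCLM_eq_bot (F := ℂ) (μ := (volume : Measure (Rn n))) (p := p)
  exact LinearMap.ker_eq_bot.1 this

theorem distLpNorm_le {n : ℕ} {p : ℝ≥0∞} [Fact (1 ≤ p)] {T : 𝓢'(Rn n, ℂ)}
    {g : Lp ℂ p (volume : Measure (Rn n))} (hg : Lp.toTemperedDistribution g = T) :
    distLpNorm p T ≤ ‖g‖ₑ :=
  iInf₂_le g hg

theorem exists_Lp_of_distLpNorm_lt_top {n : ℕ} {p : ℝ≥0∞} [Fact (1 ≤ p)] {T : 𝓢'(Rn n, ℂ)}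
    (hT : distLpNorm p T < ⊤) :
    ∃ g : Lp ℂ p (volume : Measure (Rn n)),
      Lp.toTemperedDistribution g = T ∧ ‖g‖ₑ = distLpNorm p T := by
  obtain ⟨g, hg⟩ := iInf_lt_iff.1 hT
  obtain ⟨hg, -⟩ := iInf_lt_iff.1 hg
  refine ⟨g, hg, le_antisymm (le_iInf₂ fun g' hg' => ?_) (distLpNorm_le hg)⟩
  rw [toTemperedDistribution_injective (hg.trans hg'.symm)]

theorem hasDensity_toTemperedDistribution {n : ℕ} {p : ℝ≥0∞} [hp : Fact (1 ≤ p)]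
    (g : Lp ℂ p (volume : Measure (Rn n))) : HasDensity (Lp.toTemperedDistribution g) g := by
  intro h
  refine ⟨?_, by simp [Lp.toTemperedDistribution_apply]⟩
  have : ENNReal.HolderConjugate p (1 - p⁻¹)⁻¹ := ENNReal.HolderConjugate.inv_one_sub_inv' hp.out
  have hc : ENNReal.HolderConjugate (1 - p⁻¹)⁻¹ p := this.symm
  exact (h.memLp (1 - p⁻¹)⁻¹).integrable_mul (Lp.memLp g)

theorem HasDensity.eq_of_density {n : ℕ} {T T' : 𝓢'(Rn n, ℂ)} {F : Rn n → ℂ}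
    (h : HasDensity T F) (h' : HasDensity T' F) : T = T' := by
  ext φ
  rw [(h φ).2, (h' φ).2]

theorem enorm_apply_le_distLpNorm_top {n : ℕ} (T : 𝓢'(Rn n, ℂ)) (h : 𝓢(Rn n, ℂ))
    (hT : distLpNorm ⊤ T < ⊤) : ‖T h‖ₑ ≤ distLpNorm ⊤ T * ∫⁻ x, ‖h x‖ₑ := by
  obtain ⟨g, hg, hgn⟩ := exists_Lp_of_distLpNorm_lt_top hT
  rw [← hgn, ← hg, (hasDensity_toTemperedDistribution g h).2]
  refine (enorm_integral_le_lintegral_enorm _).trans ?_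
  rw [← lintegral_const_mul' _ _ (by rw [hgn]; exact hT.ne)]
  refine lintegral_mono_ae ?_
  have h1 : ∀ᵐ x, ‖g x‖ₑ ≤ ‖g‖ₑ := by
    rw [Lp.enorm_def, eLpNorm_exponent_top]
    exact enorm_ae_le_eLpNormEssSup _ _
  filter_upwards [h1] with x hx
  rw [enorm_mul, mul_comm]
  gcongr

theorem l2On_univ_eq_eLpNorm {n : ℕ} (F : Rn n → ℂ) :
    l2On (fun ξ => ‖F ξ‖ₑ) Set.univ = eLpNorm F 2 volume := by
  rw [l2On, Measure.restrict_univ, eLpNorm_eq_lintegral_rpow_enorm_toReal (by norm_num) (by norm_num)]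
  norm_num

/-- Plancherel: a distribution whose Fourier transform is square integrable is in `L²`. -/
theorem distLpNorm_two_le {n : ℕ} {T : 𝓢'(Rn n, ℂ)} {F : Rn n → ℂ} (hF : AEStronglyMeasurable F)
    (hT : HasDensity (𝓕 T) F) : distLpNorm 2 T ≤ l2On (fun ξ => ‖F ξ‖ₑ) Set.univ := by
  rcases eq_or_ne (l2On (fun ξ => ‖F ξ‖ₑ) Set.univ) ⊤ with htop | htop
  · rw [htop]; exact le_top
  rw [l2On_univ_eq_eLpNorm] at htop ⊢
  have hmem : MemLp F 2 := ⟨hF, lt_top_iff_ne_top.2 htop⟩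
  set W : Lp ℂ 2 (volume : Measure (Rn n)) := hmem.toLp F with hW
  have h1 : 𝓕 T = Lp.toTemperedDistribution W :=
    (hT.congr_ae hmem.coeFn_toLp.symm).eq_of_density (hasDensity_toTemperedDistribution W)
  have h2 : Lp.toTemperedDistribution (𝓕⁻ W) = T := by
    rw [← Lp.fourierInv_toTemperedDistribution_eq, ← h1, FourierTransform.fourierInv_fourier_eq]
  refine (distLpNorm_le h2).trans (le_of_eq ?_)
  have h3 : ‖(𝓕⁻ W : Lp ℂ 2 (volume : Measure (Rn n)))‖ = ‖W‖ := by
    rw [← Lp.norm_fourier_eq (𝓕⁻ W : Lp ℂ 2 (volume : Measure (Rn n))),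
      FourierTransform.fourier_fourierInv_eq]
  rw [← ofReal_norm, h3, ofReal_norm, Lp.enorm_def]
  exact eLpNorm_congr_ae hmem.coeFn_toLp

/-- A distribution with integrable Fourier transform is bounded. -/
theorem distLpNorm_top_le {n : ℕ} {T : 𝓢'(Rn n, ℂ)} {F : Rn n → ℂ} (hF : AEStronglyMeasurable F)
    (hT : HasDensity (𝓕 T) F) : distLpNorm ⊤ T ≤ ∫⁻ ξ, ‖F ξ‖ₑ := by
  rcases eq_or_ne (∫⁻ ξ, ‖F ξ‖ₑ) ⊤ with htop | htop
  · rw [htop]; exact le_top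
  have hint : Integrable F := ⟨hF, lt_top_iff_ne_top.2 htop⟩
  have hL : Continuous fun p : Rn n × Rn n => (-innerₗ (Rn n)) p.1 p.2 := by
    simp only [LinearMap.neg_apply, innerₗ_apply_apply]
    exact continuous_inner.neg
  have hcont : Continuous (𝓕⁻ F : Rn n → ℂ) :=
    VectorFourier.fourierIntegral_continuous Real.continuous_fourierChar hL hint
  have hbd : ∀ x, ‖(𝓕⁻ F : Rn n → ℂ) x‖ₑ ≤ ∫⁻ ξ, ‖F ξ‖ₑ := by
    intro x
    rw [Real.fourierInv_eq]
    refine (enorm_integral_le_lintegral_enorm _).trans (le_of_eq (lintegral_congr fun ξ => ?_))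
    rw [← ofReal_norm, Circle.norm_smul, ofReal_norm]
  have hmem : MemLp (𝓕⁻ F : Rn n → ℂ) ⊤ :=
    ⟨hcont.aestronglyMeasurable, by
      rw [eLpNorm_exponent_top]
      exact (eLpNormEssSup_le_of_ae_enorm_bound (Eventually.of_forall hbd)).trans_lt
        (lt_top_iff_ne_top.2 htop)⟩
  have h1 : Lp.toTemperedDistribution (hmem.toLp _) = T := by
    ext h
    rw [(hasDensity_toTemperedDistribution (hmem.toLp _) h).2]
    have h2 : T h = 𝓕 T (𝓕⁻ h) := by simp
    rw [h2, (hT (𝓕⁻ h)).2]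
    have h3 := VectorFourier.integral_fourierIntegral_smul_eq_flip (μ := (volume : Measure (Rn n)))
      (ν := (volume : Measure (Rn n))) (L := -innerₗ (Rn n)) Real.continuous_fourierChar hL
      h.integrable hint
    have h4 : (-innerₗ (Rn n)).flip = -innerₗ (Rn n) := by
      ext x y; simp [real_inner_comm]
    rw [h4] at h3
    have h5 : ∫ x, h x * (hmem.toLp _ : Lp ℂ ⊤ (volume : Measure (Rn n))) x
        = ∫ x, h x * (𝓕⁻ F : Rn n → ℂ) x :=
      integral_congr_ae (by filter_upwards [hmem.coeFn_toLp] with x hx; rw [hx])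
    rw [h5, SchwartzMap.fourierInv_coe]
    exact h3.symm
  refine (distLpNorm_le h1).trans ?_
  rw [Lp.enorm_def, eLpNorm_congr_ae hmem.coeFn_toLp, eLpNorm_exponent_top]
  exact eLpNormEssSup_le_of_ae_enorm_bound (Eventually.of_forall hbd)

/-! ### The Besov norm on the Fourier side -/

theorem distLpNorm_dyadicBlock_le {n : ℕ} (χ : LPCutoff n) {T : 𝓢'(Rn n, ℂ)} {F : Rn n → ℂ}
    (hF : AEStronglyMeasurable F) (hT : HasDensityAwayZero (𝓕 T) F) (j : ℤ) :
    distLpNorm 2 (χ.dyadicBlock j T) ≤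
      l2On (fun ξ => ‖F ξ‖ₑ) {ξ | (2 : ℝ) ^ (j + -4) ≤ ‖ξ‖ ∧ ‖ξ‖ < 2 ^ (j + -1)} := by
  refine (distLpNorm_two_le
    ((χ.continuous_dyadicSymbol j).aestronglyMeasurable.mul hF)
    (hT.multiplier (χ.hasTemperateGrowth_dyadicSymbol j) (χ.dyadicSymbol_zero j))).trans ?_
  refine ENNReal.rpow_le_rpow ?_ (by norm_num)
  have hm : MeasurableSet {ξ : Rn n | (2 : ℝ) ^ (j + -4) ≤ ‖ξ‖ ∧ ‖ξ‖ < 2 ^ (j + -1)} :=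
    (measurableSet_le measurable_const measurable_norm).inter
      (measurableSet_lt measurable_norm measurable_const)
  rw [Measure.restrict_univ, ← lintegral_indicator hm]
  refine lintegral_mono fun ξ => ?_
  by_cases hξ : ξ ∈ {ξ : Rn n | (2 : ℝ) ^ (j + -4) ≤ ‖ξ‖ ∧ ‖ξ‖ < 2 ^ (j + -1)}
  · rw [Set.indicator_of_mem hξ]
    refine ENNReal.rpow_le_rpow ?_ (by norm_num)
    have h1 : ‖χ.dyadicSymbol j ξ‖ₑ ≤ 1 := by
      rw [← ofReal_norm, ← ENNReal.ofReal_one]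
      exact ENNReal.ofReal_le_ofReal (χ.norm_dyadicSymbol_le j ξ)
    calc ‖χ.dyadicSymbol j ξ * F ξ‖ₑ = ‖χ.dyadicSymbol j ξ‖ₑ * ‖F ξ‖ₑ := enorm_mul _ _
      _ ≤ 1 * ‖F ξ‖ₑ := by gcongr
      _ = _ := one_mul _
  · have : χ.dyadicSymbol j ξ = 0 := by
      simp only [Set.mem_ofPred_eq, not_and_or, not_le, not_lt] at hξ
      rcases hξ with h | h
      · exact χ.dyadicSymbol_eq_zero_of_lt h
      · exact χ.dyadicSymbol_eq_zero_of_le h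
    simp [this]

/-- The constant relating the Besov norm to the sum over sharp annuli. -/
noncomputable def shiftConst (a b : ℤ) (σ : ℝ) : ℝ≥0∞ :=
  ∑ i ∈ Finset.Ico a b, (2 : ℝ≥0∞) ^ (-(i : ℝ) * σ)

theorem shiftConst_ne_top (a b : ℤ) (σ : ℝ) : shiftConst a b σ ≠ ⊤ :=
  ENNReal.sum_ne_top.2 fun _ _ => two_rpow_ne_top _

/-- A density away from `0` is enough, since the dyadic blocks do not see the frequency `0`. -/
theorem besovNorm_le_annulusSum {n : ℕ} (χ : LPCutoff n) (σ : ℝ) {T : 𝓢'(Rn n, ℂ)} {F : Rn n → ℂ}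
    (hF : AEStronglyMeasurable F) (hT : HasDensityAwayZero (𝓕 T) F) :
    besovNorm χ σ T ≤ shiftConst (-4) (-1) σ * annulusSum σ (fun ξ => ‖F ξ‖ₑ) :=
  calc besovNorm χ σ T ≤ ∑' j : ℤ, (2 : ℝ≥0∞) ^ ((j : ℝ) * σ) *
        l2On (fun ξ => ‖F ξ‖ₑ) {ξ | (2 : ℝ) ^ (j + -4) ≤ ‖ξ‖ ∧ ‖ξ‖ < 2 ^ (j + -1)} :=
        ENNReal.tsum_le_tsum fun j => by
          gcongr
          exact distLpNorm_dyadicBlock_le χ hF hT j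
    _ ≤ _ := tsum_l2On_le σ _ _ _ fun j => subset_iUnion_annulus j (-4) (-1)

/-- The low-frequency condition holds by dominated convergence: `F` is integrable near `0` because
`|ξ|^{-a}` is bounded below there. -/
theorem tendsto_distLpNorm_lowFreq {n : ℕ} (χ : LPCutoff n) {T : 𝓢'(Rn n, ℂ)}
    {F : Rn n → ℂ} (hn : 0 < n) (hF : AEStronglyMeasurable F) (hT : HasDensity (𝓕 T) F) {a : ℝ}
    (ha : 0 ≤ a) (hfin : ∫⁻ ξ, ‖ξ‖ₑ ^ (-a) * ‖F ξ‖ₑ ≠ ⊤) :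
    Tendsto (fun j : ℤ => distLpNorm ⊤ (χ.lowFreq j T)) atBot (𝓝 0) := by
  have hlim : Tendsto (fun j : ℤ => ∫⁻ ξ, ‖χ.lowSymbol j ξ * F ξ‖ₑ) atBot
      (𝓝 (∫⁻ _ : Rn n, 0)) := by
    refine tendsto_lintegral_filter_of_dominated_convergence' (fun ξ => ‖ξ‖ₑ ^ (-a) * ‖F ξ‖ₑ)
      (Eventually.of_forall fun j =>
        ((χ.continuous_lowSymbol j).aestronglyMeasurable.mul hF).enorm) ?_ hfin ?_
    · filter_upwards [eventually_le_atBot 0] with j hj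
      filter_upwards with ξ
      rw [enorm_mul]
      gcongr
      have h2 : (2 : ℝ) ^ j ≤ 1 := zpow_le_one_of_nonpos₀ (by norm_num) hj
      rcases le_or_gt ‖ξ‖ 1 with h1 | h1
      · have h3 : ‖χ.lowSymbol j ξ‖ₑ ≤ 1 := by
          rw [← ofReal_norm, ← ENNReal.ofReal_one]
          exact ENNReal.ofReal_le_ofReal (χ.norm_lowSymbol_le j ξ)
        refine h3.trans ?_
        rw [ENNReal.rpow_neg, ENNReal.one_le_inv]
        refine ENNReal.rpow_le_one ?_ ha
        rw [← ofReal_norm, ← ENNReal.ofReal_one]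
        exact ENNReal.ofReal_le_ofReal h1
      · rw [χ.lowSymbol_eq_zero]
        · simp
        · nlinarith [Real.pi_gt_three]
    · filter_upwards [ae_ne_zero hn] with ξ hξ
      have hpos := norm_pos_iff.2 hξ
      obtain ⟨N, hN⟩ := exists_pow_lt_of_lt_one hpos (show (1 / 2 : ℝ) < 1 by norm_num)
      refine tendsto_const_nhds.congr' ?_
      filter_upwards [eventually_le_atBot (-(N : ℤ))] with j hj
      rw [χ.lowSymbol_eq_zero]
      · simp
      · have : (2 : ℝ) ^ j ≤ (1 / 2) ^ N := by
          calc (2 : ℝ) ^ j ≤ 2 ^ (-(N : ℤ)) := zpow_le_zpow_right₀ (by norm_num) hj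
            _ = _ := by simp
        nlinarith [Real.pi_gt_three]
  rw [lintegral_zero] at hlim
  exact tendsto_of_tendsto_of_tendsto_of_le_of_le tendsto_const_nhds hlim (fun _ => zero_le)
    fun j => distLpNorm_top_le ((χ.continuous_lowSymbol j).aestronglyMeasurable.mul hF)
      (hT.multiplier (χ.hasTemperateGrowth_lowSymbol j))

/-! ### The Fourier transform of an element of the critical Besov space -/

theorem sum_Ico_int_sub {M : Type*} [AddCommGroup M] (b : ℤ → M) (a : ℤ) (m : ℕ) :
    ∑ j ∈ Finset.Ico a (a + m), (b (j + 1) - b j) = b (a + m) - b a := by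
  induction m with
  | zero => simp
  | succ m ih =>
    rw [Nat.cast_succ, ← add_assoc, ← Finset.insert_Ico_right_eq_Ico_add_one (by omega),
      Finset.sum_insert (by simp), ih]
    abel

/-- Every dyadic block of finite `L²` norm has a square integrable density on the Fourier side,
supported in an annulus. -/
theorem exists_density_dyadicBlock {n : ℕ} (χ : LPCutoff n) (T : 𝓢'(Rn n, ℂ)) (j : ℤ)
    (hT : distLpNorm 2 (χ.dyadicBlock j T) < ⊤) :
    ∃ W : Rn n → ℂ, Measurable W ∧ HasDensity (𝓕 (χ.dyadicBlock j T)) W ∧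
      (∀ ξ, W ξ ≠ 0 → (2 : ℝ) ^ (j - 5) ≤ ‖ξ‖ ∧ ‖ξ‖ < 2 ^ j) ∧
      l2On (fun ξ => ‖W ξ‖ₑ) Set.univ ≤ distLpNorm 2 (χ.dyadicBlock j T) := by
  obtain ⟨g, hg, hgn⟩ := exists_Lp_of_distLpNorm_lt_top hT
  set W₀ : Lp ℂ 2 (volume : Measure (Rn n)) := 𝓕 g with hW₀
  have hW₀n : ‖W₀‖ₑ = distLpNorm 2 (χ.dyadicBlock j T) := by
    rw [← ofReal_norm, hW₀, Lp.norm_fourier_eq, ofReal_norm, hgn]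
  have hd : HasDensity (𝓕 (χ.dyadicBlock j T)) W₀ := by
    rw [← hg, Lp.fourier_toTemperedDistribution_eq]
    exact hasDensity_toTemperedDistribution W₀
  -- `ψ = 1` on the support of the symbol of `Δ_j`, so multiplication by `ψ` localises the density
  -- without changing the distribution
  set ψ : Rn n → ℂ := fun ξ => χ.lowSymbol (j + 2) ξ - χ.lowSymbol (j - 1) ξ with hψ
  have hψg : ψ.HasTemperateGrowth :=
    (χ.hasTemperateGrowth_lowSymbol _).sub (χ.hasTemperateGrowth_lowSymbol _)
  have hψφ : ∀ ξ, ψ ξ * χ.dyadicSymbol j ξ = χ.dyadicSymbol j ξ := by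
    intro ξ
    have hj : (0 : ℝ) < 2 ^ j := by positivity
    have e2 : (2 : ℝ) ^ (j + 2) = 2 ^ j * 4 := by rw [zpow_add₀ (by norm_num)]; norm_num
    have e1 : (2 : ℝ) ^ (j + 1) = 2 ^ j * 2 := by rw [zpow_add₀ (by norm_num)]; norm_num
    have em : (2 : ℝ) ^ (j - 1) = 2 ^ j / 2 := by rw [zpow_sub₀ (by norm_num)]; norm_num
    rcases lt_or_ge (2 * Real.pi * ‖ξ‖) (3 / 4 * 2 ^ j) with h1 | h1
    · have : χ.dyadicSymbol j ξ = 0 := by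
        rw [χ.dyadicSymbol_eq, χ.lowSymbol_eq_one h1, χ.lowSymbol_eq_one, sub_self]
        rw [e1]; linarith
      rw [this, mul_zero]
    rcases lt_or_ge (8 / 3 * 2 ^ j) (2 * Real.pi * ‖ξ‖) with h2 | h2
    · have : χ.dyadicSymbol j ξ = 0 := by
        rw [χ.dyadicSymbol_eq, χ.lowSymbol_eq_zero (j := j), χ.lowSymbol_eq_zero, sub_self]
        · rw [e1]; linarith
        · linarith
      rw [this, mul_zero]
    · have : ψ ξ = 1 := by
        simp only [hψ]
        rw [χ.lowSymbol_eq_one, χ.lowSymbol_eq_zero, sub_zero]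
        · rw [em]; linarith
        · rw [e2]; linarith
      rw [this, one_mul]
  have hd' : HasDensity (𝓕 (χ.dyadicBlock j T)) (fun ξ => ψ ξ * W₀ ξ) := by
    have h1 : TemperedDistribution.fourierMultiplierCLM ℂ ψ (χ.dyadicBlock j T)
        = χ.dyadicBlock j T := by
      rw [LPCutoff.dyadicBlock,
        TemperedDistribution.fourierMultiplierCLM_fourierMultiplierCLM_apply
          (χ.hasTemperateGrowth_dyadicSymbol j) hψg]
      congr 2
      ext ξ
      rw [Pi.mul_apply, mul_comm, hψφ]
    have h2 := hd.multiplier hψg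
    rwa [h1] at h2
  have hloc : LocallyIntegrable W₀ := (Lp.memLp W₀).locallyIntegrable (by norm_num)
  have hloc' : LocallyIntegrable (fun ξ => ψ ξ * W₀ ξ) :=
    hloc.continuous_smul ((χ.continuous_lowSymbol _).sub (χ.continuous_lowSymbol _))
  have hae := hd.ae_eq hloc hloc' hd'
  have hψ0 : ∀ ξ, ψ ξ ≠ 0 → (2 : ℝ) ^ (j - 5) ≤ ‖ξ‖ ∧ ‖ξ‖ < 2 ^ j := by
    intro ξ hξ
    have hsum : ψ ξ = χ.dyadicSymbol (j - 1) ξ + χ.dyadicSymbol j ξ + χ.dyadicSymbol (j + 1) ξ := by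
      simp only [hψ, χ.dyadicSymbol_eq]
      rw [show j - 1 + 1 = j by ring, show j + 1 + 1 = j + 2 by ring]
      ring
    constructor
    · by_contra h
      push Not at h
      refine hξ ?_
      have hle : ∀ i, j - 5 ≤ i - 4 → χ.dyadicSymbol i ξ = 0 := fun i hi =>
        χ.dyadicSymbol_eq_zero_of_lt (h.trans_le (zpow_le_zpow_right₀ (by norm_num) hi))
      rw [hsum, hle _ (by omega), hle _ (by omega), hle _ (by omega)]; simp
    · by_contra h
      push Not at h
      refine hξ ?_
      have hle : ∀ i, i - 1 ≤ j → χ.dyadicSymbol i ξ = 0 := fun i hi =>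
        χ.dyadicSymbol_eq_zero_of_le ((zpow_le_zpow_right₀ (by norm_num) hi).trans h)
      rw [hsum, hle _ (by omega), hle _ (by omega), hle _ (by omega)]; simp
  refine ⟨fun ξ => ψ ξ * W₀ ξ, ?_, hd', fun ξ hξ => hψ0 ξ (left_ne_zero_of_mul hξ), ?_⟩
  · exact ((χ.continuous_lowSymbol _).sub (χ.continuous_lowSymbol _)).measurable.mul
      (Lp.stronglyMeasurable W₀).measurable
  · rw [← hW₀n, Lp.enorm_def, ← l2On_univ_eq_eLpNorm]
    refine le_of_eq (l2On_congr_ae ?_ _)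
    filter_upwards [hae] with ξ hξ
    rw [← hξ]

/-- The Fourier transform of an element of `Ḃ^{n/2}_{2,1}` is an integrable function. The condition
on the low frequencies excludes polynomials, whose Fourier transform is concentrated at `0`. -/
theorem exists_density_of_memBesov {n : ℕ} (hn : 0 < n) (χ : LPCutoff n) (T : 𝓢'(Rn n, ℂ))
    (hT : MemBesov χ ((n : ℝ) / 2) T) :
    ∃ V : Rn n → ℂ, Measurable V ∧ HasDensity (𝓕 T) V ∧
      annulusSum ((n : ℝ) / 2) (fun ξ => ‖V ξ‖ₑ) ≤
        shiftConst 1 6 ((n : ℝ) / 2) * besovNorm χ ((n : ℝ) / 2) T := by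
  obtain ⟨hlow, hfin⟩ := hT
  set σ : ℝ := (n : ℝ) / 2 with hσ
  have hblock : ∀ j, distLpNorm 2 (χ.dyadicBlock j T) < ⊤ := by
    intro j
    have h1 := (ENNReal.le_tsum j).trans_lt hfin
    by_contra h
    rw [not_lt, top_le_iff] at h
    simp only [h, ENNReal.mul_top (two_rpow_ne_zero _)] at h1
    exact lt_irrefl _ h1
  choose W hWm hWd hWs hWn using fun j => exists_density_dyadicBlock χ T j (hblock j)
  set G : Rn n → ℝ≥0∞ := fun ξ => ∑' j, ‖W j ξ‖ₑ with hG
  have hGm : Measurable G := Measurable.tsum fun j => (hWm j).enorm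
  -- on a fixed annulus only five of the `W j` do not vanish
  have hzero : ∀ k, ∀ ξ ∈ annulus n k, ∀ j, j ∉ Finset.Ico (k + 1) (k + 6) → W j ξ = 0 := by
    intro k ξ hξ j hj
    by_contra h
    obtain ⟨h1, h2⟩ := hWs j ξ h
    have ha : j - 5 < k + 1 := (zpow_lt_zpow_iff_right₀ one_lt_two).1 (h1.trans_lt hξ.2)
    have hb : k < j := (zpow_lt_zpow_iff_right₀ one_lt_two).1 (hξ.1.trans_lt h2)
    exact hj (Finset.mem_Ico.2 ⟨by omega, by omega⟩)
  have hsummable : ∀ ξ, (Function.support fun j => W j ξ).Finite := by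
    intro ξ
    by_cases h0 : ξ = 0
    · have : (Function.support fun j => W j ξ) = ∅ := by
        ext j
        simp only [Function.mem_support, Set.mem_empty_iff_false, iff_false, not_not]
        by_contra h
        have := (hWs j ξ h).1
        rw [h0, norm_zero] at this
        exact absurd this (not_le.2 (by positivity))
      rw [this]; exact Set.finite_empty
    · obtain ⟨k, hk⟩ := exists_mem_annulus h0
      refine (Finset.Ico (k + 1) (k + 6)).finite_toSet.subset fun j hj => ?_
      by_contra h
      exact hj (hzero k ξ hk j h)
  have hGsum : ∀ k, ∀ ξ ∈ annulus n k, G ξ = ∑ i ∈ Finset.Ico (1 : ℤ) 6, ‖W (k + i) ξ‖ₑ := by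
    intro k ξ hξ
    rw [hG]
    simp only
    rw [tsum_eq_sum (s := Finset.Ico (k + 1) (k + 6)) fun j hj => by simp [hzero k ξ hξ j hj]]
    refine (Finset.sum_bij (fun i _ => k + i) ?_ ?_ ?_ ?_).symm
    · intro i hi; simp only [Finset.mem_Ico] at hi ⊢; omega
    · intro i _ i' _ h; omega
    · intro j hj
      simp only [Finset.mem_Ico] at hj ⊢
      exact ⟨j - k, by omega, by omega⟩
    · intro i _; rfl
  have hGann : annulusSum σ G ≤ shiftConst 1 6 σ * besovNorm χ σ T := by
    calc annulusSum σ G ≤ ∑' k : ℤ, ∑ i ∈ Finset.Ico (1 : ℤ) 6,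
          (2 : ℝ≥0∞) ^ ((k : ℝ) * σ) * distLpNorm 2 (χ.dyadicBlock (k + i) T) := by
          refine ENNReal.tsum_le_tsum fun k => ?_
          rw [← Finset.mul_sum]
          gcongr
          calc l2On G (annulus n k)
              ≤ l2On (fun ξ => ∑ i ∈ Finset.Ico (1 : ℤ) 6, ‖W (k + i) ξ‖ₑ) (annulus n k) :=
                l2On_mono (measurableSet_annulus n k) (fun ξ hξ => (hGsum k ξ hξ).le) subset_rfl
            _ ≤ ∑ i ∈ Finset.Ico (1 : ℤ) 6, l2On (fun ξ => ‖W (k + i) ξ‖ₑ) (annulus n k) :=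
                l2On_sum_le _ (fun i => (hWm _).enorm.aemeasurable) _
            _ ≤ _ := by
                gcongr with i hi
                exact (l2On_mono MeasurableSet.univ (fun _ _ => le_rfl)
                  (Set.subset_univ _)).trans (hWn _)
      _ = ∑ i ∈ Finset.Ico (1 : ℤ) 6, ∑' k : ℤ,
          (2 : ℝ≥0∞) ^ ((k : ℝ) * σ) * distLpNorm 2 (χ.dyadicBlock (k + i) T) :=
          Summable.tsum_finsetSum fun i _ => ENNReal.summable
      _ = _ := by
          rw [shiftConst, Finset.sum_mul]
          exact Finset.sum_congr rfl fun i _ =>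
            tsum_two_rpow_shift σ (fun j => distLpNorm 2 (χ.dyadicBlock j T)) i
  have hGfin : ∫⁻ ξ, G ξ ≠ ⊤ := by
    refine ne_top_of_le_ne_top ?_ (lintegral_le_annulusSum hn hGm.aemeasurable)
    refine ENNReal.mul_ne_top (bernsteinConst_ne_top n) (ne_top_of_le_ne_top ?_ hGann)
    exact ENNReal.mul_ne_top (shiftConst_ne_top _ _ _) hfin.ne
  set V : Rn n → ℂ := fun ξ => ∑' j, W j ξ with hV
  have hVhas : ∀ ξ, HasSum (fun j => W j ξ) (V ξ) := fun ξ =>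
    (summable_of_hasFiniteSupport (hsummable ξ)).hasSum
  have hVm : Measurable V := by
    refine measurable_of_tendsto_metrizable' (atTop : Filter (Finset ℤ))
      (f := fun s ξ => ∑ j ∈ s, W j ξ) (fun s => Finset.measurable_fun_sum s fun j _ => hWm j) ?_
    exact tendsto_pi_nhds.2 fun ξ => hVhas ξ
  have hVG : ∀ ξ, ‖V ξ‖ₑ ≤ G ξ := fun ξ => by
    rw [hV, hG]
    exact enorm_tsum_le_tsum_enorm
  refine ⟨V, hVm, fun h => ?_, (annulusSum_mono σ hVG).trans hGann⟩
  have hhb : ∀ ξ, ‖h ξ‖ₑ ≤ ENNReal.ofReal (decayNorm 0 h) := fun ξ => by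
    rw [← ofReal_norm]
    exact ENNReal.ofReal_le_ofReal (norm_apply_le_decayNorm' 0 h ξ)
  have hhW : ∀ j, Measurable fun ξ => h ξ * W j ξ := fun j => h.continuous.measurable.mul (hWm j)
  have hsumfin : ∑' j, ∫⁻ ξ, ‖h ξ * W j ξ‖ₑ ≠ ⊤ := by
    refine ne_top_of_le_ne_top (ENNReal.mul_ne_top (ENNReal.ofReal_ne_top (r := decayNorm 0 h))
      hGfin) ?_
    rw [← lintegral_tsum fun j => (hhW j).enorm.aemeasurable, ← lintegral_const_mul _ hGm]
    refine lintegral_mono fun ξ => ?_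
    rw [hG, ← ENNReal.tsum_mul_left]
    refine ENNReal.tsum_le_tsum fun j => ?_
    rw [enorm_mul]
    gcongr
    exact hhb ξ
  have hFint : ∀ j, Integrable (fun ξ => h ξ * W j ξ) := fun j =>
    ⟨(hhW j).aestronglyMeasurable, lt_top_iff_ne_top.2 (ENNReal.ne_top_of_tsum_ne_top hsumfin j)⟩
  have hHas := hasSum_integral_of_summable_integral_norm hFint (by
    simp_rw [integral_norm_eq_lintegral_enorm (hFint _).1]
    exact ENNReal.summable_toReal hsumfin)
  have htsum : ∀ ξ, ∑' j, h ξ * W j ξ = h ξ * V ξ := fun ξ => tsum_mul_left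
  simp_rw [htsum] at hHas
  refine ⟨⟨(h.continuous.measurable.mul hVm).aestronglyMeasurable, ?_⟩, ?_⟩
  · refine lt_of_le_of_lt ?_ (lt_top_iff_ne_top.2 (ENNReal.mul_ne_top
      (ENNReal.ofReal_ne_top (r := decayNorm 0 h)) hGfin))
    rw [← lintegral_const_mul _ hGm]
    refine lintegral_mono fun ξ => ?_
    rw [enorm_mul]
    gcongr
    exacts [hhb ξ, hVG ξ]
  · have hpart : Tendsto (fun N : ℕ => ∑ j ∈ Finset.Ico (-(N : ℤ)) N, ∫ ξ, h ξ * W j ξ) atTop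
        (𝓝 (∫ ξ, h ξ * V ξ)) :=
      hHas.comp (Finset.tendsto_Ico_neg_atTop_atTop.comp tendsto_natCast_atTop_atTop)
    set b : ℤ → ℂ := fun j => 𝓕 T (SchwartzMap.smulLeftCLM ℂ (χ.lowSymbol j) h) with hb
    have hterm : ∀ j, ∫ ξ, h ξ * W j ξ = b (j + 1) - b j := by
      intro j
      rw [← (hWd j h).2, LPCutoff.dyadicBlock, fourier_fourierMultiplierCLM,
        χ.dyadicSymbol_eq_sub, SchwartzMap.smulLeftCLM_sub (χ.hasTemperateGrowth_lowSymbol _)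
          (χ.hasTemperateGrowth_lowSymbol _), _root_.sub_apply, map_sub]
    -- the partial sums telescope to `χ(2^{-N}D) - χ(2^{N}D)`, whose second term tends to `0` by the
    -- low-frequency condition
    have hpart' : ∀ N : ℕ, ∑ j ∈ Finset.Ico (-(N : ℤ)) N, ∫ ξ, h ξ * W j ξ = b N - b (-N) := by
      intro N
      have := sum_Ico_int_sub b (-N) (2 * N)
      rw [show (-(N : ℤ) + (2 * N : ℕ)) = N by push_cast; ring] at this
      rw [← this]
      exact Finset.sum_congr rfl fun j _ => hterm j
    have hb1 : Tendsto (fun N : ℕ => b N) atTop (𝓝 (𝓕 T h)) :=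
      (χ.tendsto_apply_smulLeftCLM_lowSymbol (𝓕 T) h).comp tendsto_natCast_atTop_atTop
    have hb0 : Tendsto b atBot (𝓝 0) := by
      rw [tendsto_zero_iff_enorm_tendsto_zero]
      have hbound : ∀ᶠ j : ℤ in atBot, ‖b j‖ₑ ≤
          distLpNorm ⊤ (χ.lowFreq j T) * ∫⁻ x, ‖(𝓕 h : 𝓢(Rn n, ℂ)) x‖ₑ := by
        filter_upwards [hlow.eventually_lt_const (show (0 : ℝ≥0∞) < ⊤ by simp)] with j hj
        have : b j = χ.lowFreq j T (𝓕 h) := by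
          rw [hb]
          simp only
          rw [← fourier_fourierMultiplierCLM, TemperedDistribution.fourier_apply]
          rfl
        rw [this]
        exact enorm_apply_le_distLpNorm_top _ _ hj
      have hI : ∫⁻ x, ‖(𝓕 h : 𝓢(Rn n, ℂ)) x‖ₑ ≠ ⊤ := (𝓕 h : 𝓢(Rn n, ℂ)).integrable.2.ne
      have h0 := ENNReal.Tendsto.mul_const hlow (Or.inr hI)
      rw [zero_mul] at h0
      exact tendsto_of_tendsto_of_tendsto_of_le_of_le' tendsto_const_nhds h0
        (Eventually.of_forall fun _ => zero_le) hbound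
    have hb2 : Tendsto (fun N : ℕ => b (-N)) atTop (𝓝 0) :=
      hb0.comp (tendsto_neg_atTop_atBot.comp tendsto_natCast_atTop_atTop)
    have hlim := hb1.sub hb2
    rw [sub_zero] at hlim
    simp_rw [hpart'] at hpart
    exact tendsto_nhds_unique hlim hpart

/-! ### Pointwise bounds for the commutator kernel -/

theorem rpow_le_rpow_abs {c r : ℝ} (hc : 0 < c) (h1 : c⁻¹ ≤ r) (h2 : r ≤ c) (a : ℝ) :
    r ^ a ≤ c ^ |a| := by
  have hr : 0 < r := (inv_pos.2 hc).trans_le h1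
  rcases le_total 0 a with ha | ha
  · rw [abs_of_nonneg ha]
    exact Real.rpow_le_rpow hr.le h2 ha
  · rw [abs_of_nonpos ha]
    calc r ^ a = (r⁻¹) ^ (-a) := by rw [Real.inv_rpow hr.le, Real.rpow_neg hr.le, inv_inv]
      _ ≤ c ^ (-a) := Real.rpow_le_rpow (inv_pos.2 hr).le (inv_le_of_inv_le₀ hc h1) (by linarith)

/-- The mean value inequality for `t ↦ t^s` at comparable arguments. -/
theorem abs_rpow_sub_rpow_le (s : ℝ) {x z : ℝ} (hx : 0 < x) (h1 : x / 2 ≤ z) (h2 : z ≤ 3 * x / 2) :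
    |x ^ s - z ^ s| ≤ |s| * 2 ^ |s - 1| * |x - z| * x ^ (s - 1) := by
  have hz : 0 < z := by linarith
  have key : ∀ t ∈ Set.Icc (1 / 2 : ℝ) (3 / 2),
      ‖(1 : ℝ) ^ s - t ^ s‖ ≤ |s| * 2 ^ |s - 1| * ‖1 - t‖ := by
    intro t ht
    refine Convex.norm_image_sub_le_of_norm_hasDerivWithin_le (𝕜 := ℝ)
      (f := fun t => t ^ s) (f' := fun t => s * t ^ (s - 1)) (s := Set.Icc (1 / 2) (3 / 2))
      (fun r hr => ?_) (fun r hr => ?_) (convex_Icc _ _) ht (by norm_num)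
    · exact (Real.hasDerivAt_rpow_const (Or.inl (by linarith [hr.1]))).hasDerivWithinAt
    · have hr0 : 0 < r := by linarith [hr.1]
      rw [norm_mul, Real.norm_eq_abs, Real.norm_of_nonneg (by positivity)]
      gcongr
      exact rpow_le_rpow_abs two_pos (by linarith [hr.1]) (by linarith [hr.2]) _
  have h3 := key (z / x) ⟨by rw [le_div_iff₀ hx]; linarith, by rw [div_le_iff₀ hx]; linarith⟩
  rw [Real.one_rpow, Real.div_rpow hz.le hx.le, Real.norm_eq_abs, Real.norm_eq_abs] at h3
  have e1 : |x ^ s - z ^ s| = |1 - z ^ s / x ^ s| * x ^ s := by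
    rw [← abs_of_pos (Real.rpow_pos_of_pos hx s), ← abs_mul, abs_of_pos (Real.rpow_pos_of_pos hx s)]
    congr 1
    field_simp
  have e2 : |x - z| = |1 - z / x| * x := by
    conv_rhs => rw [← abs_of_pos hx, ← abs_mul, abs_of_pos hx]
    congr 1
    field_simp
  rw [e1, e2]
  calc |1 - z ^ s / x ^ s| * x ^ s ≤ (|s| * 2 ^ |s - 1| * |1 - z / x|) * x ^ s := by gcongr
    _ = |s| * 2 ^ |s - 1| * (|1 - z / x| * x) * x ^ (s - 1) := by
        rw [Real.rpow_sub_one hx.ne']; field_simp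

/-- The constant in the pointwise bounds for the commutator kernel. -/
noncomputable def kernelConst (s θ : ℝ) : ℝ :=
  |s| * 2 ^ |s - 1| + 4 + 3 ^ |s| * (2 ^ (1 - θ) + 2 ^ (1 - s - θ))

theorem kernelConst_nonneg (s θ : ℝ) : 0 ≤ kernelConst s θ := by
  unfold kernelConst; positivity

/-- If one of the two input frequencies is small compared with the output frequency `x`, then the
commutator gains one derivative, which compensates the factor `1 / y`. -/
theorem kernel_le_of_low {s θ : ℝ} (hs : -1 ≤ s) {x y z : ℝ} (hx : 0 < x) (hy : 0 < y)
    (hz : 0 < z) (h1 : x ≤ y + z) (h2 : z ≤ x + y) (h : y ≤ x / 2 ∨ z ≤ x / 2) :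
    |x ^ s - z ^ s| * (min x z * y⁻¹) ≤ kernelConst s θ * x ^ s := by
  have hp1 : (0 : ℝ) ≤ |s| * 2 ^ |s - 1| := by positivity
  have hp3 : (0 : ℝ) ≤ 3 ^ |s| * (2 ^ (1 - θ) + 2 ^ (1 - s - θ)) := by positivity
  have hxs := Real.rpow_pos_of_pos hx s
  rcases le_or_gt y (x / 2) with hyx | hyx
  · have h3 := abs_rpow_sub_rpow_le s hx (z := z) (by linarith) (by linarith)
    have h4 : |x - z| ≤ y := abs_le.2 ⟨by linarith, by linarith⟩
    calc |x ^ s - z ^ s| * (min x z * y⁻¹)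
        ≤ (|s| * 2 ^ |s - 1| * y * x ^ (s - 1)) * (x * y⁻¹) := by
          refine mul_le_mul (h3.trans (by gcongr)) ?_ (by positivity) (by positivity)
          gcongr
          exact min_le_left _ _
      _ = |s| * 2 ^ |s - 1| * x ^ s := by
          rw [Real.rpow_sub_one hx.ne']; field_simp
      _ ≤ _ := by
          unfold kernelConst
          gcongr
          linarith
  · have hzx : z ≤ x / 2 := by
      rcases h with h | h
      · linarith
      · exact h
    have h5 : z ^ s * z ≤ x ^ s * x := by
      rw [← Real.rpow_add_one hz.ne', ← Real.rpow_add_one hx.ne']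
      exact Real.rpow_le_rpow hz.le (by linarith) (by linarith)
    have hzs := Real.rpow_pos_of_pos hz s
    calc |x ^ s - z ^ s| * (min x z * y⁻¹) ≤ (x ^ s + z ^ s) * (z * (x / 2)⁻¹) := by
          refine mul_le_mul ?_ ?_ (by positivity) (by positivity)
          · rw [abs_le]; constructor <;> linarith
          · gcongr
            exact min_le_right _ _
      _ = 2 * (x ^ s * z + z ^ s * z) / x := by field_simp
      _ ≤ 2 * (x ^ s * x + x ^ s * x) / x := by gcongr; linarith
      _ = 4 * x ^ s := by field_simp; ring
      _ ≤ _ := by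
          unfold kernelConst
          gcongr
          linarith

/-- If both input frequencies are at least half of the output frequency `x`, then they are
comparable and the kernel decays like a power of `x / y`. -/
theorem kernel_le_of_high {s θ : ℝ} (hθ1 : θ ≤ 1) (hθs : θ ≤ 1 - s) {x y z : ℝ} (hx : 0 < x)
    (hy : 0 < y) (hz : 0 < z) (hzy : z ≤ 3 * y) (hyz : y ≤ 3 * z) (h : x / 2 < y) :
    |x ^ s - z ^ s| * (min x z * y⁻¹) ≤ kernelConst s θ * (x ^ s * (x / y) ^ θ) := by
  have hxs := Real.rpow_pos_of_pos hx s
  have hzs := Real.rpow_pos_of_pos hz s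
  have hys := Real.rpow_pos_of_pos hy s
  have hr : 0 < x / y := by positivity
  have hr2 : x / y ≤ 2 := by rw [div_le_iff₀ hy]; linarith
  have hpow : ∀ a, θ ≤ a → (x / y) ^ a ≤ 2 ^ (a - θ) * (x / y) ^ θ := by
    intro a ha
    calc (x / y) ^ a = (x / y) ^ (a - θ) * (x / y) ^ θ := by
          rw [← Real.rpow_add hr]; congr 1; ring
      _ ≤ _ := by
          gcongr
  have hzs' : z ^ s ≤ 3 ^ |s| * y ^ s := by
    have := rpow_le_rpow_abs (show (0 : ℝ) < 3 by norm_num) (r := z / y)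
      (by rw [le_div_iff₀ hy]; linarith) (by rw [div_le_iff₀ hy]; linarith) s
    rw [Real.div_rpow hz.le hy.le, div_le_iff₀ hys] at this
    exact this
  have h3 : (1 : ℝ) ≤ 3 ^ |s| := Real.one_le_rpow (by norm_num) (abs_nonneg s)
  calc |x ^ s - z ^ s| * (min x z * y⁻¹) ≤ (3 ^ |s| * x ^ s + 3 ^ |s| * y ^ s) * (x * y⁻¹) := by
        refine mul_le_mul ?_ ?_ (by positivity) (by positivity)
        · have : x ^ s ≤ 3 ^ |s| * x ^ s := le_mul_of_one_le_left hxs.le h3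
          have h0 : 0 ≤ 3 ^ |s| * y ^ s := by positivity
          rw [abs_le]; constructor <;> linarith
        · gcongr
          exact min_le_left _ _
    _ = 3 ^ |s| * x ^ s * ((x / y) ^ (1 : ℝ) + (x / y) ^ (1 - s)) := by
        rw [Real.rpow_sub hr, Real.rpow_one, Real.div_rpow hx.le hy.le]
        field_simp
    _ ≤ 3 ^ |s| * x ^ s *
        (2 ^ (1 - θ) * (x / y) ^ θ + 2 ^ (1 - s - θ) * (x / y) ^ θ) := by
        gcongr
        exacts [hpow 1 hθ1, hpow (1 - s) hθs]
    _ = (3 ^ |s| * (2 ^ (1 - θ) + 2 ^ (1 - s - θ))) * (x ^ s * (x / y) ^ θ) := by ring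
    _ ≤ _ := by
        unfold kernelConst
        gcongr
        have : (0 : ℝ) ≤ |s| * 2 ^ |s - 1| := by positivity
        linarith

/-! ### The bilinear estimate -/

theorem measurable_mul_comp_sub {n : ℕ} {A B : Rn n → ℝ≥0∞} (hA : Measurable A)
    (hB : Measurable B) : Measurable fun p : Rn n × Rn n => A p.2 * B (p.1 - p.2) :=
  (hA.comp measurable_snd).mul (hB.comp (measurable_fst.sub measurable_snd))

/-- Young's inequality `‖A * B‖_{L²} ≤ ‖A‖_{L¹} ‖B‖_{L²}`. -/
theorem l2On_convolution_le {n : ℕ} {A B : Rn n → ℝ≥0∞} (hA : Measurable A) (hB : Measurable B) :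
    l2On (fun ξ => ∫⁻ η, A η * B (ξ - η)) Set.univ ≤ (∫⁻ η, A η) * l2On B Set.univ := by
  have hcs : ∀ ξ, (∫⁻ η, A η * B (ξ - η)) ^ (2 : ℝ)
      ≤ (∫⁻ η, A η) * ∫⁻ η, A η * B (ξ - η) ^ (2 : ℝ) := by
    intro ξ
    have hB' : Measurable fun η => B (ξ - η) := hB.comp (measurable_const.sub measurable_id)
    have h1 := ENNReal.lintegral_mul_le_Lp_mul_Lq (volume : Measure (Rn n))
      Real.HolderConjugate.two_two (f := fun η => A η ^ (1 / 2 : ℝ))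
      (g := fun η => A η ^ (1 / 2 : ℝ) * B (ξ - η))
      (hA.pow_const _).aemeasurable ((hA.pow_const _).mul hB').aemeasurable
    have e : ∀ η, A η ^ (1 / 2 : ℝ) * (A η ^ (1 / 2 : ℝ) * B (ξ - η)) = A η * B (ξ - η) := by
      intro η
      rw [← mul_assoc, ← ENNReal.rpow_add_of_nonneg _ _ (by norm_num) (by norm_num)]
      norm_num
    simp only [Pi.mul_apply, e, ENNReal.mul_rpow_of_nonneg _ _ (show (0 : ℝ) ≤ 2 by norm_num),
      ← ENNReal.rpow_mul] at h1
    norm_num at h1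
    calc (∫⁻ η, A η * B (ξ - η)) ^ (2 : ℝ)
        ≤ ((∫⁻ η, A η) ^ (2⁻¹ : ℝ) * (∫⁻ η, A η * B (ξ - η) ^ 2) ^ (2⁻¹ : ℝ)) ^ (2 : ℝ) := by
          refine ENNReal.rpow_le_rpow ?_ (by norm_num)
          simpa using h1
      _ = _ := by
          rw [ENNReal.mul_rpow_of_nonneg _ _ (by norm_num), ← ENNReal.rpow_mul, ← ENNReal.rpow_mul]
          norm_num
  have hB2 : Measurable fun ξ => B ξ ^ (2 : ℝ) := hB.pow_const _
  have hfub : ∫⁻ ξ, ∫⁻ η, A η * B (ξ - η) ^ (2 : ℝ) = (∫⁻ η, A η) * ∫⁻ ξ, B ξ ^ (2 : ℝ) := by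
    rw [lintegral_lintegral_swap (measurable_mul_comp_sub hA hB2).aemeasurable,
      ← lintegral_mul_const _ hA]
    refine lintegral_congr fun η => ?_
    have hBs : Measurable fun ξ => B (ξ - η) ^ (2 : ℝ) :=
      hB2.comp (measurable_id.sub measurable_const)
    rw [lintegral_const_mul _ hBs, lintegral_sub_right_eq_self (fun ξ => B ξ ^ (2 : ℝ)) η]
  have hmeas : Measurable fun ξ => ∫⁻ η, A η * B (ξ - η) ^ (2 : ℝ) :=
    (measurable_mul_comp_sub hA hB2).lintegral_prod_right'
  calc l2On (fun ξ => ∫⁻ η, A η * B (ξ - η)) Set.univ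
      ≤ (∫⁻ ξ, (∫⁻ η, A η) * ∫⁻ η, A η * B (ξ - η) ^ (2 : ℝ)) ^ (1 / 2 : ℝ) := by
        rw [l2On, Measure.restrict_univ]
        exact ENNReal.rpow_le_rpow (lintegral_mono hcs) (by norm_num)
    _ = _ := by
        rw [lintegral_const_mul _ hmeas, hfub, ← mul_assoc,
          ENNReal.mul_rpow_of_nonneg _ _ (by norm_num), l2On, Measure.restrict_univ,
          ← sq, ← ENNReal.rpow_two, ← ENNReal.rpow_mul]
        norm_num

theorem convolution_comm {n : ℕ} (A B : Rn n → ℝ≥0∞) (ξ : Rn n) :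
    ∫⁻ η, A η * B (ξ - η) = ∫⁻ η, B η * A (ξ - η) := by
  rw [← lintegral_sub_left_eq_self (fun η => A η * B (ξ - η)) ξ]
  refine lintegral_congr fun η => ?_
  rw [sub_sub_cancel, mul_comm]

/-- The radii comparable with `2^j`, up to the factors `2^a` and `2^b`. -/
def fatAnnulus (n : ℕ) (a b j : ℤ) : Set (Rn n) :=
  {ξ | (2 : ℝ) ^ (j + a) ≤ ‖ξ‖ ∧ ‖ξ‖ < 2 ^ (j + b)}

theorem measurableSet_fatAnnulus (n : ℕ) (a b j : ℤ) : MeasurableSet (fatAnnulus n a b j) :=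
  (measurableSet_le measurable_const measurable_norm).inter
    (measurableSet_lt measurable_norm measurable_const)

theorem l2On_indicator {n : ℕ} (f : Rn n → ℝ≥0∞) {S : Set (Rn n)} (hS : MeasurableSet S) :
    l2On (S.indicator f) Set.univ = l2On f S := by
  rw [l2On, l2On, Measure.restrict_univ, ← lintegral_indicator hS]
  congr 2
  ext ξ
  by_cases h : ξ ∈ S
  · simp [h]
  · simp [h]

theorem tsum_l2On_fatAnnulus_le {n : ℕ} (σ : ℝ) (f : Rn n → ℝ≥0∞) (a b : ℤ) :
    ∑' j : ℤ, (2 : ℝ≥0∞) ^ ((j : ℝ) * σ) * l2On f (fatAnnulus n a b j)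
      ≤ shiftConst a b σ * annulusSum σ f :=
  tsum_l2On_le σ f _ _ fun j => subset_iUnion_annulus j a b

/-- Low frequencies of one factor times frequencies of the other factor comparable with the output
frequency. -/
theorem tsum_low_high_le {n : ℕ} (hn : 0 < n) {A B : Rn n → ℝ≥0∞} (hA : Measurable A)
    (hB : Measurable B) :
    ∑' j : ℤ, (2 : ℝ≥0∞) ^ ((j : ℝ) * (n / 2)) *
        l2On (fun ξ => ∫⁻ η, A η * (fatAnnulus n (-1) 2 j).indicator B (ξ - η)) (annulus n j)
      ≤ bernsteinConst n * shiftConst (-1) 2 (n / 2) *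
        (annulusSum (n / 2) A * annulusSum (n / 2) B) := by
  calc _ ≤ ∑' j : ℤ, (∫⁻ η, A η) *
        ((2 : ℝ≥0∞) ^ ((j : ℝ) * (n / 2)) * l2On B (fatAnnulus n (-1) 2 j)) := by
        refine ENNReal.tsum_le_tsum fun j => ?_
        have hm := measurableSet_fatAnnulus n (-1) 2 j
        have h1 := (l2On_mono (f := fun ξ => ∫⁻ η, A η * (fatAnnulus n (-1) 2 j).indicator B (ξ - η))
          MeasurableSet.univ (fun _ _ => le_rfl) (Set.subset_univ (annulus n j))).trans
          (l2On_convolution_le hA (hB.indicator hm))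
        rw [l2On_indicator B hm] at h1
        calc _ ≤ (2 : ℝ≥0∞) ^ ((j : ℝ) * (n / 2)) *
              ((∫⁻ η, A η) * l2On B (fatAnnulus n (-1) 2 j)) := by gcongr
          _ = _ := by ring
    _ ≤ (bernsteinConst n * annulusSum (n / 2) A) *
        (shiftConst (-1) 2 (n / 2) * annulusSum (n / 2) B) := by
        rw [ENNReal.tsum_mul_left]
        gcongr
        · exact lintegral_le_annulusSum hn hA.aemeasurable
        · exact tsum_l2On_fatAnnulus_le _ _ _ _
    _ = _ := by ring

theorem tsum_mul_le_tsum_mul_tsum {ι : Type*} (x y : ι → ℝ≥0∞) :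
    ∑' l, x l * y l ≤ (∑' l, x l) * ∑' l, y l := by
  rw [← ENNReal.tsum_mul_right]
  exact ENNReal.tsum_le_tsum fun l => by gcongr; exact ENNReal.le_tsum l

theorem tsum_geometric_ne_top {δ : ℝ} (hδ : 0 < δ) :
    ∑' m : ℕ, (2 : ℝ≥0∞) ^ ((1 - (m : ℝ)) * δ) ≠ ⊤ := by
  have e : ∀ m : ℕ, (2 : ℝ≥0∞) ^ ((1 - (m : ℝ)) * δ) = 2 ^ δ * (2 ^ (-δ)) ^ m := by
    intro m
    rw [← ENNReal.rpow_natCast, ← ENNReal.rpow_mul, ← two_rpow_add]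
    congr 1; ring
  simp_rw [e]
  rw [ENNReal.tsum_mul_left, ENNReal.tsum_geometric]
  refine ENNReal.mul_ne_top (two_rpow_ne_top _) (ENNReal.inv_ne_top.2 ?_)
  rw [Ne, tsub_eq_zero_iff_le, not_le]
  exact ENNReal.rpow_lt_one_of_one_lt_of_neg (by norm_num) (by linarith)

/-- Two comparable high frequencies: for output frequencies of size `2^j` the sum runs over the
annuli `2^{j-1+m}`, `m ≥ 0`, and the gain `(|ξ|/|η|)^θ` together with Bernstein's inequality
makes it converge when `θ > -n`. -/
theorem tsum_high_high_le {n : ℕ} {θ : ℝ} {A B : Rn n → ℝ≥0∞} (hA : Measurable A)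
    (hB : Measurable B) :
    ∑' j : ℤ, (2 : ℝ≥0∞) ^ ((j : ℝ) * (n / 2)) *
        l2On (fun ξ => ∑' m : ℕ, (2 : ℝ≥0∞) ^ ((1 - (m : ℝ)) * θ) *
          ∫⁻ η in annulus n (j + ((m : ℤ) - 1)), A η *
            (fatAnnulus n (-2) 3 (j + ((m : ℤ) - 1))).indicator B (ξ - η)) (annulus n j)
      ≤ bernsteinConst n * (∑' m : ℕ, (2 : ℝ≥0∞) ^ ((1 - (m : ℝ)) * (n + θ))) *
        shiftConst (-2) 3 (n / 2) * (annulusSum (n / 2) A * annulusSum (n / 2) B) := by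
  set a : ℤ → ℝ≥0∞ := fun l => l2On A (annulus n l) with ha
  set b : ℤ → ℝ≥0∞ := fun l => l2On B (fatAnnulus n (-2) 3 l) with hb
  have hcs : ∀ l ξ, ∫⁻ η in annulus n l, A η * (fatAnnulus n (-2) 3 l).indicator B (ξ - η)
      ≤ a l * b l := by
    intro l ξ
    have hm := measurableSet_fatAnnulus n (-2) 3 l
    have hBm : Measurable fun η => (fatAnnulus n (-2) 3 l).indicator B (ξ - η) :=
      (hB.indicator hm).comp (measurable_const.sub measurable_id)
    refine (lintegral_mul_le_l2On _ _ _ hA.aemeasurable hBm.aemeasurable).trans ?_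
    gcongr
    refine (l2On_mono MeasurableSet.univ (fun _ _ => le_rfl) (Set.subset_univ _)).trans ?_
    rw [hb]
    simp only
    rw [← l2On_indicator B hm, l2On, l2On, Measure.restrict_univ,
      lintegral_sub_left_eq_self (fun η => (fatAnnulus n (-2) 3 l).indicator B η ^ (2 : ℝ)) ξ]
  have hterm : ∀ j : ℤ, (2 : ℝ≥0∞) ^ ((j : ℝ) * (n / 2)) *
      l2On (fun ξ => ∑' m : ℕ, (2 : ℝ≥0∞) ^ ((1 - (m : ℝ)) * θ) *
          ∫⁻ η in annulus n (j + ((m : ℤ) - 1)), A η *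
            (fatAnnulus n (-2) 3 (j + ((m : ℤ) - 1))).indicator B (ξ - η)) (annulus n j)
      ≤ ∑' m : ℕ, bernsteinConst n * ((2 : ℝ≥0∞) ^ ((1 - (m : ℝ)) * θ) *
        ((2 : ℝ≥0∞) ^ ((j : ℝ) * n) * (a (j + ((m : ℤ) - 1)) * b (j + ((m : ℤ) - 1))))) := by
    intro j
    set M : ℝ≥0∞ := ∑' m : ℕ, (2 : ℝ≥0∞) ^ ((1 - (m : ℝ)) * θ) *
      (a (j + ((m : ℤ) - 1)) * b (j + ((m : ℤ) - 1))) with hM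
    calc _ ≤ (2 : ℝ≥0∞) ^ ((j : ℝ) * (n / 2)) * l2On (fun _ => M * 1) (annulus n j) := by
          gcongr
          refine l2On_mono (measurableSet_annulus n j) (fun ξ _ => ?_) subset_rfl
          rw [mul_one]
          exact ENNReal.tsum_le_tsum fun m => by gcongr; exact hcs _ ξ
      _ ≤ (2 : ℝ≥0∞) ^ ((j : ℝ) * (n / 2)) *
          (M * (bernsteinConst n * (2 : ℝ≥0∞) ^ ((j : ℝ) * (n / 2)))) := by
          rw [l2On_const_mul M aemeasurable_const]
          gcongr
          simpa [l2On] using volume_annulus_rpow_half_le n j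
      _ = (bernsteinConst n * (2 : ℝ≥0∞) ^ ((j : ℝ) * n)) * M := by
          have : (2 : ℝ≥0∞) ^ ((j : ℝ) * n)
              = (2 : ℝ≥0∞) ^ ((j : ℝ) * (n / 2)) * (2 : ℝ≥0∞) ^ ((j : ℝ) * (n / 2)) := by
            rw [← two_rpow_add]; congr 1; ring
          rw [this]; ring
      _ = _ := by
          rw [hM, ← ENNReal.tsum_mul_left]
          exact tsum_congr fun m => by ring
  have hab : ∑' l : ℤ, (2 : ℝ≥0∞) ^ ((l : ℝ) * n) * (a l * b l)
      ≤ annulusSum (n / 2) A * (shiftConst (-2) 3 (n / 2) * annulusSum (n / 2) B) := by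
    calc _ = ∑' l : ℤ, ((2 : ℝ≥0∞) ^ ((l : ℝ) * (n / 2)) * a l) *
          ((2 : ℝ≥0∞) ^ ((l : ℝ) * (n / 2)) * b l) := by
          refine tsum_congr fun l => ?_
          have : (2 : ℝ≥0∞) ^ ((l : ℝ) * n)
              = (2 : ℝ≥0∞) ^ ((l : ℝ) * (n / 2)) * (2 : ℝ≥0∞) ^ ((l : ℝ) * (n / 2)) := by
            rw [← two_rpow_add]; congr 1; ring
          rw [this]; ring
      _ ≤ _ := tsum_mul_le_tsum_mul_tsum _ _
      _ ≤ _ := by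
          gcongr
          · exact le_rfl
          · exact tsum_l2On_fatAnnulus_le _ _ _ _
  refine (ENNReal.tsum_le_tsum hterm).trans ?_
  rw [ENNReal.tsum_comm]
  have hshift : ∀ m : ℕ, ∑' j : ℤ, bernsteinConst n * ((2 : ℝ≥0∞) ^ ((1 - (m : ℝ)) * θ) *
        ((2 : ℝ≥0∞) ^ ((j : ℝ) * n) * (a (j + ((m : ℤ) - 1)) * b (j + ((m : ℤ) - 1)))))
      = bernsteinConst n * ((2 : ℝ≥0∞) ^ ((1 - (m : ℝ)) * (n + θ)) *
        ∑' l : ℤ, (2 : ℝ≥0∞) ^ ((l : ℝ) * n) * (a l * b l)) := by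
    intro m
    rw [ENNReal.tsum_mul_left, ENNReal.tsum_mul_left,
      tsum_two_rpow_shift n (fun l => a l * b l) ((m : ℤ) - 1), ← mul_assoc ((2 : ℝ≥0∞) ^ _),
      ← two_rpow_add]
    congr 3
    push_cast; ring
  simp_rw [hshift]
  rw [ENNReal.tsum_mul_left, ENNReal.tsum_mul_right]
  calc _ ≤ bernsteinConst n * ((∑' m : ℕ, (2 : ℝ≥0∞) ^ ((1 - (m : ℝ)) * (n + θ))) *
        (annulusSum (n / 2) A * (shiftConst (-2) 3 (n / 2) * annulusSum (n / 2) B))) := by gcongr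
    _ = _ := by ring

/-! ### The commutator estimate -/

/-- The kernel which dominates the symbol of `[Λ^s, u · ∇]`, for `div u = 0`: the input frequencies
are `η` (of `∇u`) and `ξ - η` (of `v`). The minimum comes from `(ξ - η) · û(η) = ξ · û(η)`. -/
noncomputable def commKernel {n : ℕ} (s : ℝ) (ξ η : Rn n) : ℝ≥0∞ :=
  ‖‖ξ‖ ^ s - ‖ξ - η‖ ^ s‖ₑ * (min ‖ξ‖ₑ ‖ξ - η‖ₑ * ‖η‖ₑ⁻¹)

/-- The bilinear operator with kernel `commKernel`. -/
noncomputable def commOp {n : ℕ} (s : ℝ) (A B : Rn n → ℝ≥0∞) (ξ : Rn n) : ℝ≥0∞ :=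
  ∫⁻ η, commKernel s ξ η * (A η * B (ξ - η))

theorem commKernel_eq_ofReal {n : ℕ} (s : ℝ) {ξ η : Rn n} (hη : η ≠ 0) :
    commKernel s ξ η = ENNReal.ofReal
      (|‖ξ‖ ^ s - ‖ξ - η‖ ^ s| * (min ‖ξ‖ ‖ξ - η‖ * ‖η‖⁻¹)) := by
  rw [commKernel, ENNReal.ofReal_mul (abs_nonneg _),
    ENNReal.ofReal_mul (le_min (norm_nonneg _) (norm_nonneg _)),
    ENNReal.ofReal_inv_of_pos (norm_pos_iff.2 hη), ENNReal.ofReal_min, ofReal_norm, ofReal_norm,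
    ofReal_norm, ← Real.norm_eq_abs, ofReal_norm]

theorem measurable_commKernel {n : ℕ} (s : ℝ) :
    Measurable fun p : Rn n × Rn n => commKernel s p.1 p.2 := by
  unfold commKernel
  refine Measurable.mul (Measurable.enorm ?_) (Measurable.mul (Measurable.min ?_ ?_) ?_)
  · exact (measurable_fst.norm.pow_const s).sub
      ((measurable_fst.sub measurable_snd).norm.pow_const s)
  · exact measurable_fst.enorm
  · exact (measurable_fst.sub measurable_snd).enorm
  · exact measurable_snd.enorm.inv

theorem measurable_commOp {n : ℕ} (s : ℝ) {A B : Rn n → ℝ≥0∞} (hA : Measurable A)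
    (hB : Measurable B) : Measurable (commOp s A B) :=
  ((measurable_commKernel s).mul (measurable_mul_comp_sub hA hB)).lintegral_prod_right'

/-- Pointwise splitting of the bilinear integrand: either `‖ξ - η‖ ∼ ‖ξ‖`, or `‖η‖ ∼ ‖ξ‖`, or both
input frequencies are comparable and `≳ ‖ξ‖`; in the last case the kernel gains `(‖ξ‖ / ‖η‖) ^ θ`. -/
theorem commKernel_mul_le {n : ℕ} {s θ : ℝ} (hs : -1 ≤ s) (hθ1 : θ ≤ 1) (hθs : θ ≤ 1 - s)
    (A B : Rn n → ℝ≥0∞) {j : ℤ} {ξ η : Rn n} (hξ : ξ ∈ annulus n j) (hη : η ≠ 0) :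
    commKernel s ξ η * (A η * B (ξ - η)) ≤
      (ENNReal.ofReal (kernelConst s θ) * (2 ^ |s| * (2 : ℝ≥0∞) ^ ((j : ℝ) * s))) *
      (A η * (fatAnnulus n (-1) 2 j).indicator B (ξ - η) +
        (fatAnnulus n (-1) 2 j).indicator A η * B (ξ - η) +
        (2 ^ |θ| * 2 ^ |θ|) * ∑' m : ℕ, (annulus n (j + ((m : ℤ) - 1))).indicator (fun η =>
          (2 : ℝ≥0∞) ^ ((1 - (m : ℝ)) * θ) * (A η *
            (fatAnnulus n (-2) 3 (j + ((m : ℤ) - 1))).indicator B (ξ - η))) η) := by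
  have hx0 : ξ ≠ 0 := fun h => enorm_ne_zero_of_mem_annulus hξ (by simp [h])
  have hx : 0 < ‖ξ‖ := norm_pos_iff.2 hx0
  have hy : 0 < ‖η‖ := norm_pos_iff.2 hη
  by_cases hz0 : ξ - η = 0
  · simp [commKernel, hz0]
  have hz : 0 < ‖ξ - η‖ := norm_pos_iff.2 hz0
  have t1 : ‖ξ‖ ≤ ‖η‖ + ‖ξ - η‖ := by
    have := norm_add_le η (ξ - η); rwa [add_sub_cancel] at this
  have t2 : ‖ξ - η‖ ≤ ‖ξ‖ + ‖η‖ := norm_sub_le _ _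
  have t3 : ‖η‖ ≤ ‖ξ‖ + ‖ξ - η‖ := by
    have := norm_sub_le ξ (ξ - η); rwa [sub_sub_cancel] at this
  have hk0 := kernelConst_nonneg s θ
  have hxs : ENNReal.ofReal (‖ξ‖ ^ s) ≤ 2 ^ |s| * (2 : ℝ≥0∞) ^ ((j : ℝ) * s) := by
    rw [← ENNReal.ofReal_rpow_of_pos hx, ofReal_norm]
    exact enorm_rpow_le_of_mem_annulus hξ s
  rw [commKernel_eq_ofReal s hη]
  have e1 : (2 : ℝ) ^ (j + -1) = 2 ^ j / 2 := by rw [zpow_add₀ (by norm_num)]; norm_num; ring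
  have e2 : (2 : ℝ) ^ (j + 2) = 2 ^ j * 4 := by rw [zpow_add₀ (by norm_num)]; norm_num
  have e3 : (2 : ℝ) ^ (j + 1) = 2 ^ j * 2 := by rw [zpow_add₀ (by norm_num)]; norm_num
  have hξ1 := hξ.1
  have hξ2 := hξ.2
  rw [e3] at hξ2
  by_cases hlow : ‖η‖ ≤ ‖ξ‖ / 2 ∨ ‖ξ - η‖ ≤ ‖ξ‖ / 2
  · have hker := ENNReal.ofReal_le_ofReal
      (kernel_le_of_low (θ := θ) hs hx hy hz t1 t2 hlow)
    rw [ENNReal.ofReal_mul hk0] at hker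
    refine mul_le_mul' (hker.trans (by gcongr)) ?_
    rcases hlow with h | h
    · have hmem : ξ - η ∈ fatAnnulus n (-1) 2 j :=
        ⟨by rw [e1]; linarith, by rw [e2]; linarith⟩
      rw [Set.indicator_of_mem hmem, add_assoc]
      exact le_self_add
    · have hmem : η ∈ fatAnnulus n (-1) 2 j := ⟨by rw [e1]; linarith, by rw [e2]; linarith⟩
      rw [Set.indicator_of_mem hmem, add_right_comm]
      exact le_add_self
  · push Not at hlow
    obtain ⟨h1, h2⟩ := hlow
    obtain ⟨l, hl⟩ := exists_mem_annulus hη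
    have hlj : j - 1 < l + 1 := by
      refine (zpow_lt_zpow_iff_right₀ (one_lt_two (α := ℝ))).1 (lt_of_le_of_lt ?_ hl.2)
      rw [sub_eq_add_neg, e1]; linarith
    obtain ⟨m, hm⟩ : ∃ m : ℕ, l = j + ((m : ℤ) - 1) := ⟨(l - (j - 1)).toNat, by omega⟩
    have f1 : (2 : ℝ) ^ (l + -2) = 2 ^ l / 4 := by rw [zpow_add₀ (by norm_num)]; norm_num; ring
    have f2 : (2 : ℝ) ^ (l + 3) = 2 ^ l * 8 := by rw [zpow_add₀ (by norm_num)]; norm_num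
    have f3 : (2 : ℝ) ^ (l + 1) = 2 ^ l * 2 := by rw [zpow_add₀ (by norm_num)]; norm_num
    have hl1 := hl.1
    have hl2 := hl.2
    rw [f3] at hl2
    have hmem : ξ - η ∈ fatAnnulus n (-2) 3 l :=
      ⟨by rw [f1]; linarith, by rw [f2]; linarith⟩
    have hker := ENNReal.ofReal_le_ofReal (kernel_le_of_high (s := s) (θ := θ) hθ1 hθs hx hy hz
      (by linarith) (by linarith) h1)
    have hθ : ENNReal.ofReal ((‖ξ‖ / ‖η‖) ^ θ)
        ≤ (2 ^ |θ| * 2 ^ |θ|) * (2 : ℝ≥0∞) ^ ((1 - (m : ℝ)) * θ) := by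
      have g1 := enorm_rpow_le_of_mem_annulus hξ θ
      have g2 := enorm_rpow_le_of_mem_annulus hl (-θ)
      rw [abs_neg] at g2
      calc ENNReal.ofReal ((‖ξ‖ / ‖η‖) ^ θ) = ‖ξ‖ₑ ^ θ * ‖η‖ₑ ^ (-θ) := by
            rw [div_eq_mul_inv, Real.mul_rpow hx.le (by positivity), Real.inv_rpow hy.le,
              ← Real.rpow_neg hy.le, ENNReal.ofReal_mul (by positivity),
              ← ENNReal.ofReal_rpow_of_pos hx, ← ENNReal.ofReal_rpow_of_pos hy, ofReal_norm,
              ofReal_norm]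
        _ ≤ (2 ^ |θ| * (2 : ℝ≥0∞) ^ ((j : ℝ) * θ)) * (2 ^ |θ| * (2 : ℝ≥0∞) ^ ((l : ℝ) * -θ)) := by
            gcongr
        _ = (2 ^ |θ| * 2 ^ |θ|) *
            ((2 : ℝ≥0∞) ^ ((j : ℝ) * θ) * (2 : ℝ≥0∞) ^ ((l : ℝ) * -θ)) := by ring
        _ = _ := by
            rw [← two_rpow_add ((j : ℝ) * θ), hm]
            congr 2
            push_cast; ring
    rw [ENNReal.ofReal_mul hk0, ENNReal.ofReal_mul (p := ‖ξ‖ ^ s) (by positivity)] at hker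
    calc _ ≤ (ENNReal.ofReal (kernelConst s θ) * ((2 ^ |s| * (2 : ℝ≥0∞) ^ ((j : ℝ) * s)) *
          ((2 ^ |θ| * 2 ^ |θ|) * (2 : ℝ≥0∞) ^ ((1 - (m : ℝ)) * θ)))) * (A η * B (ξ - η)) := by
          gcongr
          exact hker.trans (by gcongr)
      _ = (ENNReal.ofReal (kernelConst s θ) * (2 ^ |s| * (2 : ℝ≥0∞) ^ ((j : ℝ) * s))) *
          ((2 ^ |θ| * 2 ^ |θ|) *
            ((2 : ℝ≥0∞) ^ ((1 - (m : ℝ)) * θ) * (A η * B (ξ - η)))) := by ring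
      _ ≤ _ := by
          gcongr
          refine le_trans ?_ le_add_self
          gcongr
          refine le_trans (le_of_eq ?_) (ENNReal.le_tsum m)
          rw [← hm, Set.indicator_of_mem hl, Set.indicator_of_mem hmem]

/-- The constant in the commutator estimate. -/
noncomputable def commConst (n : ℕ) (s θ : ℝ) : ℝ≥0∞ :=
  ENNReal.ofReal (kernelConst s θ) * 2 ^ |s| *
    (bernsteinConst n * shiftConst (-1) 2 (n / 2) + bernsteinConst n * shiftConst (-1) 2 (n / 2) +
      (2 ^ |θ| * 2 ^ |θ|) * (bernsteinConst n * (∑' m : ℕ, (2 : ℝ≥0∞) ^ ((1 - (m : ℝ)) * (n + θ))) *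
        shiftConst (-2) 3 (n / 2)))

theorem commConst_ne_top {n : ℕ} {s θ : ℝ} (hθ : 0 < n + θ) : commConst n s θ ≠ ⊤ := by
  have h1 := bernsteinConst_ne_top n
  have h2 := tsum_geometric_ne_top hθ
  have h3 := shiftConst_ne_top (-1) 2 (n / 2)
  have h4 := shiftConst_ne_top (-2) 3 (n / 2)
  have h5 := two_rpow_ne_top |s|
  have h6 := two_rpow_ne_top |θ|
  unfold commConst
  finiteness

theorem annulusSum_commOp_le {n : ℕ} (hn : 0 < n) {s θ : ℝ} (hs : -1 ≤ s) (hθ1 : θ ≤ 1)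
    (hθs : θ ≤ 1 - s) {A B : Rn n → ℝ≥0∞} (hA : Measurable A) (hB : Measurable B) :
    annulusSum (n / 2 - s) (commOp s A B) ≤
      commConst n s θ * (annulusSum (n / 2) A * annulusSum (n / 2) B) := by
  set K := ENNReal.ofReal (kernelConst s θ) with hK
  set I₁ : ℤ → Rn n → ℝ≥0∞ := fun j ξ =>
    ∫⁻ η, A η * (fatAnnulus n (-1) 2 j).indicator B (ξ - η) with hI₁
  set I₂ : ℤ → Rn n → ℝ≥0∞ := fun j ξ =>
    ∫⁻ η, B η * (fatAnnulus n (-1) 2 j).indicator A (ξ - η) with hI₂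
  set I₃ : ℤ → Rn n → ℝ≥0∞ := fun j ξ => ∑' m : ℕ, (2 : ℝ≥0∞) ^ ((1 - (m : ℝ)) * θ) *
    ∫⁻ η in annulus n (j + ((m : ℤ) - 1)), A η *
      (fatAnnulus n (-2) 3 (j + ((m : ℤ) - 1))).indicator B (ξ - η) with hI₃
  have hBf : ∀ a b l, Measurable ((fatAnnulus n a b l).indicator B) := fun a b l =>
    hB.indicator (measurableSet_fatAnnulus n a b l)
  have hAf : ∀ a b l, Measurable ((fatAnnulus n a b l).indicator A) := fun a b l =>
    hA.indicator (measurableSet_fatAnnulus n a b l)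
  have hm₁ : ∀ j, Measurable (I₁ j) := fun j =>
    (measurable_mul_comp_sub hA (hBf (-1) 2 j)).lintegral_prod_right'
  have hm₂ : ∀ j, Measurable (I₂ j) := fun j =>
    (measurable_mul_comp_sub hB (hAf (-1) 2 j)).lintegral_prod_right'
  have hm₃ : ∀ j, Measurable (I₃ j) := fun j =>
    Measurable.tsum fun m => Measurable.const_mul
      ((measurable_mul_comp_sub hA (hBf (-2) 3 (j + ((m : ℤ) - 1)))).lintegral_prod_right'
        (ν := volume.restrict (annulus n (j + ((m : ℤ) - 1))))) _
  have hpt : ∀ j, ∀ ξ ∈ annulus n j, commOp s A B ξ ≤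
      (K * (2 ^ |s| * (2 : ℝ≥0∞) ^ ((j : ℝ) * s))) *
        (I₁ j ξ + I₂ j ξ + (2 ^ |θ| * 2 ^ |θ|) * I₃ j ξ) := by
    intro j ξ hξ
    have ha : Measurable fun η => A η * (fatAnnulus n (-1) 2 j).indicator B (ξ - η) :=
      hA.mul ((hBf _ _ _).comp (measurable_const.sub measurable_id))
    have hb : Measurable fun η => (fatAnnulus n (-1) 2 j).indicator A η * B (ξ - η) :=
      (hAf _ _ _).mul (hB.comp (measurable_const.sub measurable_id))
    have hc' : ∀ m : ℕ, Measurable fun η => A η *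
        (fatAnnulus n (-2) 3 (j + ((m : ℤ) - 1))).indicator B (ξ - η) := fun m =>
      hA.mul ((hBf _ _ _).comp (measurable_const.sub measurable_id))
    have hc : ∀ m : ℕ, Measurable ((annulus n (j + ((m : ℤ) - 1))).indicator (fun η =>
          (2 : ℝ≥0∞) ^ ((1 - (m : ℝ)) * θ) * (A η *
            (fatAnnulus n (-2) 3 (j + ((m : ℤ) - 1))).indicator B (ξ - η)))) := fun m =>
      ((hc' m).const_mul _).indicator (measurableSet_annulus n _)
    calc commOp s A B ξ ≤ ∫⁻ η, (K * (2 ^ |s| * (2 : ℝ≥0∞) ^ ((j : ℝ) * s))) *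
        (A η * (fatAnnulus n (-1) 2 j).indicator B (ξ - η) +
        (fatAnnulus n (-1) 2 j).indicator A η * B (ξ - η) +
        (2 ^ |θ| * 2 ^ |θ|) * ∑' m : ℕ, (annulus n (j + ((m : ℤ) - 1))).indicator (fun η =>
          (2 : ℝ≥0∞) ^ ((1 - (m : ℝ)) * θ) * (A η *
            (fatAnnulus n (-2) 3 (j + ((m : ℤ) - 1))).indicator B (ξ - η))) η) := by
          refine lintegral_mono_ae ?_
          filter_upwards [ae_ne_zero hn] with η hη
          exact commKernel_mul_le hs hθ1 hθs A B hξ hη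
      _ = _ := by
          have hc2 : Measurable fun η => ∑' m : ℕ, (annulus n (j + ((m : ℤ) - 1))).indicator
              (fun η => (2 : ℝ≥0∞) ^ ((1 - (m : ℝ)) * θ) * (A η *
                (fatAnnulus n (-2) 3 (j + ((m : ℤ) - 1))).indicator B (ξ - η))) η :=
            Measurable.tsum hc
          have hlin : ∀ {P Q R : Rn n → ℝ≥0∞}, Measurable P → Measurable Q → Measurable R →
              ∀ c d, ∫⁻ η, c * (P η + Q η + d * R η) =
                c * ((∫⁻ η, P η) + (∫⁻ η, Q η) + d * ∫⁻ η, R η) := by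
            intro P Q R hP hQ hR c d
            have hPQ : Measurable fun η => P η + Q η := hP.add hQ
            have hPQR : Measurable fun η => P η + Q η + d * R η := hPQ.add (hR.const_mul d)
            rw [lintegral_const_mul _ hPQR, lintegral_add_left hPQ, lintegral_add_left hP,
              lintegral_const_mul _ hR]
          refine (hlin ha hb hc2 _ _).trans ?_
          rw [lintegral_tsum fun m => (hc m).aemeasurable]
          congr 3
          · rw [hI₂]
            simp only
            rw [convolution_comm]
          · rw [hI₃]
            simp only
            congr 1
            ext m
            rw [lintegral_indicator (measurableSet_annulus n _), lintegral_const_mul _ (hc' m)]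
  have hl2 : ∀ j : ℤ, (2 : ℝ≥0∞) ^ ((j : ℝ) * (n / 2 - s)) * l2On (commOp s A B) (annulus n j) ≤
      K * 2 ^ |s| * ((2 : ℝ≥0∞) ^ ((j : ℝ) * (n / 2)) * l2On (I₁ j) (annulus n j) +
        (2 : ℝ≥0∞) ^ ((j : ℝ) * (n / 2)) * l2On (I₂ j) (annulus n j) +
        (2 ^ |θ| * 2 ^ |θ|) * ((2 : ℝ≥0∞) ^ ((j : ℝ) * (n / 2)) * l2On (I₃ j) (annulus n j))) := by
    intro j
    have hsplit : (2 : ℝ≥0∞) ^ ((j : ℝ) * (n / 2))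
        = (2 : ℝ≥0∞) ^ ((j : ℝ) * (n / 2 - s)) * (2 : ℝ≥0∞) ^ ((j : ℝ) * s) := by
      rw [← two_rpow_add]; congr 1; ring
    calc _ ≤ (2 : ℝ≥0∞) ^ ((j : ℝ) * (n / 2 - s)) *
          l2On (fun ξ => (K * (2 ^ |s| * (2 : ℝ≥0∞) ^ ((j : ℝ) * s))) *
            (I₁ j + I₂ j + fun ξ => (2 ^ |θ| * 2 ^ |θ|) * I₃ j ξ) ξ) (annulus n j) := by
          gcongr
          exact l2On_mono (measurableSet_annulus n j) (hpt j) subset_rfl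
      _ ≤ (2 : ℝ≥0∞) ^ ((j : ℝ) * (n / 2 - s)) *
          ((K * (2 ^ |s| * (2 : ℝ≥0∞) ^ ((j : ℝ) * s))) *
            (l2On (I₁ j) (annulus n j) + l2On (I₂ j) (annulus n j) +
              (2 ^ |θ| * 2 ^ |θ|) * l2On (I₃ j) (annulus n j))) := by
          have hm4 : Measurable fun ξ => (2 ^ |θ| * 2 ^ |θ|) * I₃ j ξ := (hm₃ j).const_mul _
          rw [l2On_const_mul _ (((hm₁ j).add (hm₂ j)).add hm4).aemeasurable]
          gcongr
          refine (l2On_add_le ((hm₁ j).add (hm₂ j)).aemeasurable hm4.aemeasurable _).trans ?_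
          gcongr
          · exact l2On_add_le (hm₁ j).aemeasurable (hm₂ j).aemeasurable _
          · rw [l2On_const_mul _ (hm₃ j).aemeasurable]
      _ = _ := by rw [hsplit]; ring
  refine (ENNReal.tsum_le_tsum hl2).trans ?_
  rw [ENNReal.tsum_mul_left, ENNReal.tsum_add, ENNReal.tsum_add, ENNReal.tsum_mul_left]
  have b1 := tsum_low_high_le hn hA hB
  have b2 := tsum_low_high_le hn hB hA
  have b3 := tsum_high_high_le (n := n) (θ := θ) hA hB
  rw [mul_comm (annulusSum (n / 2) B)] at b2
  refine (mul_le_mul' le_rfl (add_le_add (add_le_add b1 b2) (mul_le_mul' le_rfl b3))).trans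
    (le_of_eq ?_)
  rw [commConst, ← hK]
  ring

/-! ### The Fourier transform of a field with gradient in the Besov space -/

theorem integrable_of_annulusSum {n : ℕ} (hn : 0 < n) {F : Rn n → ℂ} (hF : Measurable F)
    (h : annulusSum ((n : ℝ) / 2) (fun ξ => ‖F ξ‖ₑ) ≠ ⊤) : Integrable F := by
  refine ⟨hF.aestronglyMeasurable, ?_⟩
  refine (lintegral_le_annulusSum hn hF.enorm.aemeasurable).trans_lt ?_
  exact (ENNReal.mul_ne_top (bernsteinConst_ne_top n) h).lt_top

theorem abs_coord_le {n : ℕ} (ξ : Rn n) (k : Fin n) : |ξ k| ≤ ‖ξ‖ := by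
  simpa using PiLp.norm_apply_le ξ k

theorem hasTemperateGrowth_gradSymbol {n : ℕ} (k : Fin n) :
    (fun ξ : Rn n => 2 * Real.pi * Complex.I * (ξ k : ℂ)).HasTemperateGrowth :=
  (Function.HasTemperateGrowth.const (2 * Real.pi * Complex.I)).mul (hasTemperateGrowth_coord k)

/-- The densities of the `∂_k f`, `1 ≤ k ≤ n`, satisfy the compatibility conditions of a gradient. -/
theorem coord_mul_density_comm {n : ℕ} {f : 𝓢'(Rn n, ℂ)} {G : Fin n → Rn n → ℂ}
    (hGi : ∀ k, Integrable (G k)) (hG : ∀ k, HasDensity (𝓕 (partialD k f)) (G k)) (k l : Fin n) :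
    ∀ᵐ ξ : Rn n, (ξ l : ℂ) * G k ξ = (ξ k : ℂ) * G l ξ := by
  have hc := hasTemperateGrowth_coord (n := n)
  have e : TemperedDistribution.fourierMultiplierCLM ℂ (fun ξ : Rn n => (ξ l : ℂ)) (partialD k f) =
      TemperedDistribution.fourierMultiplierCLM ℂ (fun ξ : Rn n => (ξ k : ℂ)) (partialD l f) := by
    refine eq_of_fourier_apply_eq fun h => ?_
    rw [fourier_fourierMultiplierCLM, fourier_fourierMultiplierCLM, fourier_partialD,
      fourier_partialD]
    congr 1
    ext ξ
    rw [SchwartzMap.smulLeftCLM_apply_apply (hasTemperateGrowth_gradSymbol k),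
      SchwartzMap.smulLeftCLM_apply_apply (hc l),
      SchwartzMap.smulLeftCLM_apply_apply (hasTemperateGrowth_gradSymbol l),
      SchwartzMap.smulLeftCLM_apply_apply (hc k)]
    simp only [smul_eq_mul]
    ring
  have hcont : ∀ k : Fin n, Continuous fun ξ : Rn n => (ξ k : ℂ) := fun k => by fun_prop
  have h1 := (hG k).multiplier (hc l)
  rw [e] at h1
  refine HasDensity.ae_eq ?_ ?_ h1 ((hG l).multiplier (hc k))
  · exact (hGi k).locallyIntegrable.continuous_smul (hcont l)
  · exact (hGi l).locallyIntegrable.continuous_smul (hcont k)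

/-- A distribution whose gradient has integrable Fourier transform is the sum of a constant and of
the regularised inverse Fourier transform of a function `g` with `∫ ‖ξ‖ ‖g ξ‖ < ∞`. -/
theorem exists_symbol_of_gradient {n : ℕ} (hn : 0 < n) (χ : LPCutoff n) {f : 𝓢'(Rn n, ℂ)}
    {G : Fin n → Rn n → ℂ} (hGm : ∀ k, Measurable (G k)) (hGi : ∀ k, Integrable (G k))
    (hG : ∀ k, HasDensity (𝓕 (partialD k f)) (G k)) :
    ∃ (c : ℂ) (g : Rn n → ℂ), Measurable g ∧
      (∀ ξ, ‖ξ‖ * ‖g ξ‖ ≤ ∑ k, ‖G k ξ‖) ∧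
      (∀ k, ∀ᵐ ξ : Rn n, 2 * Real.pi * Complex.I * (ξ k : ℂ) * g ξ = G k ξ) ∧
      ∀ h : 𝓢(Rn n, ℂ), Integrable (fun ξ => (h ξ - h 0) * g ξ) ∧
        𝓕 f h = c * h 0 + ∫ ξ, (h ξ - h 0) * g ξ := by
  set g : Rn n → ℂ := fun ξ =>
    (2 * Real.pi * Complex.I)⁻¹ * ((‖ξ‖ : ℂ) ^ 2)⁻¹ * ∑ k, (ξ k : ℂ) * G k ξ with hg
  have hgm : Measurable g := by
    refine Measurable.mul (by fun_prop) (Finset.measurable_fun_sum _ fun k _ => ?_)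
    exact Measurable.mul (by fun_prop) (hGm k)
  have hpi : (1 : ℝ) ≤ 2 * Real.pi := by linarith [Real.pi_gt_three]
  have hgb : ∀ ξ, ‖ξ‖ * ‖g ξ‖ ≤ ∑ k, ‖G k ξ‖ := by
    intro ξ
    rcases eq_or_ne ξ 0 with rfl | h0
    · rw [norm_zero, zero_mul]; positivity
    have hp : 0 < ‖ξ‖ := norm_pos_iff.2 h0
    have h1 : ‖∑ k, (ξ k : ℂ) * G k ξ‖ ≤ ‖ξ‖ * ∑ k, ‖G k ξ‖ := by
      rw [Finset.mul_sum]
      refine norm_sum_le_of_le _ fun k _ => ?_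
      rw [norm_mul, Complex.norm_real]
      gcongr
      exact abs_coord_le ξ k
    have h2 : ‖(2 * Real.pi * Complex.I : ℂ)⁻¹‖ ≤ 1 := by
      rw [norm_inv]
      refine inv_le_one_of_one_le₀ ?_
      simpa [abs_of_pos Real.pi_pos] using hpi
    calc ‖ξ‖ * ‖g ξ‖ = ‖(2 * Real.pi * Complex.I : ℂ)⁻¹‖ *
          (‖ξ‖ * ((‖ξ‖ ^ 2)⁻¹ * ‖∑ k, (ξ k : ℂ) * G k ξ‖)) := by
          rw [hg]; simp only [norm_mul, norm_inv, norm_pow, Complex.norm_real, norm_norm]; ring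
      _ ≤ 1 * (‖ξ‖ * ((‖ξ‖ ^ 2)⁻¹ * (‖ξ‖ * ∑ k, ‖G k ξ‖))) := by gcongr
      _ = _ := by field_simp
  have hgG : ∀ k, ∀ᵐ ξ : Rn n, 2 * Real.pi * Complex.I * (ξ k : ℂ) * g ξ = G k ξ := by
    intro k
    have h1 : ∀ᵐ ξ : Rn n, ∀ l, (ξ k : ℂ) * G l ξ = (ξ l : ℂ) * G k ξ :=
      ae_all_iff.2 fun l => coord_mul_density_comm hGi hG l k
    filter_upwards [h1, ae_ne_zero hn] with ξ h1 h0
    have hp : (‖ξ‖ : ℂ) ≠ 0 := by simpa using h0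
    have hs : ∑ l, (ξ l : ℂ) * (ξ l : ℂ) = (‖ξ‖ : ℂ) ^ 2 := by
      have := EuclideanSpace.real_norm_sq_eq ξ
      rw [← Complex.ofReal_pow, this]
      push_cast
      exact Finset.sum_congr rfl fun l _ => (sq _).symm
    have h3 : (ξ k : ℂ) * ∑ l, (ξ l : ℂ) * G l ξ = (‖ξ‖ : ℂ) ^ 2 * G k ξ := by
      rw [← hs, Finset.mul_sum, Finset.sum_mul]
      refine Finset.sum_congr rfl fun l _ => ?_
      rw [mul_left_comm, h1 l, mul_assoc]
    have hpi0 : (Real.pi : ℂ) ≠ 0 := by simp [Real.pi_ne_zero]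
    calc _ = ((2 * Real.pi * Complex.I) * (2 * Real.pi * Complex.I)⁻¹) * ((‖ξ‖ : ℂ) ^ 2)⁻¹ *
          ((ξ k : ℂ) * ∑ l, (ξ l : ℂ) * G l ξ) := by rw [hg]; ring
      _ = _ := by
          rw [h3, mul_inv_cancel₀ (by simp [hpi0])]
          field_simp
  have hgi : Integrable fun ξ => ‖g ξ‖ * ‖ξ‖ ^ (1 : ℝ) := by
    refine (integrable_finsetSum Finset.univ fun k _ => (hGi k).norm).mono'
      (by fun_prop) (Eventually.of_forall fun ξ => ?_)
    rw [Real.rpow_one, mul_comm, Real.norm_of_nonneg (by positivity)]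
    exact hgb ξ
  obtain ⟨R, hR⟩ := exists_regularized g hgm.aestronglyMeasurable zero_le_one le_rfl hgi
  have hc := hasTemperateGrowth_coord (n := n)
  obtain ⟨c, hcT⟩ := eq_const_mul_delta χ (𝓕 f - R) (by
    intro k h
    have e : SchwartzMap.smulLeftCLM ℂ (fun ξ : Rn n => (ξ k : ℂ)) h =
        SchwartzMap.smulLeftCLM ℂ (fun ξ : Rn n => 2 * Real.pi * Complex.I * (ξ k : ℂ))
          ((2 * Real.pi * Complex.I : ℂ)⁻¹ • h) := by
      ext ξ
      rw [SchwartzMap.smulLeftCLM_apply_apply (hc k),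
        SchwartzMap.smulLeftCLM_apply_apply (hasTemperateGrowth_gradSymbol k),
        _root_.smul_apply]
      have hpi0 : (Real.pi : ℂ) ≠ 0 := by simp [Real.pi_ne_zero]
      simp only [smul_eq_mul]
      field_simp
    rw [_root_.sub_apply, sub_eq_zero]
    nth_rw 1 [e]
    rw [← fourier_partialD, (hG k _).2, (hR _).2]
    refine integral_congr_ae ?_
    filter_upwards [hgG k] with ξ hξ
    rw [← hξ, SchwartzMap.smulLeftCLM_apply_apply (hc k),
      SchwartzMap.smulLeftCLM_apply_apply (hc k), _root_.smul_apply]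
    have hpi0 : (Real.pi : ℂ) ≠ 0 := by simp [Real.pi_ne_zero]
    simp only [smul_eq_mul, PiLp.zero_apply, Complex.ofReal_zero, zero_mul, sub_zero]
    field_simp)
  refine ⟨c, g, hgm, hgb, hgG, fun h => ⟨(hR h).1, ?_⟩⟩
  rw [← hcT h, ← (hR h).2, _root_.sub_apply, sub_add_cancel]

/-- The size of the gradient of a field with Fourier transform `g`, up to constants. -/
noncomputable def gradSize {n : ℕ} (g : Fin n → Rn n → ℂ) (η : Rn n) : ℝ≥0∞ :=
  ‖η‖ₑ * ∑ i, ‖g i η‖ₑ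

theorem measurable_gradSize {n : ℕ} {g : Fin n → Rn n → ℂ} (hg : ∀ i, Measurable (g i)) :
    Measurable (gradSize g) :=
  measurable_enorm.mul (Finset.measurable_fun_sum _ fun i _ => (hg i).enorm)

theorem exists_symbols_of_memBesov_gradient {n : ℕ} (hn : 0 < n) (χ : LPCutoff n)
    {u : Fin n → 𝓢'(Rn n, ℂ)} (hu : ∀ i k, MemBesov χ ((n : ℝ) / 2) (partialD k (u i)))
    (hdiv : ∑ k : Fin n, partialD k (u k) = 0) :
    ∃ (c : Fin n → ℂ) (g : Fin n → Rn n → ℂ), (∀ i, Measurable (g i)) ∧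
      annulusSum ((n : ℝ) / 2) (gradSize g) ≤
        shiftConst 1 6 ((n : ℝ) / 2) * gradBesovNorm χ ((n : ℝ) / 2) u ∧
      (∀ᵐ ξ : Rn n, ∑ k, (ξ k : ℂ) * g k ξ = 0) ∧
      ∀ i (h : 𝓢(Rn n, ℂ)), Integrable (fun ξ => (h ξ - h 0) * g i ξ) ∧
        𝓕 (u i) h = c i * h 0 + ∫ ξ, (h ξ - h 0) * g i ξ := by
  choose G hGm hGd hGn using fun i k => exists_density_of_memBesov hn χ _ (hu i k)
  have hGi : ∀ i k, Integrable (G i k) := fun i k => integrable_of_annulusSum hn (hGm i k)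
    (ne_top_of_le_ne_top (ENNReal.mul_ne_top (shiftConst_ne_top _ _ _) (hu i k).2.ne) (hGn i k))
  choose c g hgm hgb hgG hgf using fun i =>
    exists_symbol_of_gradient hn χ (hGm i) (hGi i) (hGd i)
  refine ⟨c, g, hgm, ?_, ?_, hgf⟩
  · have hle : ∀ ξ, gradSize g ξ ≤ ∑ p : Fin n × Fin n, ‖G p.1 p.2 ξ‖ₑ := by
      intro ξ
      rw [gradSize, Finset.mul_sum, Fintype.sum_prod_type]
      refine Finset.sum_le_sum fun i _ => ?_
      have h1 := ENNReal.ofReal_le_ofReal (hgb i ξ)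
      rw [ENNReal.ofReal_mul (norm_nonneg _), ENNReal.ofReal_sum_of_nonneg fun _ _ => norm_nonneg _]
        at h1
      simpa only [ofReal_norm] using h1
    refine (annulusSum_mono _ hle).trans ?_
    have h2 := annulusSum_sum_le ((n : ℝ) / 2) (Finset.univ : Finset (Fin n × Fin n))
      (f := fun p ξ => ‖G p.1 p.2 ξ‖ₑ) fun p => (hGm p.1 p.2).enorm.aemeasurable
    refine h2.trans ?_
    · rw [gradBesovNorm, Fintype.sum_prod_type, Finset.mul_sum]
      refine Finset.sum_le_sum fun i _ => ?_
      rw [Finset.mul_sum]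
      exact Finset.sum_le_sum fun k _ => hGn i k
  · have h0 : HasDensity (0 : 𝓢'(Rn n, ℂ)) (fun _ => 0) := fun h => by simp
    have h1 : HasDensity (0 : 𝓢'(Rn n, ℂ)) (fun ξ => ∑ k, G k k ξ) := by
      intro h
      have hi : ∀ k ∈ (Finset.univ : Finset (Fin n)), Integrable fun ξ => h ξ * G k k ξ :=
        fun k _ => (hGd k k h).1
      simp only [Finset.mul_sum]
      refine ⟨integrable_finsetSum _ hi, ?_⟩
      rw [integral_finsetSum _ hi, ← Finset.sum_congr rfl fun k _ => (hGd k k h).2]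
      have h2 : 𝓕 (∑ k : Fin n, partialD k (u k)) h = ∑ k, 𝓕 (partialD k (u k)) h := by
        simp_rw [TemperedDistribution.fourier_apply, _root_.sum_apply]
      rw [← h2, hdiv, TemperedDistribution.fourier_apply]
      rfl
    have h2 := HasDensity.ae_eq (integrable_finsetSum _ fun k _ => hGi k k).locallyIntegrable
      (integrable_zero _ _ _).locallyIntegrable h1 h0
    have h3 : ∀ᵐ ξ : Rn n, ∀ k, 2 * Real.pi * Complex.I * (ξ k : ℂ) * g k ξ = G k k ξ :=
      ae_all_iff.2 fun k => hgG k k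
    filter_upwards [h2, h3] with ξ h2 h3
    have hpi0 : (Real.pi : ℂ) ≠ 0 := by simp [Real.pi_ne_zero]
    have h4 : (2 * Real.pi * Complex.I : ℂ) * ∑ k, (ξ k : ℂ) * g k ξ = 0 := by
      refine Eq.trans ?_ h2
      rw [Finset.mul_sum]
      refine Finset.sum_congr rfl fun k _ => ?_
      rw [← h3 k, ← mul_assoc]
    exact (mul_eq_zero.1 h4).resolve_left (by simp [hpi0])

/-! ### Integrability of the product on the Fourier side -/

/-- `decayNorm M h * differenceWeight M ζ η` bounds the difference `h (ζ + η) - h ζ`. -/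
noncomputable def differenceWeight {n : ℕ} (M : ℕ) (ζ η : Rn n) : ℝ :=
  if ‖η‖ ≤ 1 then 2 ^ M * ((1 + ‖ζ‖) ^ M)⁻¹ * ‖η‖
  else ((1 + ‖ζ + η‖) ^ M)⁻¹ + ((1 + ‖ζ‖) ^ M)⁻¹

theorem differenceWeight_nonneg {n : ℕ} (M : ℕ) (ζ η : Rn n) : 0 ≤ differenceWeight M ζ η := by
  unfold differenceWeight
  split_ifs <;> positivity

theorem measurable_differenceWeight {n : ℕ} (M : ℕ) :
    Measurable fun p : Rn n × Rn n => differenceWeight M p.1 p.2 := by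
  unfold differenceWeight
  exact Measurable.ite (measurableSet_le (by fun_prop) measurable_const) (by fun_prop) (by fun_prop)

theorem norm_sub_le_differenceWeight {n : ℕ} (M : ℕ) (h : 𝓢(Rn n, ℂ)) (ζ η : Rn n) :
    ‖h (ζ + η) - h ζ‖ ≤ decayNorm M h * differenceWeight M ζ η := by
  unfold differenceWeight
  split_ifs with h1
  · exact norm_add_sub_le_decayNorm M h ζ η h1
  · refine (norm_sub_le _ _).trans ?_
    rw [mul_add]
    exact add_le_add (norm_apply_le_decayNorm M h _) (norm_apply_le_decayNorm M h _)

/-- The numerical inequality behind the existence of `u · ∇Λ^s v`. In the last region, where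
`‖ζ‖ > 2 ‖ζ + η‖` and `‖η‖ > 1`, the frequencies `ζ` and `η` are comparable and bounded below. -/
theorem exists_product_kernel_le {s d : ℝ} (hs : -1 ≤ s) (hs' : s ≤ d + 1) (hd : 0 ≤ d) {M : ℕ}
    (hM : s + 1 ≤ M) :
    ∃ C : ℝ, 0 ≤ C ∧ ∀ {n : ℕ} (ζ η : Rn n), ζ ≠ 0 → η ≠ 0 →
      ‖ζ‖ ^ s * (min ‖ζ‖ ‖ζ + η‖ * ‖η‖⁻¹) * differenceWeight M ζ η ≤
        C * (1 + ‖ζ + η‖ * ((1 + ‖ζ + η‖) ^ M)⁻¹ * (‖ζ‖ ^ (d / 2) * ‖η‖ ^ (d / 2))) := by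
  set C₂ : ℝ := (2 / 3 : ℝ) ^ (s - d - 1) * 2 ^ (d / 2 + 1) with hC₂
  have hC₂0 : 0 ≤ C₂ := by positivity
  refine ⟨2 ^ M + 1 + 2 ^ (s + 1) + C₂, by positivity, ?_⟩
  intro n ζ η hζ hη
  have hx : 0 < ‖ζ‖ := norm_pos_iff.2 hζ
  have hy : 0 < ‖η‖ := norm_pos_iff.2 hη
  have hz : 0 ≤ ‖ζ + η‖ := norm_nonneg _
  have t1 : ‖ζ‖ ≤ ‖ζ + η‖ + ‖η‖ := by
    have := norm_sub_le (ζ + η) η; rwa [add_sub_cancel_right] at this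
  have t2 : ‖η‖ ≤ ‖ζ + η‖ + ‖ζ‖ := by
    have := norm_sub_le (ζ + η) ζ; rwa [add_sub_cancel_left] at this
  unfold differenceWeight
  generalize ‖ζ‖ = x at *
  generalize ‖η‖ = y at *
  generalize ‖ζ + η‖ = z at *
  have hpow : ∀ t : ℝ, 0 ≤ t → t ^ (s + 1) * ((1 + t) ^ M)⁻¹ ≤ 1 := by
    intro t ht
    rw [← div_eq_mul_inv, div_le_one (by positivity), ← Real.rpow_natCast]
    exact (Real.rpow_le_rpow ht (by linarith) (by linarith)).trans
      (Real.rpow_le_rpow_of_exponent_le (by linarith) hM)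
  have hxx : x ^ s * x = x ^ (s + 1) := (Real.rpow_add_one hx.ne' s).symm
  have hxs : 0 < x ^ s := by positivity
  have hK : 0 ≤ z * ((1 + z) ^ M)⁻¹ * (x ^ (d / 2) * y ^ (d / 2)) := by positivity
  set K := z * ((1 + z) ^ M)⁻¹ * (x ^ (d / 2) * y ^ (d / 2)) with hKd
  have h2s : (0 : ℝ) < 2 ^ (s + 1) := by positivity
  have h2M : (0 : ℝ) < 2 ^ M := by positivity
  have hmx : min x z ≤ x := min_le_left _ _
  have hm0 : 0 ≤ min x z := le_min hx.le hz
  split_ifs with h1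
  · calc x ^ s * (min x z * y⁻¹) * (2 ^ M * ((1 + x) ^ M)⁻¹ * y)
        ≤ x ^ s * (x * y⁻¹) * (2 ^ M * ((1 + x) ^ M)⁻¹ * y) := by gcongr
      _ = 2 ^ M * (x ^ (s + 1) * ((1 + x) ^ M)⁻¹) := by rw [← hxx]; field_simp
      _ ≤ 2 ^ M * 1 := by gcongr; exact hpow x hx.le
      _ ≤ (2 ^ M + 1 + 2 ^ (s + 1) + C₂) * (1 + K) := by nlinarith
  · push Not at h1
    have hyi : y⁻¹ ≤ 1 := inv_le_one_of_one_le₀ h1.le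
    have hb : x ^ s * (min x z * y⁻¹) * ((1 + x) ^ M)⁻¹ ≤ 1 := by
      calc x ^ s * (min x z * y⁻¹) * ((1 + x) ^ M)⁻¹ ≤ x ^ s * (x * 1) * ((1 + x) ^ M)⁻¹ := by gcongr
        _ = x ^ (s + 1) * ((1 + x) ^ M)⁻¹ := by rw [← hxx, mul_one]
        _ ≤ 1 := hpow x hx.le
    have hc : x ^ s * (min x z * y⁻¹) * ((1 + z) ^ M)⁻¹ ≤ 2 ^ (s + 1) + C₂ * K := by
      rcases le_or_gt x (2 * z) with h2 | h2
      · calc x ^ s * (min x z * y⁻¹) * ((1 + z) ^ M)⁻¹ ≤ x ^ s * (x * 1) * ((1 + z) ^ M)⁻¹ := by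
              gcongr
          _ = x ^ (s + 1) * ((1 + z) ^ M)⁻¹ := by rw [← hxx, mul_one]
          _ ≤ (2 * z) ^ (s + 1) * ((1 + z) ^ M)⁻¹ := by
              gcongr
              linarith
          _ = 2 ^ (s + 1) * (z ^ (s + 1) * ((1 + z) ^ M)⁻¹) := by
              rw [Real.mul_rpow two_pos.le hz, mul_assoc]
          _ ≤ 2 ^ (s + 1) * 1 := by gcongr; exact hpow z hz
          _ ≤ _ := by nlinarith
      · have hkey : x ^ s * y⁻¹ ≤ C₂ * (x ^ (d / 2) * y ^ (d / 2)) := by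
          have hx23 : 2 / 3 ≤ x := by linarith
          have e1 : x ^ s ≤ (2 / 3 : ℝ) ^ (s - d - 1) * (x ^ (d / 2) * x ^ (d / 2 + 1)) := by
            calc x ^ s = x ^ (s - d - 1) * (x ^ (d / 2) * x ^ (d / 2 + 1)) := by
                  rw [← Real.rpow_add hx, ← Real.rpow_add hx]; congr 1; ring
              _ ≤ _ := by
                  gcongr ?_ * _
                  exact Real.rpow_le_rpow_of_nonpos (by norm_num) hx23 (by linarith)
          have e2 : x ^ (d / 2 + 1) ≤ 2 ^ (d / 2 + 1) * (y ^ (d / 2) * y) := by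
            rw [← Real.rpow_add_one hy.ne', ← Real.mul_rpow two_pos.le hy.le]
            exact Real.rpow_le_rpow hx.le (by linarith) (by linarith)
          rw [← div_eq_mul_inv, div_le_iff₀ hy]
          calc x ^ s ≤ (2 / 3 : ℝ) ^ (s - d - 1) * (x ^ (d / 2) * x ^ (d / 2 + 1)) := e1
            _ ≤ (2 / 3 : ℝ) ^ (s - d - 1) * (x ^ (d / 2) * (2 ^ (d / 2 + 1) * (y ^ (d / 2) * y))) := by
                gcongr
            _ = _ := by rw [hC₂]; ring
        calc x ^ s * (min x z * y⁻¹) * ((1 + z) ^ M)⁻¹ ≤ x ^ s * (z * y⁻¹) * ((1 + z) ^ M)⁻¹ := by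
              gcongr
              exact min_le_right _ _
          _ = z * ((1 + z) ^ M)⁻¹ * (x ^ s * y⁻¹) := by ring
          _ ≤ z * ((1 + z) ^ M)⁻¹ * (C₂ * (x ^ (d / 2) * y ^ (d / 2))) := by gcongr
          _ = C₂ * K := by rw [hKd]; ring
          _ ≤ _ := by linarith
    rw [mul_add]
    nlinarith [mul_nonneg hC₂0 hK]

theorem lintegral_comp_add_mul_left {n : ℕ} {K P : Rn n → ℝ≥0∞} (hK : Measurable K)
    (hP : Measurable P) :
    ∫⁻ p : Rn n × Rn n, K (p.1 + p.2) * P p.1 = (∫⁻ z, K z) * ∫⁻ ζ, P ζ := by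
  rw [Measure.volume_eq_prod, lintegral_prod _ (by fun_prop)]
  have h1 : ∀ ζ : Rn n, ∫⁻ η, K (ζ + η) * P ζ = (∫⁻ z, K z) * P ζ := fun ζ => by
    rw [lintegral_mul_const _ (by fun_prop), lintegral_add_left_eq_self K]
  simp_rw [h1]
  rw [lintegral_const_mul _ hP]

theorem lintegral_comp_add_mul_right {n : ℕ} {K P : Rn n → ℝ≥0∞} (hK : Measurable K)
    (hP : Measurable P) :
    ∫⁻ p : Rn n × Rn n, K (p.1 + p.2) * P p.2 = (∫⁻ z, K z) * ∫⁻ ζ, P ζ := by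
  rw [← lintegral_comp_add_mul_left hK hP, Measure.volume_eq_prod, ← lintegral_prod_swap]
  simp_rw [Prod.fst_swap, Prod.snd_swap, add_comm]

/-- The integrand of the trilinear form `(u, ∇Λ^s v, h) ↦ ⟨u · ∇Λ^s v, h⟩`, with `v` of size `B`,
`∇u` of size `A` and the test function replaced by the weight `differenceWeight M`. -/
noncomputable def productIntegrand {n : ℕ} (s : ℝ) (M : ℕ) (A B : Rn n → ℝ≥0∞)
    (p : Rn n × Rn n) : ℝ≥0∞ :=
  ‖p.1‖ₑ ^ s * (min ‖p.1‖ₑ ‖p.1 + p.2‖ₑ * ‖p.2‖ₑ⁻¹) *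
    ENNReal.ofReal (differenceWeight M p.1 p.2) * (B p.1 * A p.2)

theorem lintegral_productIntegrand_ne_top {n : ℕ} (hn : 0 < n) {s : ℝ} (hs : -1 ≤ s)
    (hs' : s ≤ n + 1) {M : ℕ} (hM : s + 1 ≤ M) (hM' : n + 2 ≤ M) {A B : Rn n → ℝ≥0∞}
    (hA : Measurable A) (hB : Measurable B) (hA' : annulusSum (n / 2) A ≠ ⊤)
    (hB' : annulusSum (n / 2) B ≠ ⊤) :
    ∫⁻ p, productIntegrand s M A B p ≠ ⊤ := by
  obtain ⟨C, hC0, hC⟩ := exists_product_kernel_le hs hs' (Nat.cast_nonneg n) hM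
  set K : Rn n → ℝ≥0∞ := fun z => ENNReal.ofReal (‖z‖ * ((1 + ‖z‖) ^ M)⁻¹) with hK
  have hKm : Measurable K := by fun_prop
  have hKi : ∫⁻ z, K z ≠ ⊤ := by
    have h1 : Integrable fun z : Rn n => (1 + ‖z‖) ^ (-((n : ℝ) + 1)) :=
      integrable_one_add_norm (by simp)
    refine ne_top_of_le_ne_top h1.2.ne (lintegral_mono fun z => ?_)
    rw [hK, ← ofReal_norm]
    refine ENNReal.ofReal_le_ofReal ?_
    have hp : 0 < 1 + ‖z‖ := by positivity
    beta_reduce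
    rw [Real.norm_of_nonneg (by positivity), Real.rpow_neg hp.le, ← div_eq_mul_inv,
      div_le_iff₀ (by positivity), ← Real.rpow_natCast, ← Real.rpow_neg hp.le,
      ← Real.rpow_add hp]
    have hM2 : (n : ℝ) + 2 ≤ M := by exact_mod_cast hM'
    calc ‖z‖ ≤ (1 + ‖z‖) ^ (1 : ℝ) := by rw [Real.rpow_one]; linarith
      _ ≤ _ := Real.rpow_le_rpow_of_exponent_le (by linarith [norm_nonneg z]) (by linarith)
  set P : (Rn n → ℝ≥0∞) → Rn n → ℝ≥0∞ := fun f ζ => (‖ζ‖ₑ ^ ((n : ℝ) / 2) * f ζ) ^ (2 : ℝ) with hP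
  have hPm : ∀ {f : Rn n → ℝ≥0∞}, Measurable f → Measurable (P f) := fun hf =>
    ((measurable_enorm.pow_const _).mul hf).pow_const _
  have hPi : ∀ {f : Rn n → ℝ≥0∞}, Measurable f → annulusSum (n / 2) f ≠ ⊤ → ∫⁻ ζ, P f ζ ≠ ⊤ := by
    intro f hf hf'
    refine ne_top_of_le_ne_top ?_ (lintegral_sq_le_annulusSum hn hf.aemeasurable ((n : ℝ) / 2))
    exact ENNReal.rpow_ne_top_of_nonneg zero_le_two (ENNReal.mul_ne_top (two_rpow_ne_top _) hf')
  have hle : ∀ᵐ p : Rn n × Rn n, productIntegrand s M A B p ≤ ENNReal.ofReal C *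
      (B p.1 * A p.2 + (K (p.1 + p.2) * P B p.1 + K (p.1 + p.2) * P A p.2)) := by
    have h0 : ∀ᵐ p : Rn n × Rn n, p.1 ≠ 0 ∧ p.2 ≠ 0 := by
      rw [Measure.volume_eq_prod]
      exact (Measure.quasiMeasurePreserving_fst.ae (ae_ne_zero hn)).and
        (Measure.quasiMeasurePreserving_snd.ae (ae_ne_zero hn))
    filter_upwards [h0] with p ⟨hp1, hp2⟩
    have hx := norm_pos_iff.2 hp1
    have hy := norm_pos_iff.2 hp2
    have h1 := ENNReal.ofReal_le_ofReal (hC p.1 p.2 hp1 hp2)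
    have e1 : ENNReal.ofReal (‖p.1‖ ^ s * (min ‖p.1‖ ‖p.1 + p.2‖ * ‖p.2‖⁻¹) *
        differenceWeight M p.1 p.2) = ‖p.1‖ₑ ^ s * (min ‖p.1‖ₑ ‖p.1 + p.2‖ₑ * ‖p.2‖ₑ⁻¹) *
          ENNReal.ofReal (differenceWeight M p.1 p.2) := by
      have hm : 0 ≤ min ‖p.1‖ ‖p.1 + p.2‖ := le_min (norm_nonneg _) (norm_nonneg _)
      rw [ENNReal.ofReal_mul (by positivity), ENNReal.ofReal_mul (by positivity),
        ENNReal.ofReal_mul hm, ← ENNReal.ofReal_rpow_of_pos hx, ENNReal.ofReal_inv_of_pos hy,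
        ENNReal.ofReal_min, ofReal_norm, ofReal_norm, ofReal_norm]
    have e2 : ENNReal.ofReal (C * (1 + ‖p.1 + p.2‖ * ((1 + ‖p.1 + p.2‖) ^ M)⁻¹ *
        (‖p.1‖ ^ ((n : ℝ) / 2) * ‖p.2‖ ^ ((n : ℝ) / 2)))) = ENNReal.ofReal C *
          (1 + K (p.1 + p.2) * (‖p.1‖ₑ ^ ((n : ℝ) / 2) * ‖p.2‖ₑ ^ ((n : ℝ) / 2))) := by
      rw [ENNReal.ofReal_mul hC0, ENNReal.ofReal_add zero_le_one (by positivity),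
        ENNReal.ofReal_one, ENNReal.ofReal_mul (by positivity),
        ENNReal.ofReal_mul (p := ‖p.1‖ ^ ((n : ℝ) / 2)) (by positivity),
        ← ENNReal.ofReal_rpow_of_pos hx, ← ENNReal.ofReal_rpow_of_pos hy, ofReal_norm, ofReal_norm]
    rw [e1, e2] at h1
    have hsq : ∀ a b : ℝ≥0∞, a * b ≤ a ^ (2 : ℝ) + b ^ (2 : ℝ) := by
      intro a b
      rw [ENNReal.rpow_two, ENNReal.rpow_two, sq, sq]
      rcases le_total a b with h | h
      · exact (mul_le_mul' h le_rfl).trans le_add_self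
      · exact (mul_le_mul' le_rfl h).trans le_self_add
    calc productIntegrand s M A B p ≤ ENNReal.ofReal C *
          (1 + K (p.1 + p.2) * (‖p.1‖ₑ ^ ((n : ℝ) / 2) * ‖p.2‖ₑ ^ ((n : ℝ) / 2))) *
            (B p.1 * A p.2) := by
          rw [productIntegrand]
          gcongr
      _ = ENNReal.ofReal C * (B p.1 * A p.2 + K (p.1 + p.2) *
            ((‖p.1‖ₑ ^ ((n : ℝ) / 2) * B p.1) * (‖p.2‖ₑ ^ ((n : ℝ) / 2) * A p.2))) := by ring
      _ ≤ ENNReal.ofReal C * (B p.1 * A p.2 + K (p.1 + p.2) * (P B p.1 + P A p.2)) := by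
          gcongr
          exact hsq _ _
      _ = _ := by rw [mul_add (K _)]
  refine ne_top_of_le_ne_top ?_ (lintegral_mono_ae hle)
  have m1 : Measurable fun p : Rn n × Rn n => B p.1 * A p.2 := by fun_prop
  have hPB := hPm hB
  have hPA := hPm hA
  have m2 : Measurable fun p : Rn n × Rn n => K (p.1 + p.2) * P B p.1 := by fun_prop
  have i1 : ∫⁻ p : Rn n × Rn n, B p.1 * A p.2 = (∫⁻ ζ, B ζ) * ∫⁻ η, A η := by
    rw [Measure.volume_eq_prod, lintegral_prod_mul hB.aemeasurable hA.aemeasurable]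
  rw [lintegral_const_mul' _ _ ENNReal.ofReal_ne_top, lintegral_add_left m1,
    lintegral_add_left m2, i1, lintegral_comp_add_mul_left hKm hPB,
    lintegral_comp_add_mul_right hKm hPA]
  have f1 : ∀ {f : Rn n → ℝ≥0∞}, Measurable f → annulusSum (n / 2) f ≠ ⊤ → ∫⁻ ζ, f ζ ≠ ⊤ :=
    fun hf hf' => ne_top_of_le_ne_top (ENNReal.mul_ne_top (bernsteinConst_ne_top n) hf')
      (lintegral_le_annulusSum hn hf.aemeasurable)
  have := f1 hA hA'
  have := f1 hB hB'
  have := hPi hA hA'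
  have := hPi hB hB'
  finiteness

/-! ### Low frequencies of a distribution with integrable gradient -/

section FourierGrowth

variable {E : Type*} [NormedAddCommGroup E] [NormedSpace ℂ E] {n : ℕ} {f : Rn n → E}

theorem hasTemperateGrowth_fourier (hf : AEStronglyMeasurable f)
    (hfi : ∀ m : ℕ, Integrable (fun v => ‖v‖ ^ m * ‖f v‖)) :
    (𝓕 f : Rn n → E).HasTemperateGrowth := by
  refine ⟨Real.contDiff_fourier (N := ⊤) fun m _ => hfi m, fun m => ?_⟩
  refine ⟨0, ∫ v, ‖VectorFourier.fourierPowSMulRight (innerSL ℝ) f v m‖, fun x => ?_⟩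
  rw [Real.iteratedFDeriv_fourier (N := ⊤) (fun m _ => hfi m) hf le_top, pow_zero, mul_one]
  exact VectorFourier.norm_fourierIntegral_le_integral_norm _ _ _ _ _

/-- The function `x ↦ ∫ (e^{2πi ⟨v, x⟩} - 1) f(v) dv`, which makes sense if `∫ ‖v‖ ‖f v‖ < ∞`. -/
noncomputable def renormFourierInv (f : Rn n → E) (x : Rn n) : E :=
  ∫ v, (Real.fourierChar (inner ℝ v x) • f v - f v)

theorem hasTemperateGrowth_renormFourierInv (hf : AEStronglyMeasurable f)
    (hfi : ∀ m : ℕ, 1 ≤ m → Integrable (fun v => ‖v‖ ^ m * ‖f v‖)) :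
    (renormFourierInv f).HasTemperateGrowth := by
  set L : Rn n →L[ℝ] Rn n →L[ℝ] ℝ := innerSL ℝ with hL
  set f' : Rn n → Rn n →L[ℝ] E := VectorFourier.fourierSMulRight L f with hf'
  set R : Rn n → E := fun x => ∫ v, (Real.fourierChar (-L v x) • f v - f v) with hR
  have hf'm : AEStronglyMeasurable f' := hf.fourierSMulRight
  have hf'b : ∀ v, ‖f' v‖ ≤ 2 * Real.pi * ‖L‖ * (‖v‖ * ‖f v‖) := fun v =>
    (VectorFourier.norm_fourierSMulRight_le L f v).trans (le_of_eq (by ring))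
  have hfi1 : Integrable fun v => ‖v‖ * ‖f v‖ := by simpa using hfi 1 le_rfl
  have hd1 : ∀ v x, HasFDerivAt (fun x => Real.fourierChar (-L v x) • f v - f v)
      (Real.fourierChar (-L v x) • f' v) x := fun v x =>
    (VectorFourier.hasFDerivAt_fourierChar_smul L f v x).sub_const (f v)
  have hnd : ∀ v x, ‖Real.fourierChar (-L v x) • f' v‖ ≤ 2 * Real.pi * ‖L‖ * (‖v‖ * ‖f v‖) := by
    intro v x
    rw [Circle.smul_def, norm_smul, Circle.norm_coe, one_mul]
    exact hf'b v
  have hdiff : ∀ v x, ‖Real.fourierChar (-L v x) • f v - f v‖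
      ≤ 2 * Real.pi * ‖L‖ * (‖v‖ * ‖f v‖) * ‖x‖ := by
    intro v x
    have := (convex_univ (𝕜 := ℝ) (E := Rn n)).norm_image_sub_le_of_norm_hasFDerivWithin_le
      (fun y _ => (hd1 v y).hasFDerivWithinAt) (fun y _ => hnd v y) (Set.mem_univ 0)
      (Set.mem_univ x)
    simpa using this
  have hchar : ∀ x, AEStronglyMeasurable (fun v => Real.fourierChar (-L v x)) (volume : Measure (Rn n)) :=
    fun x => (Real.continuous_fourierChar.comp
      (show Continuous fun v => -L v x by fun_prop)).aestronglyMeasurable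
  have hmeas : ∀ x, AEStronglyMeasurable fun v => Real.fourierChar (-L v x) • f v - f v := by
    intro x
    exact ((hchar x).smul hf).sub hf
  have hder : ∀ x, HasFDerivAt R (𝓕 f' x) x := by
    intro x
    refine hasFDerivAt_integral_of_dominated_of_fderiv_le
      (bound := fun v => 2 * Real.pi * ‖L‖ * (‖v‖ * ‖f v‖)) univ_mem
      (Eventually.of_forall hmeas) ?_ ?_ (Eventually.of_forall fun v x _ => hnd v x)
      (hfi1.const_mul _) (Eventually.of_forall fun v x _ => hd1 v x)
    · exact ((hfi1.const_mul _).mul_const ‖x‖).mono' (hmeas x)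
        (Eventually.of_forall fun v => hdiff v x)
    · exact (hchar x).smul hf'm
  have hRt : R.HasTemperateGrowth := by
    refine Function.HasTemperateGrowth.of_fderiv ?_ (fun x => (hder x).differentiableAt) (k := 1)
      (C := ∫ v, 2 * Real.pi * ‖L‖ * (‖v‖ * ‖f v‖)) ?_
    · have : fderiv ℝ R = 𝓕 f' := funext fun x => (hder x).fderiv
      rw [this]
      refine hasTemperateGrowth_fourier hf'm fun m => ?_
      refine ((hfi (m + 1) (by omega)).const_mul (2 * Real.pi * ‖L‖)).mono'
        (by fun_prop) (Eventually.of_forall fun v => ?_)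
      rw [Real.norm_of_nonneg (by positivity)]
      calc ‖v‖ ^ m * ‖f' v‖ ≤ ‖v‖ ^ m * (2 * Real.pi * ‖L‖ * (‖v‖ * ‖f v‖)) := by
            gcongr; exact hf'b v
        _ = _ := by ring
    · intro x
      refine (norm_integral_le_of_norm_le ((hfi1.const_mul _).mul_const ‖x‖)
        (Eventually.of_forall fun v => hdiff v x)).trans ?_
      rw [integral_mul_const, pow_one]
      have h0 : 0 ≤ ∫ v, 2 * Real.pi * ‖L‖ * (‖v‖ * ‖f v‖) := integral_nonneg fun v => by positivity
      gcongr
      linarith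
  have e : renormFourierInv f = fun x => R (-x) := by
    ext x
    simp only [renormFourierInv, hR, hL, map_neg, neg_neg]
    rfl
  rw [e]
  exact hRt.comp (by fun_prop)

end FourierGrowth

theorem norm_fourierChar_smul_sub_le {n : ℕ} (v x : Rn n) (a : ℂ) :
    ‖Real.fourierChar (inner ℝ v x) • a - a‖ ≤ 2 * Real.pi * (‖x‖ * (‖v‖ * ‖a‖)) := by
  have h1 : Real.fourierChar (inner ℝ v x) • a - a
      = (Complex.exp (Complex.I * ((2 * Real.pi * inner ℝ v x : ℝ) : ℂ)) - 1) * a := by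
    rw [Circle.smul_def, Real.fourierChar_apply, smul_eq_mul, sub_mul, one_mul, mul_comm Complex.I]
  rw [h1, norm_mul]
  calc _ ≤ ‖(2 * Real.pi * inner ℝ v x : ℝ)‖ * ‖a‖ := by
        gcongr; exact Real.norm_exp_I_mul_ofReal_sub_one_le
    _ ≤ (2 * Real.pi * (‖v‖ * ‖x‖)) * ‖a‖ := by
        gcongr
        rw [norm_mul, Real.norm_of_nonneg (by positivity : 0 ≤ 2 * Real.pi)]
        gcongr
        exact norm_inner_le_norm v x
    _ = _ := by ring

theorem fourierInv_apply_eq {n : ℕ} (φ : 𝓢(Rn n, ℂ)) (ζ : Rn n) :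
    (𝓕⁻ φ : 𝓢(Rn n, ℂ)) ζ = ∫ x, Real.fourierChar (inner ℝ x ζ) • φ x := by
  rw [SchwartzMap.fourierInv_coe, Real.fourierInv_eq]

/-- By Fubini's theorem, the inverse Fourier transform of the product of `renormFourierInv G` with a
Schwartz function is the convolution with `G`, regularised by subtracting its value at `η = 0`. -/
theorem integral_fourierChar_smul_renormFourierInv {n : ℕ} {G : Rn n → ℂ}
    (hG : AEStronglyMeasurable G) (hGi : Integrable fun v => ‖v‖ * ‖G v‖) (φ : 𝓢(Rn n, ℂ))
    (ζ : Rn n) :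
    ∫ x, Real.fourierChar (inner ℝ x ζ) • (renormFourierInv G x * φ x) =
      ∫ η, ((𝓕⁻ φ : 𝓢(Rn n, ℂ)) (ζ + η) - (𝓕⁻ φ : 𝓢(Rn n, ℂ)) ζ) * G η := by
  set F : Rn n → Rn n → ℂ := fun x η =>
    Real.fourierChar (inner ℝ x ζ) • ((Real.fourierChar (inner ℝ η x) • G η - G η) * φ x) with hF
  have hφ : Integrable fun x => ‖x‖ * ‖φ x‖ := by simpa using φ.integrable_pow_mul volume 1
  have hi : Integrable (Function.uncurry F) (volume.prod volume) := by
    refine ((hφ.mul_prod hGi).const_mul (2 * Real.pi)).mono' ?_ (Eventually.of_forall ?_)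
    · have h1 : Continuous fun p : Rn n × Rn n => (Real.fourierChar (inner ℝ p.1 ζ) : ℂ) := by
        simp_rw [Real.fourierChar_apply]
        fun_prop
      have h2 : Continuous fun p : Rn n × Rn n => (Real.fourierChar (inner ℝ p.2 p.1) : ℂ) := by
        simp_rw [Real.fourierChar_apply]
        fun_prop
      have h3 : AEStronglyMeasurable (fun p : Rn n × Rn n => G p.2) (volume.prod volume) :=
        hG.comp_snd
      have h4 : Continuous fun p : Rn n × Rn n => φ p.1 := φ.continuous.comp continuous_fst
      exact h1.aestronglyMeasurable.mul
        (((h2.aestronglyMeasurable.mul h3).sub h3).mul h4.aestronglyMeasurable)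
    · rintro ⟨x, η⟩
      simp only [hF, Function.uncurry]
      rw [Circle.norm_smul, norm_mul]
      calc _ ≤ (2 * Real.pi * (‖x‖ * (‖η‖ * ‖G η‖))) * ‖φ x‖ := by
            gcongr; exact norm_fourierChar_smul_sub_le η x (G η)
        _ = _ := by ring
  have e1 : ∀ x, Real.fourierChar (inner ℝ x ζ) • (renormFourierInv G x * φ x) = ∫ η, F x η := by
    intro x
    rw [renormFourierInv, ← integral_mul_const, Circle.smul_def, smul_eq_mul, ← integral_const_mul]
    rfl
  simp_rw [e1]
  rw [integral_integral_swap hi]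
  refine integral_congr_ae (Eventually.of_forall fun η => ?_)
  beta_reduce
  rw [fourierInv_apply_eq, fourierInv_apply_eq, ← integral_sub, ← integral_mul_const]
  · refine integral_congr_ae (Eventually.of_forall fun x => ?_)
    simp only [hF]
    rw [inner_add_right, AddChar.map_add_eq_mul, real_inner_comm η x]
    simp only [Circle.smul_def, smul_eq_mul, Circle.coe_mul]
    ring
  · simpa only [inner_neg_right, neg_neg] using
      (Real.fourierIntegral_convergent_iff (-(ζ + η))).2 (φ.integrable (μ := volume))
  · simpa only [inner_neg_right, neg_neg] using
      (Real.fourierIntegral_convergent_iff (-ζ)).2 (φ.integrable (μ := volume))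

/-- The low-frequency part of a distribution with Fourier transform
`h ↦ c h(0) + ∫ (h - h(0)) g`, as a function. -/
theorem exists_lowFreq_function {n : ℕ} (χ : LPCutoff n) {f : 𝓢'(Rn n, ℂ)} {c : ℂ} {g : Rn n → ℂ}
    (hg : Measurable g) (hgi : Integrable fun η => ‖η‖ * ‖g η‖)
    (hf : ∀ h : 𝓢(Rn n, ℂ), Integrable (fun ξ => (h ξ - h 0) * g ξ) ∧
      𝓕 f h = c * h 0 + ∫ ξ, (h ξ - h 0) * g ξ) (N : ℤ) :
    ∃ U : Rn n → ℂ, (∃ hU : U.HasTemperateGrowth,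
        Function.HasTemperateGrowth.toTemperedDistribution volume hU = χ.lowFreq N f) ∧
      ∀ (φ : 𝓢(Rn n, ℂ)) (ζ : Rn n), (𝓕⁻ (SchwartzMap.smulLeftCLM ℂ U φ) : 𝓢(Rn n, ℂ)) ζ =
        (c + ∫ η, (χ.lowSymbol N η - 1) * g η) * (𝓕⁻ φ : 𝓢(Rn n, ℂ)) ζ +
          ∫ η, ((𝓕⁻ φ : 𝓢(Rn n, ℂ)) (ζ + η) - (𝓕⁻ φ : 𝓢(Rn n, ℂ)) ζ) *
            (χ.lowSymbol N η * g η) := by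
  set G : Rn n → ℂ := fun η => χ.lowSymbol N η * g η with hG
  set cN := c + ∫ η, (χ.lowSymbol N η - 1) * g η with hcN
  have hGm : AEStronglyMeasurable G :=
    ((χ.continuous_lowSymbol N).measurable.mul hg).aestronglyMeasurable
  have hGi : ∀ m : ℕ, 1 ≤ m → Integrable fun v => ‖v‖ ^ m * ‖G v‖ := by
    intro m hm
    obtain ⟨m, rfl⟩ := Nat.exists_eq_add_of_le' hm
    have h2 : (0 : ℝ) < 2 ^ N := by positivity
    refine (hgi.const_mul ((2 ^ N) ^ m)).mono' (by fun_prop) (Eventually.of_forall fun v => ?_)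
    rw [Real.norm_of_nonneg (by positivity), hG, norm_mul]
    by_cases hv : 4 / 3 * 2 ^ N < 2 * Real.pi * ‖v‖
    · rw [χ.lowSymbol_eq_zero hv, norm_zero, zero_mul, mul_zero]
      positivity
    · have hv' : ‖v‖ ≤ 2 ^ N := by nlinarith [Real.pi_gt_three, norm_nonneg v]
      calc ‖v‖ ^ (m + 1) * (‖χ.lowSymbol N v‖ * ‖g v‖) ≤ ‖v‖ ^ (m + 1) * (1 * ‖g v‖) := by
            gcongr; exact χ.norm_lowSymbol_le N v
        _ = ‖v‖ ^ m * (‖v‖ * ‖g v‖) := by ring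
        _ ≤ _ := by gcongr
  have hR := hasTemperateGrowth_renormFourierInv hGm hGi
  have hU : (fun x => cN + renormFourierInv G x).HasTemperateGrowth :=
    (Function.HasTemperateGrowth.const cN).add hR
  have key : ∀ (φ : 𝓢(Rn n, ℂ)) (ζ : Rn n), (𝓕⁻ (SchwartzMap.smulLeftCLM ℂ
      (fun x => cN + renormFourierInv G x) φ) : 𝓢(Rn n, ℂ)) ζ = cN * (𝓕⁻ φ : 𝓢(Rn n, ℂ)) ζ +
        ∫ η, ((𝓕⁻ φ : 𝓢(Rn n, ℂ)) (ζ + η) - (𝓕⁻ φ : 𝓢(Rn n, ℂ)) ζ) * G η := by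
    intro φ ζ
    have e : SchwartzMap.smulLeftCLM ℂ (fun x => cN + renormFourierInv G x) φ =
        cN • φ + SchwartzMap.smulLeftCLM ℂ (renormFourierInv G) φ := by
      ext x
      rw [_root_.add_apply, _root_.smul_apply, SchwartzMap.smulLeftCLM_apply_apply hU,
        SchwartzMap.smulLeftCLM_apply_apply hR, add_smul]
    rw [e, FourierInvAdd.fourierInv_add, FourierInvSMul.fourierInv_smul,
      _root_.add_apply, _root_.smul_apply, smul_eq_mul,
      ← integral_fourierChar_smul_renormFourierInv hGm (by simpa using hGi 1 le_rfl),
      fourierInv_apply_eq (SchwartzMap.smulLeftCLM ℂ _ φ)]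
    simp_rw [SchwartzMap.smulLeftCLM_apply_apply hR, smul_eq_mul]
  refine ⟨_, ⟨hU, ?_⟩, key⟩
  ext φ
  set ψ : 𝓢(Rn n, ℂ) := 𝓕⁻ φ with hψ
  have e1 : χ.lowFreq N f φ = 𝓕 (χ.lowFreq N f) ψ := by
    rw [TemperedDistribution.fourier_apply, hψ, FourierTransform.fourier_fourierInv_eq]
  have e2 : Function.HasTemperateGrowth.toTemperedDistribution volume hU φ =
      (𝓕⁻ (SchwartzMap.smulLeftCLM ℂ (fun x => cN + renormFourierInv G x) φ) : 𝓢(Rn n, ℂ)) 0 := by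
    rw [fourierInv_apply_eq, Function.HasTemperateGrowth.toTemperedDistribution_apply volume]
    refine integral_congr_ae (Eventually.of_forall fun x => ?_)
    beta_reduce
    rw [inner_zero_right, AddChar.map_zero_eq_one, one_smul,
      SchwartzMap.smulLeftCLM_apply_apply hU, smul_eq_mul, smul_eq_mul, mul_comm]
  have hχt := χ.hasTemperateGrowth_lowSymbol N
  obtain ⟨i1, i1'⟩ := hf (SchwartzMap.smulLeftCLM ℂ (χ.lowSymbol N) ψ)
  obtain ⟨i2, -⟩ := hf ((χ.hasCompactSupport_lowSymbol N).toSchwartzMap (χ.contDiff_lowSymbol N))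
  have i2 : Integrable fun η => (χ.lowSymbol N η - 1) * g η := by
    simpa [χ.lowSymbol_zero N] using i2
  simp only [SchwartzMap.smulLeftCLM_apply_apply hχt, χ.lowSymbol_zero N, smul_eq_mul, one_mul]
    at i1 i1'
  rw [e1, e2, key, LPCutoff.lowFreq, fourier_fourierMultiplierCLM, i1', ← hψ, hcN]
  have e3 : ∫ η, (ψ (0 + η) - ψ 0) * G η = (∫ η, (χ.lowSymbol N η * ψ η - ψ 0) * g η) -
      ψ 0 * ∫ η, (χ.lowSymbol N η - 1) * g η := by
    rw [← integral_const_mul, ← integral_sub i1 (i2.const_mul _)]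
    refine integral_congr_ae (Eventually.of_forall fun η => ?_)
    simp only [hG, zero_add]
    ring
  rw [e3]
  ring

/-! ### Existence of the products -/

namespace LPCutoff

variable {n : ℕ} (χ : LPCutoff n)

theorem tendsto_lowSymbol_atTop (ξ : Rn n) :
    Tendsto (fun N : ℤ => χ.lowSymbol N ξ) atTop (𝓝 1) := by
  obtain ⟨m, hm⟩ := pow_unbounded_of_one_lt (4 / 3 * (2 * Real.pi * ‖ξ‖)) one_lt_two
  refine tendsto_const_nhds.congr' ?_
  filter_upwards [eventually_ge_atTop (m : ℤ)] with N hN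
  refine (χ.lowSymbol_eq_one ?_).symm
  have h1 : (2 : ℝ) ^ m ≤ 2 ^ N := by
    rw [← zpow_natCast]; exact zpow_le_zpow_right₀ one_le_two hN
  linarith

theorem norm_lowSymbol_sub_one_le {N : ℤ} (hN : 0 ≤ N) (ξ : Rn n) :
    ‖χ.lowSymbol N ξ - 1‖ ≤ 20 * ‖ξ‖ := by
  by_cases h : 2 * Real.pi * ‖ξ‖ < 3 / 4 * 2 ^ N
  · rw [χ.lowSymbol_eq_one h, sub_self, norm_zero]
    positivity
  · have h1 : (1 : ℝ) ≤ 2 ^ N := one_le_zpow₀ one_le_two hN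
    have h2 : ‖χ.lowSymbol N ξ - 1‖ ≤ 1 + 1 := by
      refine (norm_sub_le _ _).trans ?_
      rw [norm_one]
      gcongr
      exact χ.norm_lowSymbol_le N ξ
    nlinarith [Real.pi_lt_d2, norm_nonneg ξ]

end LPCutoff

/-- Since `∑ η_k g_k(η) = 0`, one may replace `ζ` by `ζ + η` in `∑ ζ_k g_k(η)`. -/
theorem enorm_sum_coord_mul_le {n : ℕ} {g : Fin n → Rn n → ℂ} (ζ : Rn n) {η : Rn n} (hη : η ≠ 0)
    (hdiv : ∑ k, (η k : ℂ) * g k η = 0) :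
    ‖∑ k, (ζ k : ℂ) * g k η‖ₑ ≤ min ‖ζ‖ₑ ‖ζ + η‖ₑ * ‖η‖ₑ⁻¹ * gradSize g η := by
  have h1 : ∀ x : Rn n, ‖∑ k, (x k : ℂ) * g k η‖ₑ ≤ ‖x‖ₑ * ∑ k, ‖g k η‖ₑ := by
    intro x
    refine (enorm_sum_le _ _).trans ?_
    rw [Finset.mul_sum]
    refine Finset.sum_le_sum fun k _ => ?_
    rw [enorm_mul]
    gcongr
    rw [← ofReal_norm, ← ofReal_norm, Complex.norm_real]
    exact ENNReal.ofReal_le_ofReal (abs_coord_le x k)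
  have h2 : ∑ k, (ζ k : ℂ) * g k η = ∑ k, ((ζ + η) k : ℂ) * g k η := by
    simp only [PiLp.add_apply, Complex.ofReal_add, add_mul, Finset.sum_add_distrib, hdiv, add_zero]
  have h3 : ‖η‖ₑ⁻¹ * gradSize g η = ∑ k, ‖g k η‖ₑ := by
    rw [gradSize, ← mul_assoc, ENNReal.inv_mul_cancel (enorm_ne_zero.2 hη) enorm_ne_top, one_mul]
  rw [mul_assoc, h3]
  rcases le_total ‖ζ‖ₑ ‖ζ + η‖ₑ with h | h
  · rw [min_eq_left h]; exact h1 ζ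
  · rw [min_eq_right h, h2]; exact h1 _

/-- The product of a divergence-free field `u` with integrable gradient and a field `w` with
Fourier transform `a(ζ) ζ`. On the Fourier side, the product is the convolution of the two,
renormalised at the frequency zero of `u`. -/
theorem exists_isDotProduct {n : ℕ} (hn : 0 < n) (χ : LPCutoff n) {s : ℝ} (hs : -1 ≤ s)
    (hs' : s ≤ n + 1) {u w : Fin n → 𝓢'(Rn n, ℂ)} {c : Fin n → ℂ} {g : Fin n → Rn n → ℂ}
    (hg : ∀ k, Measurable (g k)) (hgA : annulusSum ((n : ℝ) / 2) (gradSize g) ≠ ⊤)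
    (hdiv : ∀ᵐ ξ : Rn n, ∑ k, (ξ k : ℂ) * g k ξ = 0)
    (hu : ∀ k (h : 𝓢(Rn n, ℂ)), Integrable (fun ξ => (h ξ - h 0) * g k ξ) ∧
      𝓕 (u k) h = c k * h 0 + ∫ ξ, (h ξ - h 0) * g k ξ)
    {a : Rn n → ℂ} (ha : Measurable a) {B : Rn n → ℝ≥0∞} (hB : Measurable B)
    (hB' : annulusSum ((n : ℝ) / 2) B ≠ ⊤) {K : ℝ≥0∞} (hK : K ≠ ⊤)
    (haB : ∀ ζ, ‖a ζ‖ₑ ≤ K * (‖ζ‖ₑ ^ s * B ζ))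
    (hw : ∀ k, HasDensity (𝓕 (w k)) fun ζ => a ζ * (ζ k : ℂ)) :
    ∃ p : 𝓢'(Rn n, ℂ), IsDotProduct χ u w p ∧ ∀ h : 𝓢(Rn n, ℂ),
      Integrable (fun q : Rn n × Rn n =>
        (h (q.1 + q.2) - h q.1) * (a q.1 * ∑ k, (q.1 k : ℂ) * g k q.2)) ∧
      𝓕 p h = (∑ k, c k * ∫ ζ, h ζ * (a ζ * (ζ k : ℂ))) +
        ∫ q : Rn n × Rn n, (h (q.1 + q.2) - h q.1) * (a q.1 * ∑ k, (q.1 k : ℂ) * g k q.2) := by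
  set S : Rn n × Rn n → ℂ := fun q => a q.1 * ∑ k, (q.1 k : ℂ) * g k q.2 with hS
  have hSm : Measurable S := by
    refine (ha.comp measurable_fst).mul (Finset.measurable_fun_sum _ fun k _ => ?_)
    exact Measurable.mul (by fun_prop) ((hg k).comp measurable_snd)
  obtain ⟨M, hM⟩ := exists_nat_ge ((n : ℝ) + 2 + (s + 1))
  have hM1 : s + 1 ≤ M := by linarith [(Nat.cast_nonneg n : (0 : ℝ) ≤ n)]
  have hM2 : n + 2 ≤ M := by
    have : ((n + 2 : ℕ) : ℝ) ≤ M := by push_cast; linarith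
    exact_mod_cast this
  have hA := measurable_gradSize hg
  have hint : Integrable (fun q : Rn n × Rn n => ‖S q‖ * differenceWeight M q.1 q.2) := by
    refine ⟨(hSm.norm.mul (measurable_differenceWeight M)).aestronglyMeasurable, ?_⟩
    refine lt_of_le_of_lt ?_ (ENNReal.mul_ne_top hK
      (lintegral_productIntegrand_ne_top hn hs hs' hM1 hM2 hA hB hgA hB')).lt_top
    rw [← lintegral_const_mul' _ _ hK]
    refine lintegral_mono_ae ?_
    have h0 : ∀ᵐ q : Rn n × Rn n, q.2 ≠ 0 ∧ ∑ k, (q.2 k : ℂ) * g k q.2 = 0 := by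
      rw [Measure.volume_eq_prod]
      exact Measure.quasiMeasurePreserving_snd.ae ((ae_ne_zero hn).and hdiv)
    filter_upwards [h0] with q ⟨hq, hq'⟩
    rw [enorm_mul, enorm_norm, Real.enorm_of_nonneg (differenceWeight_nonneg _ _ _), hS, enorm_mul]
    calc _ ≤ K * (‖q.1‖ₑ ^ s * B q.1) * (min ‖q.1‖ₑ ‖q.1 + q.2‖ₑ * ‖q.2‖ₑ⁻¹ * gradSize g q.2) *
          ENNReal.ofReal (differenceWeight M q.1 q.2) := by
          gcongr
          · exact haB _
          · exact enorm_sum_coord_mul_le q.1 hq hq'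
      _ = _ := by rw [productIntegrand]; ring
  obtain ⟨T, hT⟩ := exists_distribution_of_integral volume S hSm.aestronglyMeasurable
    (fun h q => h (q.1 + q.2) - h q.1)
    (fun h h' q => by simp only [_root_.add_apply]; ring)
    (fun b h q => by simp only [_root_.smul_apply, smul_eq_mul]; ring)
    (fun h => ((h.continuous.comp (by fun_prop)).sub
      (h.continuous.comp continuous_fst)).aestronglyMeasurable) M
    (fun q => differenceWeight M q.1 q.2)
    (fun h q => norm_sub_le_differenceWeight M h q.1 q.2) hint
  set p : 𝓢'(Rn n, ℂ) := 𝓕⁻ (∑ k, c k • 𝓕 (w k) + T) with hp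
  have hpF : ∀ h, 𝓕 p h = (∑ k, c k * ∫ ζ, h ζ * (a ζ * (ζ k : ℂ))) +
      ∫ q : Rn n × Rn n, (h (q.1 + q.2) - h q.1) * S q := by
    intro h
    rw [hp, FourierTransform.fourier_fourierInv_eq, _root_.add_apply, _root_.sum_apply, (hT h).2]
    congr 1
    refine Finset.sum_congr rfl fun k _ => ?_
    rw [_root_.smul_apply, smul_eq_mul, (hw k h).2]
  refine ⟨p, ?_, fun h => ⟨(hT h).1, hpF h⟩⟩
  have hgi : ∀ k, Integrable fun η => ‖η‖ * ‖g k η‖ := by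
    intro k
    refine ⟨by fun_prop, lt_of_le_of_lt (lintegral_mono fun η => ?_)
      ((lintegral_le_annulusSum hn hA.aemeasurable).trans_lt
        (ENNReal.mul_ne_top (bernsteinConst_ne_top n) hgA).lt_top)⟩
    rw [enorm_mul, enorm_norm, enorm_norm, gradSize]
    gcongr
    exact Finset.single_le_sum (f := fun i => ‖g i η‖ₑ) (fun i _ => zero_le (a := ‖g i η‖ₑ))
      (Finset.mem_univ k)
  choose U hU hUF using fun (N : ℤ) k => exists_lowFreq_function χ (hg k) (hgi k) (hu k) N
  refine ⟨U, hU, ?_⟩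
  rw [PointwiseConvergenceCLM.tendsto_iff_forall_tendsto]
  intro φ
  set h : 𝓢(Rn n, ℂ) := 𝓕⁻ φ with hh
  have hpφ : p φ = 𝓕 p h := by
    rw [TemperedDistribution.fourier_apply, hh, FourierTransform.fourier_fourierInv_eq]
  rw [hpφ, hpF]
  set cN : ℤ → Fin n → ℂ := fun N k => c k + ∫ η, (χ.lowSymbol N η - 1) * g k η with hcN
  -- the truncated products have the same form, with both symbols cut off
  have hterm : ∀ N : ℤ, (∑ k, TemperedDistribution.smulLeftCLM ℂ (U N k) (χ.lowFreq N (w k))) φ =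
      (∑ k, cN N k * ∫ ζ, χ.lowSymbol N ζ * (h ζ * (a ζ * (ζ k : ℂ)))) +
        ∫ q : Rn n × Rn n, (χ.lowSymbol N q.1 * χ.lowSymbol N q.2) *
          ((h (q.1 + q.2) - h q.1) * S q) := by
    intro N
    have hχt := χ.hasTemperateGrowth_lowSymbol N
    have hwN : ∀ k, HasDensity (𝓕 (χ.lowFreq N (w k)))
        fun ζ => χ.lowSymbol N ζ * (a ζ * (ζ k : ℂ)) := fun k => (hw k).multiplier hχt
    set I : Fin n → Rn n → ℂ := fun k ζ =>
      ∫ η, (h (ζ + η) - h ζ) * (χ.lowSymbol N η * g k η) with hI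
    have e1 : ∀ k, TemperedDistribution.smulLeftCLM ℂ (U N k) (χ.lowFreq N (w k)) φ =
        ∫ ζ, (cN N k * h ζ + I k ζ) * (χ.lowSymbol N ζ * (a ζ * (ζ k : ℂ))) := by
      intro k
      have e2 : SchwartzMap.smulLeftCLM ℂ (U N k) φ =
          𝓕 (𝓕⁻ (SchwartzMap.smulLeftCLM ℂ (U N k) φ) : 𝓢(Rn n, ℂ)) :=
        (FourierTransform.fourier_fourierInv_eq _).symm
      rw [TemperedDistribution.smulLeftCLM_apply_apply, e2, ← TemperedDistribution.fourier_apply,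
        (hwN k _).2]
      simp_rw [hUF N k φ]
      rfl
    have i1 : ∀ k, Integrable fun ζ => h ζ * (χ.lowSymbol N ζ * (a ζ * (ζ k : ℂ))) :=
      fun k => (hwN k h).1
    have i2 : ∀ k, Integrable fun ζ =>
        (cN N k * h ζ + I k ζ) * (χ.lowSymbol N ζ * (a ζ * (ζ k : ℂ))) := by
      intro k
      have := (hwN k (𝓕⁻ (SchwartzMap.smulLeftCLM ℂ (U N k) φ))).1
      simp_rw [hUF N k φ] at this
      exact this
    have i3 : ∀ k, Integrable fun ζ => I k ζ * (χ.lowSymbol N ζ * (a ζ * (ζ k : ℂ))) := by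
      intro k
      refine ((i2 k).sub ((i1 k).const_mul (cN N k))).congr (Eventually.of_forall fun ζ => ?_)
      simp only [Pi.sub_apply]
      ring
    have i4 : ∀ k ζ, Integrable fun η => (h (ζ + η) - h ζ) * (χ.lowSymbol N η * g k η) := by
      intro k ζ
      refine ((hgi k).const_mul (decayNorm 0 h)).mono' ?_ (Eventually.of_forall fun η => ?_)
      · exact ((h.continuous.comp (by fun_prop)).sub continuous_const).aestronglyMeasurable.mul
          ((χ.continuous_lowSymbol N).aestronglyMeasurable.mul (hg k).aestronglyMeasurable)
      · have h1 := norm_sub_le_decayNorm 0 h (ζ + η) ζ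
        rw [add_sub_cancel_left] at h1
        rw [norm_mul, norm_mul]
        calc _ ≤ (decayNorm 0 h * ‖η‖) * (1 * ‖g k η‖) := by
              gcongr
              · exact mul_nonneg (decayNorm_nonneg _ _) (norm_nonneg _)
              · exact χ.norm_lowSymbol_le N η
          _ = _ := by ring
    have i5 : Integrable fun q : Rn n × Rn n => (χ.lowSymbol N q.1 * χ.lowSymbol N q.2) *
        ((h (q.1 + q.2) - h q.1) * S q) := by
      refine (hT h).1.norm.mono' ?_ (Eventually.of_forall fun q => ?_)
      · have hc := χ.continuous_lowSymbol N
        exact (((hc.comp continuous_fst).mul (hc.comp continuous_snd)).aestronglyMeasurable).mul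
          (hT h).1.aestronglyMeasurable
      · rw [norm_mul, norm_mul (χ.lowSymbol N q.1)]
        calc _ ≤ (1 * 1) * ‖(h (q.1 + q.2) - h q.1) * S q‖ := by
              gcongr <;> exact χ.norm_lowSymbol_le N _
          _ = _ := by rw [one_mul, one_mul]
    rw [_root_.sum_apply, Finset.sum_congr rfl fun k _ => e1 k]
    have e3 : ∀ k, ∫ ζ, (cN N k * h ζ + I k ζ) * (χ.lowSymbol N ζ * (a ζ * (ζ k : ℂ))) =
        (cN N k * ∫ ζ, χ.lowSymbol N ζ * (h ζ * (a ζ * (ζ k : ℂ)))) +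
          ∫ ζ, I k ζ * (χ.lowSymbol N ζ * (a ζ * (ζ k : ℂ))) := by
      intro k
      have e4 : (fun ζ => χ.lowSymbol N ζ * (h ζ * (a ζ * (ζ k : ℂ)))) =
          fun ζ => h ζ * (χ.lowSymbol N ζ * (a ζ * (ζ k : ℂ))) := by ext ζ; ring
      rw [e4, ← integral_const_mul, ← integral_add ((i1 k).const_mul _) (i3 k)]
      refine integral_congr_ae (Eventually.of_forall fun ζ => ?_)
      beta_reduce
      ring
    rw [Finset.sum_congr rfl fun k _ => e3 k, Finset.sum_add_distrib,
      ← integral_finsetSum _ fun k _ => i3 k, Measure.volume_eq_prod, integral_prod _ i5]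
    congr 1
    refine integral_congr_ae (Eventually.of_forall fun ζ => ?_)
    simp only [hI, hS]
    simp_rw [← integral_mul_const]
    rw [← integral_finsetSum _ fun k _ => (i4 k ζ).mul_const _]
    refine integral_congr_ae (Eventually.of_forall fun η => ?_)
    simp only [Finset.mul_sum]
    refine Finset.sum_congr rfl fun k _ => ?_
    ring
  have hcNt : ∀ k, Tendsto (fun N => cN N k) atTop (𝓝 (c k)) := by
    intro k
    have : Tendsto (fun N : ℤ => ∫ η, (χ.lowSymbol N η - 1) * g k η) atTop
        (𝓝 (∫ η : Rn n, (0 : ℂ))) := by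
      refine tendsto_integral_filter_of_dominated_convergence (fun η => 20 * (‖η‖ * ‖g k η‖))
        ?_ ?_ ((hgi k).const_mul 20) ?_
      · exact Eventually.of_forall fun N => (((χ.continuous_lowSymbol N).sub
          continuous_const).measurable.mul (hg k)).aestronglyMeasurable
      · filter_upwards [eventually_ge_atTop 0] with N hN
        refine Eventually.of_forall fun η => ?_
        rw [norm_mul]
        calc _ ≤ (20 * ‖η‖) * ‖g k η‖ := by gcongr; exact χ.norm_lowSymbol_sub_one_le hN η
          _ = _ := by ring
      · refine Eventually.of_forall fun η => ?_
        simpa using ((χ.tendsto_lowSymbol_atTop η).sub_const 1).mul_const (g k η)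
    simpa using this.const_add (c k)
  have hint1 : ∀ k, Tendsto (fun N : ℤ => ∫ ζ, χ.lowSymbol N ζ * (h ζ * (a ζ * (ζ k : ℂ)))) atTop
      (𝓝 (∫ ζ, h ζ * (a ζ * (ζ k : ℂ)))) := by
    intro k
    refine tendsto_integral_filter_of_dominated_convergence _ ?_ ?_ (hw k h).1.norm ?_
    · exact Eventually.of_forall fun N =>
        (χ.continuous_lowSymbol N).aestronglyMeasurable.mul (hw k h).1.aestronglyMeasurable
    · refine Eventually.of_forall fun N => Eventually.of_forall fun ζ => ?_
      rw [norm_mul]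
      exact mul_le_of_le_one_left (norm_nonneg _) (χ.norm_lowSymbol_le N ζ)
    · refine Eventually.of_forall fun ζ => ?_
      simpa using (χ.tendsto_lowSymbol_atTop ζ).mul_const (h ζ * (a ζ * (ζ k : ℂ)))
  have hint2 : Tendsto (fun N : ℤ => ∫ q : Rn n × Rn n, (χ.lowSymbol N q.1 * χ.lowSymbol N q.2) *
      ((h (q.1 + q.2) - h q.1) * S q)) atTop
      (𝓝 (∫ q : Rn n × Rn n, (h (q.1 + q.2) - h q.1) * S q)) := by
    refine tendsto_integral_filter_of_dominated_convergence _ ?_ ?_ (hT h).1.norm ?_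
    · refine Eventually.of_forall fun N => ?_
      have hc := χ.continuous_lowSymbol N
      exact (((hc.comp continuous_fst).mul (hc.comp continuous_snd)).aestronglyMeasurable).mul
        (hT h).1.aestronglyMeasurable
    · refine Eventually.of_forall fun N => Eventually.of_forall fun q => ?_
      rw [norm_mul]
      refine mul_le_of_le_one_left (norm_nonneg _) ?_
      rw [norm_mul]
      exact mul_le_one₀ (χ.norm_lowSymbol_le N _) (norm_nonneg _) (χ.norm_lowSymbol_le N _)
    · refine Eventually.of_forall fun q => ?_
      simpa using ((χ.tendsto_lowSymbol_atTop q.1).mul (χ.tendsto_lowSymbol_atTop q.2)).mul_const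
        ((h (q.1 + q.2) - h q.1) * S q)
  simp_rw [hterm]
  exact (tendsto_finsetSum _ fun k _ => (hcNt k).mul (hint1 k)).add hint2

/-! ### The symbol of the fractional Laplacian -/

/-- The symbol `(2π‖ξ‖)^s` of `Λ^s`. -/
noncomputable def lambdaSymbol {n : ℕ} (s : ℝ) (ξ : Rn n) : ℝ := (2 * Real.pi * ‖ξ‖) ^ s

theorem measurable_lambdaSymbol {n : ℕ} (s : ℝ) : Measurable (lambdaSymbol s : Rn n → ℝ) := by
  unfold lambdaSymbol
  fun_prop

theorem lambdaSymbol_eq {n : ℕ} (s : ℝ) (ξ : Rn n) :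
    lambdaSymbol s ξ = (2 * Real.pi) ^ s * ‖ξ‖ ^ s :=
  Real.mul_rpow (by positivity) (norm_nonneg _)

theorem enorm_norm_rpow_le {n : ℕ} (s : ℝ) (ξ : Rn n) : ‖‖ξ‖ ^ s‖ₑ ≤ ‖ξ‖ₑ ^ s := by
  rw [Real.enorm_of_nonneg (by positivity)]
  rcases eq_or_ne ξ 0 with rfl | h
  · rcases lt_trichotomy s 0 with hs | rfl | hs
    · simp [ENNReal.zero_rpow_of_neg hs]
    · simp
    · simp [Real.zero_rpow hs.ne']
  · rw [← ENNReal.ofReal_rpow_of_pos (norm_pos_iff.2 h), ofReal_norm]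

theorem hasTemperateGrowth_mul_lambdaSymbol {n : ℕ} (s : ℝ) {m : Rn n → ℂ} (hm : ContDiff ℝ ∞ m)
    (hmc : HasCompactSupport m) (hm0 : (0 : Rn n) ∉ tsupport m) :
    (fun ξ => m ξ * (lambdaSymbol s ξ : ℂ)).HasTemperateGrowth := by
  refine HasCompactSupport.hasTemperateGrowth hmc.mul_right ?_
  rw [contDiff_iff_contDiffAt]
  intro ξ
  rcases eq_or_ne ξ 0 with rfl | h
  · have h1 : (fun ξ => m ξ * (lambdaSymbol s ξ : ℂ)) =ᶠ[𝓝 0] fun _ => 0 := by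
      filter_upwards [notMem_tsupport_iff_eventuallyEq.1 hm0] with ξ hξ
      rw [hξ, Pi.zero_apply, zero_mul]
    exact contDiffAt_const.congr_of_eventuallyEq h1
  · have h0 : 2 * Real.pi * ‖ξ‖ ≠ 0 := by
      have := norm_pos_iff.2 h
      positivity
    have h1 : ContDiffAt ℝ ∞ (fun ξ : Rn n => lambdaSymbol s ξ) ξ :=
      (contDiffAt_const.mul (contDiffAt_norm ℝ h)).rpow_const_of_ne h0
    exact hm.contDiffAt.mul (Complex.ofRealCLM.contDiff.contDiffAt.comp ξ h1)

/-- The field `∇Λ^s v` on the Fourier side is `gradLambda s V ξ • ξ`, where `V` is the Fourier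
transform of `v`. -/
noncomputable def gradLambda {n : ℕ} (s : ℝ) (V : Rn n → ℂ) (ξ : Rn n) : ℂ :=
  (lambdaSymbol s ξ : ℂ) * (2 * Real.pi * Complex.I * V ξ)

theorem measurable_gradLambda {n : ℕ} (s : ℝ) {V : Rn n → ℂ} (hV : Measurable V) :
    Measurable (gradLambda s V) :=
  (Complex.measurable_ofReal.comp (measurable_lambdaSymbol s)).mul (hV.const_mul _)

theorem lambdaSymbol_mul_gradLambda_zero {n : ℕ} (s : ℝ) (V : Rn n → ℂ) (ξ : Rn n) :
    (lambdaSymbol s ξ : ℂ) * gradLambda 0 V ξ = gradLambda s V ξ := by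
  simp [gradLambda, lambdaSymbol]

/-- The constant `(2π)^{s+1}`. -/
noncomputable def lambdaConst (s : ℝ) : ℝ≥0∞ := ENNReal.ofReal ((2 * Real.pi) ^ s * (2 * Real.pi))

theorem enorm_two_pi_I_mul (z : ℂ) :
    ‖2 * Real.pi * Complex.I * z‖ₑ = ENNReal.ofReal (2 * Real.pi) * ‖z‖ₑ := by
  rw [enorm_mul]
  congr 1
  rw [← ofReal_norm]
  simp [abs_of_pos Real.pi_pos]

theorem enorm_gradLambda_le {n : ℕ} (s : ℝ) (V : Rn n → ℂ) (ξ : Rn n) :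
    ‖gradLambda s V ξ‖ₑ ≤ lambdaConst s * (‖ξ‖ₑ ^ s * ‖V ξ‖ₑ) := by
  have h1 : ‖(lambdaSymbol s ξ : ℂ)‖ₑ ≤ ENNReal.ofReal ((2 * Real.pi) ^ s) * ‖ξ‖ₑ ^ s := by
    have : ‖(lambdaSymbol s ξ : ℂ)‖ₑ = ‖lambdaSymbol s ξ‖ₑ := by
      rw [← ofReal_norm, Complex.norm_real, ofReal_norm]
    rw [this, lambdaSymbol_eq, enorm_mul, Real.enorm_of_nonneg (by positivity)]
    gcongr
    exact enorm_norm_rpow_le s ξ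
  rw [gradLambda, enorm_mul, enorm_two_pi_I_mul, lambdaConst,
    ENNReal.ofReal_mul (p := (2 * Real.pi) ^ s) (by positivity)]
  calc _ ≤ (ENNReal.ofReal ((2 * Real.pi) ^ s) * ‖ξ‖ₑ ^ s) *
        (ENNReal.ofReal (2 * Real.pi) * ‖V ξ‖ₑ) := by gcongr
    _ = _ := by ring

theorem enorm_gradLambda_mul_coord_le {n : ℕ} (s : ℝ) (V : Rn n → ℂ) (k : Fin n) (ξ : Rn n) :
    ‖gradLambda s V ξ * (ξ k : ℂ)‖ₑ ≤ lambdaConst s * (‖ξ‖ₑ ^ (s + 1) * ‖V ξ‖ₑ) := by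
  rcases eq_or_ne ξ 0 with rfl | h
  · simp
  · have h1 : ‖(ξ k : ℂ)‖ₑ ≤ ‖ξ‖ₑ := by
      rw [← ofReal_norm, ← ofReal_norm, Complex.norm_real]
      exact ENNReal.ofReal_le_ofReal (abs_coord_le ξ k)
    rw [enorm_mul, ENNReal.rpow_add _ _ (enorm_ne_zero.2 h) enorm_ne_top, ENNReal.rpow_one]
    calc _ ≤ lambdaConst s * (‖ξ‖ₑ ^ s * ‖V ξ‖ₑ) * ‖ξ‖ₑ := by
          gcongr; exact enorm_gradLambda_le s V ξ
      _ = _ := by ring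

theorem hasDensity_partialD {n : ℕ} {v : 𝓢'(Rn n, ℂ)} {V : Rn n → ℂ} (hV : HasDensity (𝓕 v) V)
    (k : Fin n) : HasDensity (𝓕 (partialD k v)) fun ξ => gradLambda 0 V ξ * (ξ k : ℂ) := by
  intro h
  obtain ⟨h1, h2⟩ := hV (SchwartzMap.smulLeftCLM ℂ
    (fun ξ : Rn n => 2 * Real.pi * Complex.I * (ξ k : ℂ)) h)
  have e : ∀ ξ : Rn n, (2 * Real.pi * Complex.I * (ξ k : ℂ)) • h ξ * V ξ =
      h ξ * (gradLambda 0 V ξ * (ξ k : ℂ)) := by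
    intro ξ
    simp only [gradLambda, lambdaSymbol, Real.rpow_zero, Complex.ofReal_one, smul_eq_mul]
    ring
  simp_rw [SchwartzMap.smulLeftCLM_apply_apply (hasTemperateGrowth_gradSymbol k), e] at h1 h2
  exact ⟨h1, by rw [fourier_partialD, h2]⟩

theorem exists_hasDensity_of_lintegral {n : ℕ} {F : Rn n → ℂ} (hF : Measurable F) {a : ℝ}
    (ha : 0 ≤ a) (hn : 0 < n) (hfin : ∫⁻ ξ, ‖ξ‖ₑ ^ (-a) * ‖F ξ‖ₑ ≠ ⊤) :
    ∃ T : 𝓢'(Rn n, ℂ), HasDensity T F := by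
  obtain ⟨M, hM⟩ := exists_nat_ge a
  refine exists_hasDensity F hF.aestronglyMeasurable M ⟨by fun_prop, ?_⟩
  refine lt_of_le_of_lt (lintegral_mono_ae ?_) hfin.lt_top
  filter_upwards [ae_ne_zero hn] with ξ hξ
  have hp := norm_pos_iff.2 hξ
  rw [enorm_mul, enorm_norm, mul_comm, ← ofReal_norm ξ, ENNReal.ofReal_rpow_of_pos hp,
    Real.enorm_of_nonneg (by positivity)]
  gcongr
  rw [Real.rpow_neg hp.le]
  refine inv_anti₀ (by positivity) ?_
  rw [← Real.rpow_natCast]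
  exact (Real.rpow_le_rpow hp.le (by linarith) ha).trans
    (Real.rpow_le_rpow_of_exponent_le (by linarith) hM)

/-- The components of `∇Λ^s v`. -/
theorem exists_gradLambda {n : ℕ} (hn : 0 < n) (χ : LPCutoff n) {s : ℝ} (hs : -1 ≤ s)
    {v : 𝓢'(Rn n, ℂ)} {V : Rn n → ℂ} (hVm : Measurable V) (hV : HasDensity (𝓕 v) V)
    (hV' : annulusSum ((n : ℝ) / 2) (fun ξ => ‖V ξ‖ₑ) ≠ ⊤) (k : Fin n) :
    ∃ w : 𝓢'(Rn n, ℂ), HasDensity (𝓕 w) (fun ξ => gradLambda s V ξ * (ξ k : ℂ)) ∧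
      IsLambda s (partialD k v) w ∧ MemBesov χ ((n : ℝ) / 2 - s - 1) w := by
  set F : Rn n → ℂ := fun ξ => gradLambda s V ξ * (ξ k : ℂ) with hF
  have hFm : Measurable F := (measurable_gradLambda s hVm).mul (by fun_prop)
  have hK : lambdaConst s ≠ ⊤ := ENNReal.ofReal_ne_top
  have hFb := enorm_gradLambda_mul_coord_le s V k
  have hfin : ∫⁻ ξ, ‖ξ‖ₑ ^ (-(s + 1)) * ‖F ξ‖ₑ ≠ ⊤ := by
    refine ne_top_of_le_ne_top (ENNReal.mul_ne_top hK (ENNReal.mul_ne_top (bernsteinConst_ne_top n)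
      hV')) ?_
    refine le_trans ?_ (mul_le_mul' le_rfl (lintegral_le_annulusSum hn hVm.enorm.aemeasurable))
    rw [← lintegral_const_mul' _ _ hK]
    refine lintegral_mono_ae ?_
    filter_upwards [ae_ne_zero hn] with ξ hξ
    have h0 := enorm_ne_zero.2 hξ
    calc ‖ξ‖ₑ ^ (-(s + 1)) * ‖F ξ‖ₑ
        ≤ ‖ξ‖ₑ ^ (-(s + 1)) * (lambdaConst s * (‖ξ‖ₑ ^ (s + 1) * ‖V ξ‖ₑ)) := by
          gcongr; exact hFb ξ
      _ = lambdaConst s * ((‖ξ‖ₑ ^ (-(s + 1)) * ‖ξ‖ₑ ^ (s + 1)) * ‖V ξ‖ₑ) := by ring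
      _ = _ := by
          rw [← ENNReal.rpow_add _ _ h0 enorm_ne_top, neg_add_cancel, ENNReal.rpow_zero, one_mul]
  obtain ⟨T, hT⟩ := exists_hasDensity_of_lintegral hFm (by linarith) hn hfin
  have hw : HasDensity (𝓕 (𝓕⁻ T : 𝓢'(Rn n, ℂ))) F := by
    rwa [FourierTransform.fourier_fourierInv_eq]
  refine ⟨𝓕⁻ T, hw, ?_, tendsto_distLpNorm_lowFreq χ hn hFm.aestronglyMeasurable hw (by linarith) hfin, ?_⟩
  · intro m hm hmc hm0
    have h1 := hw.multiplier (HasCompactSupport.hasTemperateGrowth hmc hm)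
    have h2 := (hasDensity_partialD hV k).multiplier
      (hasTemperateGrowth_mul_lambdaSymbol s hm hmc hm0)
    have e : (fun ξ => m ξ * (lambdaSymbol s ξ : ℂ) * (gradLambda 0 V ξ * (ξ k : ℂ))) =
        fun ξ => m ξ * F ξ := by
      ext ξ
      simp only [hF]
      rw [← lambdaSymbol_mul_gradLambda_zero s]
      ring
    rw [e] at h2
    refine eq_of_fourier_apply_eq fun φ => ?_
    rw [h1.eq_of_density h2]
    rfl
  · refine (besovNorm_le_annulusSum χ _ hFm.aestronglyMeasurable hw.awayZero).trans_lt ?_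
    refine (ENNReal.mul_ne_top (shiftConst_ne_top _ _ _) ?_).lt_top
    have hm : Measurable fun ξ => ‖ξ‖ₑ ^ (s + 1) * ‖V ξ‖ₑ :=
      (measurable_enorm.pow_const _).mul hVm.enorm
    refine ne_top_of_le_ne_top ?_ (annulusSum_mono _ hFb)
    rw [annulusSum_const_mul _ _ hm.aemeasurable]
    refine ENNReal.mul_ne_top hK (ne_top_of_le_ne_top ?_
      (annulusSum_enorm_rpow_mul_le _ (s + 1) hVm.enorm.aemeasurable))
    rw [show (n : ℝ) / 2 - s - 1 + (s + 1) = n / 2 by ring]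
    exact ENNReal.mul_ne_top (two_rpow_ne_top _) hV'

/-! ### The commutator -/

/-- The integrand of the Fourier transform of `Λ^s (u · ∇v) - u · ∇Λ^s v` at the frequency `ξ`, as a
function of `(ξ, η)`: here `η` is the frequency of `u` and `ξ - η` that of `v`. -/
noncomputable def commutatorIntegrand {n : ℕ} (s : ℝ) (V : Rn n → ℂ) (g : Fin n → Rn n → ℂ)
    (q : Rn n × Rn n) : ℂ :=
  ((lambdaSymbol s q.1 : ℂ) - (lambdaSymbol s (q.1 - q.2) : ℂ)) *
    (gradLambda 0 V (q.1 - q.2) * ∑ k, ((q.1 - q.2) k : ℂ) * g k q.2)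

/-- The Fourier transform of `Λ^s (u · ∇v) - u · ∇Λ^s v`, away from the origin. -/
noncomputable def commutatorDensity {n : ℕ} (s : ℝ) (V : Rn n → ℂ) (g : Fin n → Rn n → ℂ)
    (ξ : Rn n) : ℂ := ∫ η, commutatorIntegrand s V g (ξ, η)

section Commutator

variable {n : ℕ} {s : ℝ} {V : Rn n → ℂ} {g : Fin n → Rn n → ℂ}

theorem measurable_commutatorIntegrand (hV : Measurable V) (hg : ∀ k, Measurable (g k)) :
    Measurable (commutatorIntegrand s V g) := by
  have hl : Measurable fun ξ : Rn n => (lambdaSymbol s ξ : ℂ) :=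
    Complex.measurable_ofReal.comp (measurable_lambdaSymbol s)
  have hs : Measurable fun q : Rn n × Rn n => q.1 - q.2 := measurable_fst.sub measurable_snd
  refine ((hl.comp measurable_fst).sub (hl.comp hs)).mul
    (((measurable_gradLambda 0 hV).comp hs).mul (Finset.measurable_fun_sum _ fun k _ => ?_))
  exact Measurable.mul (by fun_prop) ((hg k).comp measurable_snd)

theorem measurable_commutatorDensity (hV : Measurable V) (hg : ∀ k, Measurable (g k)) :
    Measurable (commutatorDensity s V g) :=
  ((measurable_commutatorIntegrand hV hg).stronglyMeasurable.integral_prod_right').measurable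

theorem enorm_commutatorDensity_le (hn : 0 < n) (hdiv : ∀ᵐ ξ : Rn n, ∑ k, (ξ k : ℂ) * g k ξ = 0)
    (ξ : Rn n) : ‖commutatorDensity s V g ξ‖ₑ ≤
      lambdaConst s * commOp s (gradSize g) (fun ξ => ‖V ξ‖ₑ) ξ := by
  refine (enorm_integral_le_lintegral_enorm _).trans ?_
  rw [commOp, ← lintegral_const_mul' _ _ (show lambdaConst s ≠ ⊤ from ENNReal.ofReal_ne_top)]
  refine lintegral_mono_ae ?_
  filter_upwards [hdiv, ae_ne_zero hn] with η hη h0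
  have h1 := enorm_sum_coord_mul_le (ξ - η) h0 hη
  rw [sub_add_cancel, min_comm] at h1
  have h2 : ‖(lambdaSymbol s ξ : ℂ) - (lambdaSymbol s (ξ - η) : ℂ)‖ₑ =
      ENNReal.ofReal ((2 * Real.pi) ^ s) * ‖‖ξ‖ ^ s - ‖ξ - η‖ ^ s‖ₑ := by
    rw [← Complex.ofReal_sub, lambdaSymbol_eq, lambdaSymbol_eq, ← mul_sub, ← ofReal_norm,
      Complex.norm_real, ofReal_norm, enorm_mul, Real.enorm_of_nonneg (by positivity)]
  have h3 : ‖gradLambda 0 V (ξ - η)‖ₑ = ENNReal.ofReal (2 * Real.pi) * ‖V (ξ - η)‖ₑ := by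
    rw [← enorm_two_pi_I_mul]
    simp [gradLambda, lambdaSymbol]
  rw [commutatorIntegrand, enorm_mul, enorm_mul, h2, h3, lambdaConst,
    ENNReal.ofReal_mul (p := (2 * Real.pi) ^ s) (by positivity), commKernel]
  calc _ ≤ ENNReal.ofReal ((2 * Real.pi) ^ s) * ‖‖ξ‖ ^ s - ‖ξ - η‖ ^ s‖ₑ *
        (ENNReal.ofReal (2 * Real.pi) * ‖V (ξ - η)‖ₑ *
          (min ‖ξ‖ₑ ‖ξ - η‖ₑ * ‖η‖ₑ⁻¹ * gradSize g η)) := by gcongr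
    _ = _ := by ring

/-- If `f` and `p` are the products `u · ∇v` and `u · ∇Λ^s v`, and `d` is given by the commutator
density, then `p + d` represents `Λ^s f`: for a test function `ψ` vanishing near the origin, the
integrands of the two sides agree up to a change of variables. -/
theorem isLambda_add_commutator (hV : Measurable V) (hg : ∀ k, Measurable (g k))
    {f p d : 𝓢'(Rn n, ℂ)} {c : Fin n → ℂ}
    (hf : ∀ h : 𝓢(Rn n, ℂ), Integrable (fun q : Rn n × Rn n =>
        (h (q.1 + q.2) - h q.1) * (gradLambda 0 V q.1 * ∑ k, (q.1 k : ℂ) * g k q.2)) ∧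
      𝓕 f h = (∑ k, c k * ∫ ζ, h ζ * (gradLambda 0 V ζ * (ζ k : ℂ))) + ∫ q : Rn n × Rn n,
        (h (q.1 + q.2) - h q.1) * (gradLambda 0 V q.1 * ∑ k, (q.1 k : ℂ) * g k q.2))
    (hp : ∀ h : 𝓢(Rn n, ℂ), Integrable (fun q : Rn n × Rn n =>
        (h (q.1 + q.2) - h q.1) * (gradLambda s V q.1 * ∑ k, (q.1 k : ℂ) * g k q.2)) ∧
      𝓕 p h = (∑ k, c k * ∫ ζ, h ζ * (gradLambda s V ζ * (ζ k : ℂ))) + ∫ q : Rn n × Rn n,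
        (h (q.1 + q.2) - h q.1) * (gradLambda s V q.1 * ∑ k, (q.1 k : ℂ) * g k q.2))
    (hd : HasDensityAwayZero (𝓕 d) (commutatorDensity s V g)) : IsLambda s f (p + d) := by
  intro m hm hmc hm0
  refine eq_of_fourier_apply_eq fun φ => ?_
  have hmt := HasCompactSupport.hasTemperateGrowth hmc hm
  have hmt' := hasTemperateGrowth_mul_lambdaSymbol s hm hmc hm0
  set ψ := SchwartzMap.smulLeftCLM ℂ m φ with hψ
  set ψ' := SchwartzMap.smulLeftCLM ℂ (fun ξ => m ξ * (lambdaSymbol s ξ : ℂ)) φ with hψ'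
  have e1 : ∀ ξ, ψ' ξ = (lambdaSymbol s ξ : ℂ) * ψ ξ := by
    intro ξ
    rw [hψ, hψ', SchwartzMap.smulLeftCLM_apply_apply hmt, SchwartzMap.smulLeftCLM_apply_apply hmt',
      smul_eq_mul, smul_eq_mul]
    ring
  have hψ0 : ψ 0 = 0 := by
    rw [hψ, SchwartzMap.smulLeftCLM_apply_apply hmt, image_eq_zero_of_notMem_tsupport hm0, zero_smul]
  have e2 : 𝓕 (p + d) ψ = 𝓕 p ψ + 𝓕 d ψ := by
    simp only [TemperedDistribution.fourier_apply, _root_.add_apply]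
  have e3 : 𝓕 (TemperedDistribution.fourierMultiplierCLM ℂ
      (fun ξ => m ξ * (((2 * Real.pi * ‖ξ‖) ^ s : ℝ) : ℂ)) f) φ = 𝓕 f ψ' := by
    rw [fourier_fourierMultiplierCLM]
    rfl
  rw [fourier_fourierMultiplierCLM, ← hψ, e2, e3, (hf ψ').2, (hp ψ).2, (hd ψ hψ0).2, add_assoc]
  congr 1
  · refine Finset.sum_congr rfl fun k _ => ?_
    congr 1
    refine integral_congr_ae (Eventually.of_forall fun ζ => ?_)
    simp only [e1]
    rw [← lambdaSymbol_mul_gradLambda_zero s]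
    ring
  · set H : Rn n × Rn n → ℂ := fun q => ψ q.1 * commutatorIntegrand s V g q with hH
    have hHm : AEStronglyMeasurable H :=
      (ψ.continuous.comp continuous_fst).aestronglyMeasurable.mul
        (measurable_commutatorIntegrand hV hg).aestronglyMeasurable
    have hdiff : ∀ q : Rn n × Rn n, H (q.1 + q.2, q.2) =
        (ψ' (q.1 + q.2) - ψ' q.1) * (gradLambda 0 V q.1 * ∑ k, (q.1 k : ℂ) * g k q.2) -
        (ψ (q.1 + q.2) - ψ q.1) * (gradLambda s V q.1 * ∑ k, (q.1 k : ℂ) * g k q.2) := by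
      intro q
      simp only [hH, commutatorIntegrand, add_sub_cancel_right, e1]
      rw [← lambdaSymbol_mul_gradLambda_zero s]
      ring
    have hmp : MeasurePreserving (fun q : Rn n × Rn n => (q.1 + q.2, q.2)) volume volume :=
      measurePreserving_add_prod volume volume
    have hmp' : MeasurePreserving (fun q : Rn n × Rn n => (q.1 - q.2, q.2)) volume volume :=
      measurePreserving_sub_prod volume volume
    have hHi' : Integrable fun q : Rn n × Rn n => H (q.1 + q.2, q.2) := by
      simp_rw [hdiff]
      exact (hf ψ').1.sub (hp ψ).1
    have hHi : Integrable H := by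
      have := hmp'.integrable_comp_of_integrable hHi'
      simpa [Function.comp_def] using this
    have e4 : ∫ ξ, ψ ξ * commutatorDensity s V g ξ = ∫ q : Rn n × Rn n, H (q.1 + q.2, q.2) := by
      have e5 : ∫ q : Rn n × Rn n, H (q.1 + q.2, q.2) = ∫ q, H q := by
        rw [← integral_map hmp.measurable.aemeasurable (by rw [hmp.map_eq]; exact hHm), hmp.map_eq]
      rw [e5, Measure.volume_eq_prod, integral_prod _ hHi]
      refine integral_congr_ae (Eventually.of_forall fun ξ => ?_)
      simp only [hH, commutatorDensity]
      rw [integral_const_mul]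
    rw [e4]
    simp_rw [hdiff]
    rw [integral_sub (hf ψ').1 (hp ψ).1]
    ring

end Commutator

theorem lemma2p5 (n : ℕ) (hn : 2 ≤ n) (s : ℝ) (hs : -1 ≤ s) (hs' : s < (n : ℝ) + 1)
    (χ : LPCutoff n) :
    ∃ C : ℝ≥0, ∀ (u : Fin n → 𝓢'(Rn n, ℂ)) (v : 𝓢'(Rn n, ℂ)),
      MemBesov χ ((n : ℝ) / 2) v →
      (∀ i k, MemBesov χ ((n : ℝ) / 2) (partialD k (u i))) →
      ∑ k : Fin n, partialD k (u k) = 0 →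
      -- `f = u · ∇v`, `w = ∇Λ^s v`, `p = u · ∇Λ^s v`, `g = Λ^s (u · ∇v)`
      ∃ (f : 𝓢'(Rn n, ℂ)) (w : Fin n → 𝓢'(Rn n, ℂ)) (p g : 𝓢'(Rn n, ℂ)),
        IsDotProduct χ u (fun k => partialD k v) f ∧
        (∀ k, IsLambda s (partialD k v) (w k) ∧ MemBesov χ ((n : ℝ) / 2 - s - 1) (w k)) ∧
        IsDotProduct χ u w p ∧
        IsLambda s f g ∧
        besovNorm χ ((n : ℝ) / 2 - s) (g - p) ≤
          C * gradBesovNorm χ ((n : ℝ) / 2) u * besovNorm χ ((n : ℝ) / 2) v ∧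
        (0 ≤ s → MemBesov χ ((n : ℝ) / 2 - s) (g - p)) := by
  have hn0 : 0 < n := by omega
  -- the gain `θ` in the high-high interaction, which makes the sum over output frequencies converge
  set θ : ℝ := min 1 (1 - s) with hθ
  have hθn : 0 < n + θ := by
    have : (0 : ℝ) ≤ n := Nat.cast_nonneg n
    rw [hθ]
    rcases min_cases 1 (1 - s) with h | h <;> linarith [h.1]
  have hθ1 : θ ≤ 1 := min_le_left _ _
  have hθs : θ ≤ 1 - s := min_le_right _ _
  set C₁ : ℝ≥0∞ := shiftConst 1 6 ((n : ℝ) / 2) with hC₁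
  have hC₁t : C₁ ≠ ⊤ := shiftConst_ne_top _ _ _
  set C₂ : ℝ≥0∞ := lambdaConst s * commConst n s θ with hC₂
  have hC₂t : C₂ ≠ ⊤ := ENNReal.mul_ne_top ENNReal.ofReal_ne_top (commConst_ne_top hθn)
  set C : ℝ≥0∞ := shiftConst (-4) (-1) ((n : ℝ) / 2 - s) * (C₂ * (C₁ * C₁)) with hC
  have hCt : C ≠ ⊤ := ENNReal.mul_ne_top (shiftConst_ne_top _ _ _)
    (ENNReal.mul_ne_top hC₂t (ENNReal.mul_ne_top hC₁t hC₁t))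
  refine ⟨C.toNNReal, fun u v hv hu hdiv => ?_⟩
  obtain ⟨V, hVm, hVd, hVn⟩ := exists_density_of_memBesov hn0 χ v hv
  obtain ⟨c, g, hgm, hgn, hgdiv, hgu⟩ := exists_symbols_of_memBesov_gradient hn0 χ hu hdiv
  have hVt : annulusSum ((n : ℝ) / 2) (fun ξ => ‖V ξ‖ₑ) ≠ ⊤ :=
    ne_top_of_le_ne_top (ENNReal.mul_ne_top hC₁t hv.2.ne) hVn
  have hgt : annulusSum ((n : ℝ) / 2) (gradSize g) ≠ ⊤ := by
    refine ne_top_of_le_ne_top (ENNReal.mul_ne_top hC₁t ?_) hgn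
    exact ENNReal.sum_ne_top.2 fun i _ => ENNReal.sum_ne_top.2 fun k _ => (hu i k).2.ne
  choose w hwd hwL hwB using fun k => exists_gradLambda hn0 χ hs hVm hVd hVt k
  obtain ⟨f, hf, hff⟩ := exists_isDotProduct hn0 χ (s := 0) (by norm_num) (by positivity) hgm hgt
    hgdiv hgu (measurable_gradLambda 0 hVm) hVm.enorm hVt ENNReal.ofReal_ne_top
    (enorm_gradLambda_le 0 V) fun k => hasDensity_partialD hVd k
  obtain ⟨p, hp, hpf⟩ := exists_isDotProduct hn0 χ hs hs'.le hgm hgt hgdiv hgu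
    (measurable_gradLambda s hVm) hVm.enorm hVt ENNReal.ofReal_ne_top (enorm_gradLambda_le s V) hwd
  set F := commutatorDensity s V g with hF
  have hFm : Measurable F := measurable_commutatorDensity hVm hgm
  have hFn : annulusSum ((n : ℝ) / 2 - s) (fun ξ => ‖F ξ‖ₑ) ≤
      C₂ * (annulusSum ((n : ℝ) / 2) (gradSize g) *
        annulusSum ((n : ℝ) / 2) (fun ξ => ‖V ξ‖ₑ)) := by
    refine (annulusSum_mono _ (enorm_commutatorDensity_le hn0 hgdiv)).trans ?_
    rw [annulusSum_const_mul _ _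
      (measurable_commOp s (measurable_gradSize hgm) hVm.enorm).aemeasurable, hC₂, mul_assoc]
    gcongr
    exact annulusSum_commOp_le hn0 hs hθ1 hθs (measurable_gradSize hgm) hVm.enorm
  have hFt : annulusSum ((n : ℝ) / 2 - s) (fun ξ => ‖F ξ‖ₑ) ≠ ⊤ :=
    ne_top_of_le_ne_top (ENNReal.mul_ne_top hC₂t (ENNReal.mul_ne_top hgt hVt)) hFn
  have hFi : ∫⁻ ξ, ‖ξ‖ₑ ^ (-s) * ‖F ξ‖ₑ ≠ ⊤ := by
    refine ne_top_of_le_ne_top ?_ (lintegral_enorm_rpow_mul_le hn0 hFm.enorm.aemeasurable (-s))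
    rw [← sub_eq_add_neg]
    exact ENNReal.mul_ne_top (ENNReal.mul_ne_top (two_rpow_ne_top _) (bernsteinConst_ne_top n)) hFt
  -- for `s < 0` the density may fail to be integrable at the origin and has to be regularised
  obtain ⟨T, hT, hT'⟩ : ∃ T : 𝓢'(Rn n, ℂ), HasDensityAwayZero T F ∧ (0 ≤ s → HasDensity T F) := by
    rcases le_or_gt 0 s with h0 | h0
    · obtain ⟨T, hT⟩ := exists_hasDensity_of_lintegral hFm h0 hn0 hFi
      exact ⟨T, hT.awayZero, fun _ => hT⟩
    · obtain ⟨T, hT⟩ := exists_regularized F hFm.aestronglyMeasurable (θ := -s) (by linarith)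
        (by linarith) (by
          refine ⟨by fun_prop, lt_of_le_of_lt (lintegral_mono fun ξ => ?_) hFi.lt_top⟩
          rw [enorm_mul, enorm_norm, mul_comm]
          gcongr
          exact enorm_norm_rpow_le _ _)
      refine ⟨T, fun h hh => ?_, fun h => absurd h (not_le.2 h0)⟩
      simpa [hh] using hT h
  have hTF : 𝓕 (𝓕⁻ T : 𝓢'(Rn n, ℂ)) = T := FourierTransform.fourier_fourierInv_eq _
  refine ⟨f, w, p, p + 𝓕⁻ T, hf, fun k => ⟨hwL k, hwB k⟩, hp, ?_, ?_, ?_⟩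
  · exact isLambda_add_commutator hVm hgm hff hpf (by rwa [hTF])
  · rw [add_sub_cancel_left, ENNReal.coe_toNNReal hCt]
    calc besovNorm χ ((n : ℝ) / 2 - s) (𝓕⁻ T)
        ≤ shiftConst (-4) (-1) ((n : ℝ) / 2 - s) *
          annulusSum ((n : ℝ) / 2 - s) (fun ξ => ‖F ξ‖ₑ) :=
          besovNorm_le_annulusSum χ _ hFm.aestronglyMeasurable (by rwa [hTF])
      _ ≤ shiftConst (-4) (-1) ((n : ℝ) / 2 - s) * (C₂ *
          ((C₁ * gradBesovNorm χ ((n : ℝ) / 2) u) * (C₁ * besovNorm χ ((n : ℝ) / 2) v))) := by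
          gcongr
          exact hFn.trans (by gcongr)
      _ = _ := by rw [hC]; ring
  · intro h0
    rw [add_sub_cancel_left]
    refine ⟨tendsto_distLpNorm_lowFreq χ hn0 hFm.aestronglyMeasurable (by rw [hTF]; exact hT' h0) h0
      hFi, ?_⟩
    refine (besovNorm_le_annulusSum χ _ hFm.aestronglyMeasurable (by rwa [hTF])).trans_lt ?_
    exact (ENNReal.mul_ne_top (shiftConst_ne_top _ _ _) hFt).lt_top
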